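/- Let $\mathbb{K}$ be a field and let $\mathcal{A}$ be a cohomologically unital $A_\infty$-category over $\mathbb{K}$ with finite-dimensional $\mathbb{Z}$-graded morphism spaces. Write $H(\mathcal{A})$ for its cohomological category, with composition $[a_2]\cdot[a_1]=(-1)^{|a_1|}[\mu^2(a_2,a_1)]$, and $D\mathcal{A}=H^0(Tw\,\mathcal{A})$ for its derived category, where $Tw\,\mathcal{A}$ is the $A_\infty$-category of twisted complexes in $\mathcal{A}$; let $[i]$ be the shift in $D\mathcal{A}$. Let $n\ge 0$ and let $(V,h)$ be a $\mathbb{C}\mathbb{P}^n$-object of $\mathcal{A}$, that is, $V$ is an object of $\mathcal{A}$ and $h\in\hom^2_{\mathcal{A}}(V,V)$ is such that - $\mu^1(h)=0$; - $\hom_{H(\mathcal{A})}(V,V)\cong\mathbb{K}[x]/(x^{n+1})$ as a graded $\mathbb{K}$-algebra, by an isomorphism that takes $[h]$ to $x$ (of degree $2$); - there is a linear map $\int\colon\hom^{2n}_{H(\mathcal{A})}(V,V)\to\mathbb{K}$ such that, for every object $X$ of $\mathcal{A}$ and every $k\in\mathbb{Z}$, the bilinear map $\hom^{2n-k}_{H(\mathcal{A})}(X,V)\times\hom^{k}_{H(\mathcal{A})}(V,X)\to\hom^{2n}_{H(\mathcal{A})}(V,V)\xrightarrow{\int}\mathbb{K}$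 is nondegenerate. Regard $V$ as an object of $D\mathcal{A}$, put $V^{\perp}=\{B\in D\mathcal{A} : \hom_{D\mathcal{A}}(V,B[i])=0 \text{ for all } i\in\mathbb{Z}\}$ and $\Omega=\{V\}\cup V^{\perp}$. Then $\Omega$ is a spanning class in $D\mathcal{A}$: it contains a nonzero object, and for every $B\in D\mathcal{A}$, - if $\hom_{D\mathcal{A}}(A,B[i])=0$ for all $A\in\Omega$ and all $i\in\mathbb{Z}$, then $B\simeq 0$; - if $\hom_{D\mathcal{A}}(B[i],A)=0$ for all $A\in\Omega$ and all $i\in\mathbb{Z}$, then $B\simeq 0$. -/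

import Mathlib

open CategoryTheory Quiver
open scoped Polynomial

universe w u v

/-! ### Graded quivers with multilinear operations -/

/-- A set of objects, a `K`-vector space `X ⟶ Y` of morphisms with subspaces `gr X Y k` (the elements
of degree `k`) for any two objects, and multilinear operations `μ`, one for every composable sequence.
A composable sequence `a₁ : X₀ ⟶ X₁, …, a_d : X_{d-1} ⟶ X_d` is a path `(a₁, …, a_d)` from `X₀` to
`X_d` in the quiver of morphisms, and its value under `μ` is written `μ^d(a_d, …, a₁)`.
There is no `μ^0`: `μ` is zero on paths of length zero. No further law is imposed here. -/
structure AInfData (K : Type w) [Field K] where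
  Ob : Type u
  [quiver : Quiver.{v} Ob]
  [addCommGroup : ∀ X Y : Ob, AddCommGroup (X ⟶ Y)]
  [module : ∀ X Y : Ob, Module K (X ⟶ Y)]
  gr : ∀ X Y : Ob, ℤ → Submodule K (X ⟶ Y)
  μ : ∀ {X Y : Ob}, Path X Y → (X ⟶ Y)
  μ_nil : ∀ X : Ob, μ (Path.nil : Path X X) = 0
  μ_add : ∀ {W X Y Z : Ob} (p : Path W X) (a b : X ⟶ Y) (q : Path Y Z),
    μ ((p.cons (a + b)).comp q) = μ ((p.cons a).comp q) + μ ((p.cons b).comp q)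
  μ_smul : ∀ {W X Y Z : Ob} (p : Path W X) (c : K) (a : X ⟶ Y) (q : Path Y Z),
    μ ((p.cons (c • a)).comp q) = c • μ ((p.cons a).comp q)

attribute [instance] AInfData.quiver AInfData.addCommGroup AInfData.module

/-- The sum of `F p₁ p₂` over all decompositions of the path `p` as `p₁` followed by `p₂`. -/
def sumSplit {V : Type*} [Quiver V] {M : Type*} [AddCommGroup M] {X : V} :
    ∀ {Z : V}, Path X Z → (∀ Y : V, Path X Y → Path Y Z → M) → M
  | _, .nil, F => F _ .nil .nil
  | _, .cons p a, F => F _ (p.cons a) .nil + sumSplit p (fun Y p₁ p₂ => F Y p₁ (p₂.cons a))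

section Twist

variable {K : Type w} [Field K] {M : Type*} [AddCommGroup M] [Module K M]

/-- The linear map that is multiplication by `(-1) ^ (n (k - 1))` in degree `k`. -/
noncomputable def signTwist (g : ℤ → Submodule K M) (hg : DirectSum.IsInternal g) (n : ℤ) :
    M →ₗ[K] M :=
  (DirectSum.toModule K ℤ M fun k => (((n * (k - 1)).negOnePow : ℤ) : K) • (g k).subtype) ∘ₗ
    (LinearEquiv.ofBijective (DirectSum.coeLinearMap g) hg).symm.toLinearMap

theorem signTwist_apply (g : ℤ → Submodule K M) (hg : DirectSum.IsInternal g) (n k : ℤ) {x : M}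
    (hx : x ∈ g k) : signTwist g hg n x = (((n * (k - 1)).negOnePow : ℤ) : K) • x := by
  have h : (LinearEquiv.ofBijective (DirectSum.coeLinearMap g) hg).symm x
      = DirectSum.lof K ℤ (fun k => g k) k ⟨x, hx⟩ := by
    rw [LinearEquiv.symm_apply_eq]
    exact (DirectSum.coeLinearMap_lof g k ⟨x, hx⟩).symm
  rw [signTwist, LinearMap.comp_apply, LinearEquiv.coe_coe, h, DirectSum.toModule_lof]
  rfl

/-- Linear maps agreeing on homogeneous elements are equal. -/
theorem eq_of_homogeneous {N : Type*} [AddCommGroup N] [Module K N] (g : ℤ → Submodule K M)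
    (hg : DirectSum.IsInternal g) {f f' : M →ₗ[K] N} (h : ∀ k, ∀ x ∈ g k, f x = f' x) (x : M) :
    f x = f' x := by
  have hx : x ∈ ⨆ k, g k := by rw [hg.submodule_iSup_eq_top]; trivial
  induction hx using Submodule.iSup_induction' with
  | mem k x hx => exact h k x hx
  | zero => simp
  | add x y _ _ hx hy => simp [hx, hy]

end Twist

namespace AInfData

variable {K : Type w} [Field K] (A : AInfData.{w, u, v} K)

/-- `HasRedDeg p r`: the entries `a₁, …, a_d` of `p` are homogeneous and
`r = (|a₁| - 1) + ⋯ + (|a_d| - 1)`. -/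
def HasRedDeg {X : A.Ob} : ∀ {Y : A.Ob}, Path X Y → ℤ → Prop
  | _, .nil, r => r = 0
  | _, .cons (b := Y) (c := Z) p a, r => ∃ k : ℤ, a ∈ A.gr Y Z k ∧ HasRedDeg p (r - (k - 1))

/-- `(a₁, …, a_d) ↦ ((-1)^(|a₁| - 1) a₁, …, (-1)^(|a_d| - 1) a_d)`. -/
noncomputable def pathSign (hA : ∀ X Y, DirectSum.IsInternal (A.gr X Y)) {X : A.Ob} :
    ∀ {Y : A.Ob}, Path X Y → Path X Y
  | _, .nil => .nil
  | _, .cons (b := Y) (c := Z) p a =>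
    (pathSign hA p).cons (signTwist (A.gr Y Z) (hA Y Z) 1 a)

/-- The differential `μ^1`. -/
def d (X Y : A.Ob) : (X ⟶ Y) →ₗ[K] (X ⟶ Y) where
  toFun a := A.μ a.toPath
  map_add' a b := A.μ_add .nil a b .nil
  map_smul' c a := A.μ_smul .nil c a .nil

/-- `a₁ ↦ a₂ ↦ μ^2(a₂, a₁)`. -/
def μ₂ (X Y Z : A.Ob) : (X ⟶ Y) →ₗ[K] (Y ⟶ Z) →ₗ[K] (X ⟶ Z) :=
  LinearMap.mk₂ K (fun a b => A.μ (a.toPath.cons b))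
    (fun a a' b => A.μ_add .nil a a' b.toPath) (fun c a b => A.μ_smul .nil c a b.toPath)
    (fun a b b' => A.μ_add a.toPath b b' .nil) (fun c a b => A.μ_smul a.toPath c b .nil)

/-- The boundaries, as a subspace of the space of cocycles. -/
def boundaries (X Y : A.Ob) : Submodule K (LinearMap.ker (A.d X Y)) :=
  (LinearMap.range (A.d X Y)).comap (LinearMap.ker (A.d X Y)).subtype

/-- The total cohomology of the morphism space `X ⟶ Y` with respect to `μ^1`. -/
abbrev H (X Y : A.Ob) : Type v := LinearMap.ker (A.d X Y) ⧸ A.boundaries X Y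

/-- The class of a cocycle. -/
def cls {X Y : A.Ob} (a : X ⟶ Y) (ha : A.d X Y a = 0) : A.H X Y :=
  (A.boundaries X Y).mkQ ⟨a, ha⟩

/-- The degree `k` part of the cohomology: the classes of cocycles of degree `k`. -/
def Hgr (X Y : A.Ob) (k : ℤ) : Submodule K (A.H X Y) :=
  ((A.gr X Y k).comap (LinearMap.ker (A.d X Y)).subtype).map (A.boundaries X Y).mkQ

end AInfData

/-! ### `A_∞`-categories -/

/-- An `A_∞`-category over `K` (units are treated separately): finite-dimensional graded morphism
spaces, `μ^d` of degree `2 - d`, and the `A_∞`-relations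
`∑ (-1)^(|a₁| + ⋯ + |aₙ| - n) μ(a_d, …, a_{n+m+1}, μ^m(a_{n+m}, …, a_{n+1}), aₙ, …, a₁) = 0`. -/
structure AInfCategory (K : Type w) [Field K] extends AInfData.{w, u, v} K where
  gr_internal : ∀ X Y : Ob, DirectSum.IsInternal (gr X Y)
  finite : ∀ X Y : Ob, Module.Finite K (X ⟶ Y)
  μ_mem : ∀ {X Y : Ob} (p : Path X Y) (r : ℤ), toAInfData.HasRedDeg p r → μ p ∈ gr X Y (r + 2)
  relation : ∀ {X Y : Ob} (p : Path X Y),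
    (sumSplit p fun _ p₁ r => sumSplit r fun _ q p₂ =>
      μ (((toAInfData.pathSign gr_internal p₁).cons (μ q)).comp p₂)) = 0

namespace AInfCategory

variable {K : Type w} [Field K] (A : AInfCategory.{w, u, v} K)

/-- `a ↦ (-1)^(|a| - 1) a`. -/
noncomputable abbrev ε (X Y : A.Ob) : (X ⟶ Y) →ₗ[K] (X ⟶ Y) :=
  signTwist (A.gr X Y) (A.gr_internal X Y) 1

theorem ε_apply {X Y : A.Ob} {k : ℤ} {a : X ⟶ Y} (ha : a ∈ A.gr X Y k) :
    A.ε X Y a = (((k - 1).negOnePow : ℤ) : K) • a := by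
  simpa using signTwist_apply (A.gr X Y) (A.gr_internal X Y) 1 k ha

theorem d_mem {X Y : A.Ob} {k : ℤ} {a : X ⟶ Y} (ha : a ∈ A.gr X Y k) :
    A.d X Y a ∈ A.gr X Y (k + 1) := by
  have := A.μ_mem a.toPath (k - 1) ⟨k, ha, by simp [AInfData.HasRedDeg]⟩
  rwa [show k - 1 + 2 = k + 1 by ring] at this

theorem μ₂_mem {X Y Z : A.Ob} {k l : ℤ} {a : X ⟶ Y} {b : Y ⟶ Z} (ha : a ∈ A.gr X Y k)
    (hb : b ∈ A.gr Y Z l) : A.μ₂ X Y Z a b ∈ A.gr X Z (k + l) := by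
  have := A.μ_mem (a.toPath.cons b) (k + l - 2)
    ⟨l, hb, k, ha, by simp [AInfData.HasRedDeg]; ring⟩
  rwa [show k + l - 2 + 2 = k + l by ring] at this

theorem ε_ε {X Y : A.Ob} (a : X ⟶ Y) : A.ε X Y (A.ε X Y a) = a := by
  refine eq_of_homogeneous (A.gr X Y) (A.gr_internal X Y) (f := A.ε X Y ∘ₗ A.ε X Y)
    (f' := LinearMap.id) (fun k x hx => ?_) a
  simp only [LinearMap.comp_apply, A.ε_apply hx, map_smul, smul_smul, LinearMap.id_apply]
  rw [← Int.cast_mul, ← Units.val_mul, Int.units_mul_self]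
  simp

theorem d_ε {X Y : A.Ob} (a : X ⟶ Y) : A.d X Y (A.ε X Y a) = - A.ε X Y (A.d X Y a) := by
  refine eq_of_homogeneous (A.gr X Y) (A.gr_internal X Y) (f := A.d X Y ∘ₗ A.ε X Y)
    (f' := -(A.ε X Y ∘ₗ A.d X Y)) (fun k x hx => ?_) a
  simp only [LinearMap.comp_apply, LinearMap.neg_apply, A.ε_apply hx, A.ε_apply (A.d_mem hx),
    map_smul]
  rw [show k + 1 - 1 = (k - 1) + 1 by ring, Int.negOnePow_succ]
  simp

theorem ε_μ₂ {X Y Z : A.Ob} (a : X ⟶ Y) (b : Y ⟶ Z) :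
    A.ε X Z (A.μ₂ X Y Z a b) = - A.μ₂ X Y Z (A.ε X Y a) (A.ε Y Z b) := by
  refine eq_of_homogeneous (A.gr X Y) (A.gr_internal X Y)
    (f := A.ε X Z ∘ₗ (A.μ₂ X Y Z).flip b)
    (f' := -((A.μ₂ X Y Z).flip (A.ε Y Z b) ∘ₗ A.ε X Y)) (fun k x hx => ?_) a
  refine eq_of_homogeneous (A.gr Y Z) (A.gr_internal Y Z)
    (f := A.ε X Z ∘ₗ (A.μ₂ X Y Z x))
    (f' := -((A.μ₂ X Y Z (A.ε X Y x)) ∘ₗ A.ε Y Z)) (fun l y hy => ?_) b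
  simp only [LinearMap.comp_apply, LinearMap.neg_apply, A.ε_apply hx, A.ε_apply hy,
    A.ε_apply (A.μ₂_mem hx hy), map_smul, LinearMap.smul_apply, smul_smul]
  rw [show k + l - 1 = (l - 1) + (k - 1) + 1 by ring, Int.negOnePow_succ, Int.negOnePow_add]
  simp

theorem relation₂ {X Y Z : A.Ob} (a : X ⟶ Y) (b : Y ⟶ Z) :
    A.d X Z (A.μ₂ X Y Z a b) + A.μ₂ X Y Z (A.d X Y a) b
      + A.μ₂ X Y Z (A.ε X Y a) (A.d Y Z b) = 0 := by
  have h := A.relation (a.toPath.cons b)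
  have h0 : ∀ {U V W : A.Ob} (p : Path U V) (q : Path V W),
      A.μ ((p.cons (0 : V ⟶ V)).comp q) = 0 := fun p q => by
    simpa using A.μ_smul p (0 : K) (0 : _ ⟶ _) q
  have h1 := @h0 _ _ _ ((A.pathSign A.gr_internal (a.toPath)).cons (A.ε _ _ b)) .nil
  have h2 := h0 (A.pathSign A.gr_internal (a.toPath)) b.toPath
  have h3 := h0 (.nil : Path X X) (a.toPath.cons b)
  simp only [sumSplit, Hom.toPath, AInfData.pathSign, A.μ_nil, Path.comp_cons, Path.comp_nil]
    at h h1 h2 h3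
  rw [h1, h2, h3] at h
  rw [← h]
  simp only [AInfData.d, AInfData.μ₂, Hom.toPath, LinearMap.mk₂_apply, LinearMap.coe_mk,
    AddHom.coe_mk]
  abel

theorem relation₃ {W X Y Z : A.Ob} (a : W ⟶ X) (b : X ⟶ Y) (c : Y ⟶ Z)
    (ha : A.d _ _ a = 0) (hb : A.d _ _ b = 0) (hc : A.d _ _ c = 0) :
    A.d W Z (A.μ ((a.toPath.cons b).cons c)) + A.μ₂ W Y Z (A.μ₂ W X Y a b) c
      + A.μ₂ W X Z (A.ε W X a) (A.μ₂ X Y Z b c) = 0 := by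
  have h := A.relation ((a.toPath.cons b).cons c)
  have h0 : ∀ {U V V' W : A.Ob} (p : Path U V) (q : Path V' W),
      A.μ ((p.cons (0 : V ⟶ V')).comp q) = 0 := fun p q => by
    simpa using A.μ_smul p (0 : K) (0 : _ ⟶ _) q
  have h1 := @h0 _ _ _ _ (A.pathSign A.gr_internal ((a.toPath.cons b).cons c))
    (.nil : Path Z Z)
  have h2 := @h0 _ _ _ _ (A.pathSign A.gr_internal (a.toPath.cons b)) (c.toPath)
  have h3 := @h0 _ _ _ _ (A.pathSign A.gr_internal a.toPath) (b.toPath.cons c)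
  have h4 := @h0 _ _ _ _ (.nil : Path W W) ((a.toPath.cons b).cons c)
  have h5 := @h0 _ _ _ _ (A.pathSign A.gr_internal (a.toPath.cons b)) (.nil : Path Z Z)
  have h6 := @h0 _ _ _ _ (A.pathSign A.gr_internal a.toPath) c.toPath
  have h7 := @h0 _ _ _ _ (.nil : Path W W) (b.toPath.cons c)
  simp only [AInfData.d, Hom.toPath, LinearMap.coe_mk, AddHom.coe_mk] at ha hb hc
  simp only [sumSplit, Hom.toPath, AInfData.pathSign, A.μ_nil, Path.comp_cons, Path.comp_nil,
    ha, hb, hc] at h h1 h2 h3 h4 h5 h6 h7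
  rw [h1, h2, h3, h4, h5, h6, h7] at h
  rw [← h]
  simp only [AInfData.d, AInfData.μ₂, Hom.toPath, LinearMap.mk₂_apply, LinearMap.coe_mk,
    AddHom.coe_mk]
  abel

/-- `[a₂] · [a₁] = (-1)^|a₁| [μ^2(a₂, a₁)]`, on cochains. -/
noncomputable def cochainComp (X Y Z : A.Ob) : (X ⟶ Y) →ₗ[K] (Y ⟶ Z) →ₗ[K] (X ⟶ Z) :=
  -(A.μ₂ X Y Z ∘ₗ A.ε X Y)

theorem cochainComp_apply {X Y Z : A.Ob} {k : ℤ} {a₁ : X ⟶ Y} (ha : a₁ ∈ A.gr X Y k)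
    (a₂ : Y ⟶ Z) : A.cochainComp X Y Z a₁ a₂ =
      ((k.negOnePow : ℤ) : K) • A.μ (a₁.toPath.cons a₂) := by
  simp [cochainComp, A.ε_apply ha, Int.negOnePow_sub]
  rfl

theorem d_cochainComp {X Y Z : A.Ob} (a : X ⟶ Y) (b : Y ⟶ Z) :
    A.d X Z (A.cochainComp X Y Z a b) =
      A.μ₂ X Y Z a (A.d Y Z b) + A.cochainComp X Y Z (A.d X Y a) b := by
  have h := A.relation₂ (A.ε X Y a) b
  rw [A.d_ε, A.ε_ε] at h
  simp only [cochainComp, LinearMap.neg_apply, LinearMap.comp_apply, map_neg] at h ⊢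
  rw [← sub_eq_zero, ← neg_eq_zero, ← h]
  abel

/-- The composition of cocycles, with values in cohomology. -/
noncomputable def cocycleComp (X Y Z : A.Ob) :
    LinearMap.ker (A.d X Y) →ₗ[K] LinearMap.ker (A.d Y Z) →ₗ[K] A.H X Z :=
  LinearMap.mk₂ K
    (fun a b => A.cls (A.cochainComp X Y Z a b)
      (by rw [A.d_cochainComp, a.2, b.2]; simp))
    (fun a a' b => by
      simp only [AInfData.cls, ← map_add]; congr 1; ext; simp)
    (fun c a b => by
      simp only [AInfData.cls, ← map_smul]; congr 1; ext; simp)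
    (fun a b b' => by
      simp only [AInfData.cls, ← map_add]; congr 1; ext; simp)
    (fun c a b => by
      simp only [AInfData.cls, ← map_smul]; congr 1; ext; simp)

theorem cls_eq_cls {X Y : A.Ob} {a b : X ⟶ Y} (ha : A.d X Y a = 0) (hb : A.d X Y b = 0) :
    A.cls a ha = A.cls b hb ↔ ∃ c, A.d X Y c = a - b := by
  rw [AInfData.cls, AInfData.cls, ← sub_eq_zero, ← map_sub, Submodule.mkQ_apply,
    Submodule.Quotient.mk_eq_zero]
  rfl

theorem cls_eq_zero {X Y : A.Ob} {a : X ⟶ Y} (ha : A.d X Y a = 0) :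
    A.cls a ha = 0 ↔ ∃ c, A.d X Y c = a := by
  rw [AInfData.cls, Submodule.mkQ_apply, Submodule.Quotient.mk_eq_zero]
  rfl

/-- Composition in the cohomological category. -/
noncomputable def hComp (X Y Z : A.Ob) : A.H X Y →ₗ[K] A.H Y Z →ₗ[K] A.H X Z :=
  ((A.boundaries Y Z).liftQ
    ((A.boundaries X Y).liftQ (A.cocycleComp X Y Z) (by
      rintro ⟨a, ha⟩ ⟨x, hx⟩
      ext ⟨b, hb⟩
      refine (A.cls_eq_zero _).2 ⟨A.cochainComp X Y Z x b, ?_⟩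
      have hx' : A.d X Y x = a := hx
      have hb' : A.d Y Z b = 0 := hb
      simp [A.d_cochainComp, hx', hb'])).flip (by
    rintro ⟨b, hb⟩ ⟨x, hx⟩
    refine LinearMap.ext fun a => ?_
    obtain ⟨⟨a, ha⟩, rfl⟩ := (A.boundaries X Y).mkQ_surjective a
    refine (A.cls_eq_zero _).2 ⟨A.μ₂ X Y Z a x, ?_⟩
    have hx' : A.d Y Z x = b := hx
    have ha' : A.d X Y a = 0 := ha
    have h := A.relation₂ a x
    simp only [ha', hx', map_zero, LinearMap.zero_apply, add_zero] at h
    simp only [cochainComp, LinearMap.neg_apply, LinearMap.comp_apply, map_neg]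
    exact eq_neg_of_add_eq_zero_left h)).flip

theorem hComp_cls {X Y Z : A.Ob} {a : X ⟶ Y} {b : Y ⟶ Z} (ha : A.d X Y a = 0)
    (hb : A.d Y Z b = 0) : A.hComp X Y Z (A.cls a ha) (A.cls b hb) =
      A.cls (A.cochainComp X Y Z a b) (by rw [A.d_cochainComp, ha, hb]; simp) := rfl

theorem cls_surjective {X Y : A.Ob} (x : A.H X Y) : ∃ a, ∃ ha : A.d X Y a = 0, A.cls a ha = x := by
  obtain ⟨⟨a, ha⟩, rfl⟩ := (A.boundaries X Y).mkQ_surjective x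
  exact ⟨a, ha, rfl⟩

theorem hComp_assoc {W X Y Z : A.Ob} (a : A.H W X) (b : A.H X Y) (c : A.H Y Z) :
    A.hComp W Y Z (A.hComp W X Y a b) c = A.hComp W X Z a (A.hComp X Y Z b c) := by
  obtain ⟨a, ha, rfl⟩ := A.cls_surjective a
  obtain ⟨b, hb, rfl⟩ := A.cls_surjective b
  obtain ⟨c, hc, rfl⟩ := A.cls_surjective c
  simp only [hComp_cls]
  rw [cls_eq_cls]
  have hb' : A.d X Y (A.ε X Y b) = 0 := by rw [A.d_ε, hb]; simp
  have h := A.relation₃ a (A.ε X Y b) c ha hb' hc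
  refine ⟨A.μ ((a.toPath.cons (A.ε X Y b)).cons c), ?_⟩
  simp only [cochainComp, LinearMap.neg_apply, LinearMap.comp_apply, map_neg, A.ε_μ₂, A.ε_ε]
  rw [← sub_eq_zero, ← h]
  abel

theorem hComp_mem {X Y Z : A.Ob} {k l m : ℤ} (h : k + l = m) {a : A.H X Y} {b : A.H Y Z}
    (ha : a ∈ A.Hgr X Y k) (hb : b ∈ A.Hgr Y Z l) : A.hComp X Y Z a b ∈ A.Hgr X Z m := by
  obtain ⟨⟨a, ha'⟩, hak, rfl⟩ := ha
  obtain ⟨⟨b, hb'⟩, hbl, rfl⟩ := hb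
  subst h
  refine ⟨⟨A.cochainComp X Y Z a b, ?_⟩, ?_, rfl⟩
  · have h1 : A.d X Y a = 0 := ha'
    have h2 : A.d Y Z b = 0 := hb'
    rw [LinearMap.mem_ker, A.d_cochainComp, h1, h2]; simp
  · change A.cochainComp X Y Z a b ∈ A.gr X Z (k + l)
    rw [A.cochainComp_apply (show a ∈ A.gr X Y k from hak)]
    exact Submodule.smul_mem _ _ (A.μ₂_mem hak hbl)

/-- `A` is cohomologically unital: its cohomological category has identity morphisms. -/
class CUnital : Prop where
  exists_unit : ∀ X : A.Ob, ∃ e : A.H X X,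
    (∀ (Y : A.Ob) (a : A.H X Y), A.hComp X X Y e a = a) ∧
    (∀ (Y : A.Ob) (a : A.H Y X), A.hComp Y X X a e = a)

/-- The cohomological category `H(A)` of a c-unital `A_∞`-category. -/
structure HCat (A : AInfCategory.{w, u, v} K) where
  of : A.Ob

noncomputable instance [A.CUnital] : Category (HCat A) where
  Hom X Y := A.H X.of Y.of
  id X := (CUnital.exists_unit (A := A) X.of).choose
  comp {X Y Z} f g := A.hComp X.of Y.of Z.of f g
  id_comp {X Y} f := (CUnital.exists_unit (A := A) X.of).choose_spec.1 Y.of f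
  comp_id {X Y} f := (CUnital.exists_unit (A := A) Y.of).choose_spec.2 X.of f
  assoc f g h := A.hComp_assoc f g h

noncomputable instance [A.CUnital] : Preadditive (HCat A) where
  homGroup X Y := inferInstanceAs (AddCommGroup (A.H X.of Y.of))
  add_comp X Y Z f f' g := LinearMap.map_add₂ (A.hComp X.of Y.of Z.of) f f' g
  comp_add X Y Z f g g' := (A.hComp X.of Y.of Z.of f).map_add g g'

noncomputable instance [A.CUnital] : Linear K (HCat A) where
  homModule X Y := inferInstanceAs (Module K (A.H X.of Y.of))
  smul_comp X Y Z r f g := LinearMap.map_smul₂ (A.hComp X.of Y.of Z.of) r f g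
  comp_smul X Y Z f r g := (A.hComp X.of Y.of Z.of f).map_smul r g

/-! ### `ℂℙⁿ`-objects -/

/-- The bilinear map `H^(m-k)(X, V) × H^k(V, X) → H^m(V, V) → K`, `(b, a) ↦ ∫ (b · a)`. -/
noncomputable def pairing (V : A.Ob) (m : ℤ) (I : A.Hgr V V m →ₗ[K] K) (X : A.Ob) (k : ℤ) :
    A.Hgr X V (m - k) →ₗ[K] A.Hgr V X k →ₗ[K] K :=
  LinearMap.mk₂ K
    (fun b a => I ⟨A.hComp V X V a b, A.hComp_mem (by ring) a.2 b.2⟩)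
    (fun b b' a => by rw [← map_add]; congr 1; ext; simp)
    (fun c b a => by rw [← map_smul]; congr 1; ext; simp)
    (fun b a a' => by rw [← map_add]; congr 1; ext; simp)
    (fun c b a => by rw [← map_smul]; congr 1; ext; simp)

/-- `(V, h)` is a `ℂℙⁿ`-object of `A`. -/
structure IsCPObject [A.CUnital] (n : ℕ) (V : A.Ob) (h : V ⟶ V) : Prop where
  mem_gr : h ∈ A.gr V V 2
  closed : A.d V V h = 0
  end_iso : ∃ φ : (K[X] ⧸ Ideal.span {(Polynomial.X : K[X]) ^ (n + 1)}) ≃ₐ[K]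
      CategoryTheory.End (HCat.mk V : HCat A),
    φ (Ideal.Quotient.mk _ Polynomial.X) = A.cls h closed
  duality : ∃ I : A.Hgr V V (2 * n) →ₗ[K] K, ∀ (X : A.Ob) (k : ℤ),
    (A.pairing V (2 * n) I X k).Nondegenerate

end AInfCategory

/-! ### The additive enlargement -/

/-- A finite formal direct sum `⨁ i, V_i ⊗ obj i`, where `V_i` is the one-dimensional graded vector
space `K` placed in degree `deg i`. (A finite-dimensional graded vector space is a finite direct sum
of such `V_i`, so these sums are all the formal sums with finite-dimensional graded
coefficients.) -/
structure SumOb {K : Type w} [Field K] (A : AInfCategory.{w, u, v} K) where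
  ι : Type
  [fintype : Fintype ι]
  obj : ι → A.Ob
  deg : ι → ℤ

attribute [instance] SumOb.fintype

namespace SumOb

variable {K : Type w} [Field K] {A : AInfCategory.{w, u, v} K}

/-- Matrices of morphisms: the component `a i j` stands for `α ⊗ a i j`, where
`α : V_i → W_j` is the identity of `K`, of degree `Y.deg j - X.deg i`. -/
instance : Quiver.{v} (SumOb A) := ⟨fun X Y => ∀ (i : X.ι) (j : Y.ι), X.obj i ⟶ Y.obj j⟩

instance (X Y : SumOb A) : AddCommGroup (X ⟶ Y) :=
  inferInstanceAs (AddCommGroup (∀ (i : X.ι) (j : Y.ι), X.obj i ⟶ Y.obj j))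

instance (X Y : SumOb A) : Module K (X ⟶ Y) :=
  inferInstanceAs (Module K (∀ (i : X.ι) (j : Y.ι), X.obj i ⟶ Y.obj j))

/-- Degree `r`: `|a i j| = r - (Y.deg j - X.deg i)`. -/
def gr (X Y : SumOb A) (r : ℤ) : Submodule K (X ⟶ Y) where
  carrier := {a | ∀ i j, a i j ∈ A.gr (X.obj i) (Y.obj j) (r - (Y.deg j - X.deg i))}
  add_mem' ha hb i j := Submodule.add_mem _ (ha i j) (hb i j)
  zero_mem' _ _ := Submodule.zero_mem _
  smul_mem' c _ ha i j := Submodule.smul_mem _ c (ha i j)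

variable {M : Type*} [AddCommGroup M]

open Classical in
/-- For a path `(a₁, …, a_d)` of matrices, and indices `i`, `j` of its end points, the sum of
`(-1)^◁ F (x₁, …, x_d)` over all sequences of indices `i = i₀, i₁, …, i_d = j`, where
`x_q = a_q i_{q-1} i_q` and `◁ = ∑_{p < q} |α_p| (|x_q| - 1)`, with
`|α_p| = deg i_p - deg i_{p-1}` (so that `∑_{p < q} |α_p| = deg i_{q-1} - deg i₀`). -/
noncomputable def sumLifts {X : SumOb A} :
    ∀ {Y : SumOb A}, Path X Y → ∀ (i : X.ι) (j : Y.ι), (Path (X.obj i) (Y.obj j) → M) → M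
  | _, .nil, i, j, F => if h : i = j then F (h ▸ Path.nil) else 0
  | _, .cons (b := Y) (c := Z) p a, i, j, F => ∑ j' : Y.ι, sumLifts p i j' fun q =>
      F (q.cons (signTwist (A.gr (Y.obj j') (Z.obj j)) (A.gr_internal _ _)
        (Y.deg j' - X.deg i) (a j' j)))

theorem sumLifts_fun_add {X Y : SumOb A} (p : Path X Y) (i : X.ι) (j : Y.ι)
    (F G : Path (X.obj i) (Y.obj j) → M) :
    sumLifts p i j (fun q => F q + G q) = sumLifts p i j F + sumLifts p i j G := by
  induction p with
  | nil => simp only [sumLifts]; split_ifs <;> simp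
  | cons p a ih => simp only [sumLifts, ih, Finset.sum_add_distrib]

theorem sumLifts_fun_smul [Module K M] {X Y : SumOb A} (p : Path X Y) (i : X.ι) (j : Y.ι) (c : K)
    (F : Path (X.obj i) (Y.obj j) → M) :
    sumLifts p i j (fun q => c • F q) = c • sumLifts p i j F := by
  induction p with
  | nil => simp only [sumLifts]; split_ifs <;> simp
  | cons p a ih => simp only [sumLifts, ih, Finset.smul_sum]

theorem sumLifts_add {W X Y Z : SumOb A} (p : Path W X) (a b : X ⟶ Y) (q : Path Y Z)
    (i : W.ι) (j : Z.ι) (F : Path (W.obj i) (Z.obj j) → M)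
    (hF : ∀ {x y : A.Ob} (p' : Path (W.obj i) x) (a' b' : x ⟶ y) (q' : Path y (Z.obj j)),
      F ((p'.cons (a' + b')).comp q') = F ((p'.cons a').comp q') + F ((p'.cons b').comp q')) :
    sumLifts ((p.cons (a + b)).comp q) i j F =
      sumLifts ((p.cons a).comp q) i j F + sumLifts ((p.cons b).comp q) i j F := by
  induction q with
  | nil =>
    simp only [Path.comp_nil, sumLifts, ← Finset.sum_add_distrib, ← sumLifts_fun_add]
    refine Finset.sum_congr rfl fun j' _ => congrArg _ (funext fun r => ?_)
    refine Eq.trans ?_ (hF r _ _ .nil)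
    exact congrArg (fun t => F (r.cons t)) (map_add _ (a j' j) (b j' j))
  | cons q c ih =>
    simp only [Path.comp_cons, sumLifts, ← Finset.sum_add_distrib]
    refine Finset.sum_congr rfl fun j' _ => ih j' _ fun p' a' b' q' => ?_
    simp only [← Path.comp_cons]
    exact hF _ _ _ _

theorem sumLifts_smul [Module K M] {W X Y Z : SumOb A} (p : Path W X) (k : K) (a : X ⟶ Y) (q : Path Y Z)
    (i : W.ι) (j : Z.ι) (F : Path (W.obj i) (Z.obj j) → M)
    (hF : ∀ {x y : A.Ob} (p' : Path (W.obj i) x) (a' : x ⟶ y) (q' : Path y (Z.obj j)),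
      F ((p'.cons (k • a')).comp q') = k • F ((p'.cons a').comp q')) :
    sumLifts ((p.cons (k • a)).comp q) i j F = k • sumLifts ((p.cons a).comp q) i j F := by
  induction q with
  | nil =>
    simp only [Path.comp_nil, sumLifts, Finset.smul_sum, ← sumLifts_fun_smul]
    refine Finset.sum_congr rfl fun j' _ => congrArg _ (funext fun r => ?_)
    refine Eq.trans ?_ (hF r _ .nil)
    exact congrArg (fun t => F (r.cons t)) (map_smul _ k (a j' j))
  | cons q c ih =>
    simp only [Path.comp_cons, sumLifts, Finset.smul_sum]
    refine Finset.sum_congr rfl fun j' _ => ih j' _ fun p' a' q' => ?_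
    simp only [← Path.comp_cons]
    exact hF _ _ _

/-- `μ^d(a_d, …, a₁) = ∑ (-1)^◁ α_d ⋯ α₁ ⊗ μ^d(x_d, …, x₁)`. -/
noncomputable def μ {X Y : SumOb A} (p : Path X Y) : X ⟶ Y := fun i j => sumLifts p i j A.μ

theorem μ_nil (X : SumOb A) : μ (Path.nil : Path X X) = 0 := by
  funext i j
  simp only [μ, sumLifts]
  split_ifs with h
  · subst h; exact A.μ_nil _
  · rfl

theorem μ_add {W X Y Z : SumOb A} (p : Path W X) (a b : X ⟶ Y) (q : Path Y Z) :
    μ ((p.cons (a + b)).comp q) = μ ((p.cons a).comp q) + μ ((p.cons b).comp q) :=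
  funext fun i => funext fun j => sumLifts_add p a b q i j _ A.μ_add

theorem μ_smul {W X Y Z : SumOb A} (p : Path W X) (c : K) (a : X ⟶ Y) (q : Path Y Z) :
    μ ((p.cons (c • a)).comp q) = c • μ ((p.cons a).comp q) :=
  funext fun i => funext fun j =>
    sumLifts_smul p c a q i j _ fun p' a' q' => A.μ_smul p' c a' q'

end SumOb

/-- The additive enlargement `ΣA`. -/
noncomputable def AInfCategory.additive {K : Type w} [Field K] (A : AInfCategory.{w, u, v} K) :
    AInfData.{w, max u 1, v} K where
  Ob := SumOb A
  gr := SumOb.gr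
  μ := SumOb.μ
  μ_nil := SumOb.μ_nil
  μ_add := SumOb.μ_add
  μ_smul := SumOb.μ_smul

/-! ### Twisted complexes -/

/-- The path `(δ, …, δ)` of length `n`. -/
def constPath {Q : Type*} [Quiver Q] {X : Q} (δ : X ⟶ X) : ℕ → Path X X
  | 0 => .nil
  | n + 1 => (constPath δ n).cons δ

/-- A twisted complex: an object of `ΣA` with `δ` of degree one that is strictly triangular for some
finite filtration, given by the levels of the summands, and satisfies `∑_d μ^d(δ, …, δ) = 0`.
A sequence of `d` composable nonzero entries of `δ` passes through `d + 1` summands of strictly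
increasing level, so that all terms in which at least `card ι` copies of `δ` follow one another vanish;
the sums below leave them out. -/
structure TwOb {K : Type w} [Field K] (A : AInfCategory.{w, u, v} K) extends SumOb A where
  δ : toSumOb ⟶ toSumOb
  δ_mem : δ ∈ SumOb.gr toSumOb toSumOb 1
  triangular : ∃ level : ι → ℕ, ∀ i j, ¬ level i < level j → δ i j = 0
  maurerCartan : ∑ d ∈ Finset.range (Fintype.card ι), SumOb.μ (constPath δ d) = 0

namespace TwOb

variable {K : Type w} [Field K] {A : AInfCategory.{w, u, v} K}

instance : Quiver.{v} (TwOb A) := ⟨fun X Y => X.toSumOb ⟶ Y.toSumOb⟩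

instance (X Y : TwOb A) : AddCommGroup (X ⟶ Y) :=
  inferInstanceAs (AddCommGroup (X.toSumOb ⟶ Y.toSumOb))

instance (X Y : TwOb A) : Module K (X ⟶ Y) :=
  inferInstanceAs (Module K (X.toSumOb ⟶ Y.toSumOb))

variable {M : Type*} [AddCommGroup M]

/-- For a path `(a₁, …, a_d)` from `X₀` to `X_d`, the sum over all `i₀, …, i_d` of the values of `F` at
`(δ, …, δ, a₁, δ, …, δ, a₂, …, a_d, δ, …, δ)`, with `i₀` copies of `δ` of `X₀` at the beginning, then
`i₁` copies of `δ` of `X₁` after `a₁`, and so on. -/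
def sumInsertions {X : TwOb A} :
    ∀ {Y : TwOb A}, Path X Y → (Path X.toSumOb Y.toSumOb → M) → M
  | _, .nil, F => ∑ n ∈ Finset.range (Fintype.card X.ι), F (constPath X.δ n)
  | _, .cons (b := Y) (c := Z) p a, F => sumInsertions p fun q =>
      ∑ n ∈ Finset.range (Fintype.card Z.ι),
        F ((Path.cons q (show Y.toSumOb ⟶ Z.toSumOb from a)).comp (constPath Z.δ n))

theorem sumInsertions_fun_add {X Y : TwOb A} (p : Path X Y)
    (F G : Path X.toSumOb Y.toSumOb → M) :
    sumInsertions p (fun q => F q + G q) = sumInsertions p F + sumInsertions p G := by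
  induction p with
  | nil => simp only [sumInsertions, Finset.sum_add_distrib]
  | cons p a ih => simp only [sumInsertions, Finset.sum_add_distrib, ih]

theorem sumInsertions_fun_smul [Module K M] {X Y : TwOb A} (p : Path X Y) (c : K)
    (F : Path X.toSumOb Y.toSumOb → M) :
    sumInsertions p (fun q => c • F q) = c • sumInsertions p F := by
  induction p with
  | nil => simp only [sumInsertions, Finset.smul_sum]
  | cons p a ih => simp only [sumInsertions, ← Finset.smul_sum, ih]

theorem sumInsertions_add {W X Y Z : TwOb A} (p : Path W X) (a b : X ⟶ Y) (q : Path Y Z)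
    (F : Path W.toSumOb Z.toSumOb → M)
    (hF : ∀ {x y : SumOb A} (p' : Path W.toSumOb x) (a' b' : x ⟶ y) (q' : Path y Z.toSumOb),
      F ((p'.cons (a' + b')).comp q') = F ((p'.cons a').comp q') + F ((p'.cons b').comp q')) :
    sumInsertions ((p.cons (a + b)).comp q) F =
      sumInsertions ((p.cons a).comp q) F + sumInsertions ((p.cons b).comp q) F := by
  induction q with
  | nil =>
    simp only [Path.comp_nil, sumInsertions, ← sumInsertions_fun_add, ← Finset.sum_add_distrib]
    refine congrArg _ (funext fun r => Finset.sum_congr rfl fun n _ => ?_)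
    exact hF r _ _ _
  | cons q c ih =>
    simp only [Path.comp_cons, sumInsertions]
    refine ih _ fun p' a' b' q' => ?_
    simp only [← Finset.sum_add_distrib, ← Path.comp_cons, Path.comp_assoc]
    exact Finset.sum_congr rfl fun n _ => hF _ _ _ _

theorem sumInsertions_smul [Module K M] {W X Y Z : TwOb A} (p : Path W X) (k : K) (a : X ⟶ Y) (q : Path Y Z)
    (F : Path W.toSumOb Z.toSumOb → M)
    (hF : ∀ {x y : SumOb A} (p' : Path W.toSumOb x) (a' : x ⟶ y) (q' : Path y Z.toSumOb),
      F ((p'.cons (k • a')).comp q') = k • F ((p'.cons a').comp q')) :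
    sumInsertions ((p.cons (k • a)).comp q) F = k • sumInsertions ((p.cons a).comp q) F := by
  induction q with
  | nil =>
    simp only [Path.comp_nil, sumInsertions, ← sumInsertions_fun_smul, Finset.smul_sum]
    refine congrArg _ (funext fun r => Finset.sum_congr rfl fun n _ => ?_)
    exact hF r _ _
  | cons q c ih =>
    simp only [Path.comp_cons, sumInsertions]
    refine ih _ fun p' a' q' => ?_
    simp only [Finset.smul_sum, ← Path.comp_cons, Path.comp_assoc]
    exact Finset.sum_congr rfl fun n _ => hF _ _ _

end TwOb

/-- The category `Tw A` of twisted complexes, with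
`μ^d(a_d, …, a₁) = ∑ μ_{ΣA}(δ, …, δ, a_d, δ, …, δ, a_{d-1}, …, a₁, δ, …, δ)`. -/
noncomputable def AInfCategory.tw {K : Type w} [Field K] (A : AInfCategory.{w, u, v} K) :
    AInfData.{w, max u 1 v, v} K where
  Ob := TwOb A
  gr X Y := SumOb.gr X.toSumOb Y.toSumOb
  μ p := TwOb.sumInsertions p SumOb.μ
  μ_nil X := X.maurerCartan
  μ_add p a b q := TwOb.sumInsertions_add p a b q _ SumOb.μ_add
  μ_smul p c a q := TwOb.sumInsertions_smul p c a q _ fun p' a' q' => SumOb.μ_smul p' c a' q'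

/-! ### The derived category -/

namespace TwOb

variable {K : Type w} [Field K] {A : AInfCategory.{w, u, v} K}

/-- An object of `A` as a twisted complex: one summand, in degree zero, and `δ = 0`. -/
def single (V : A.Ob) : TwOb A where
  ι := Unit
  obj _ := V
  deg _ := 0
  δ := 0
  δ_mem := Submodule.zero_mem _
  triangular := ⟨fun _ => 0, fun _ _ _ => rfl⟩
  maurerCartan := by
    rw [Fintype.card_unit, Finset.sum_range_one]
    exact SumOb.μ_nil _

/-- The shift of a formal sum: the summand in degree `s` moves to degree `s - σ`. -/
abbrev shiftSum (X : SumOb A) (σ : ℤ) : SumOb A where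
  ι := X.ι
  obj := X.obj
  deg i := X.deg i - σ

theorem sumLifts_shiftSum {M : Type*} [AddCommGroup M] (X : SumOb A) (σ : ℤ) (δ : X ⟶ X) (n : ℕ)
    (i j : X.ι) (F : Path (X.obj i) (X.obj j) → M) :
    SumOb.sumLifts (constPath (show shiftSum X σ ⟶ shiftSum X σ from δ) n) i j F =
      SumOb.sumLifts (constPath δ n) i j F := by
  induction n generalizing j with
  | zero => rfl
  | succ n ih =>
    simp only [constPath, SumOb.sumLifts, ih, sub_sub_sub_cancel_right]

/-- The shift `X[σ] = K[σ] ⊗ X`. -/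
def shift (X : TwOb A) (σ : ℤ) : TwOb A where
  toSumOb := shiftSum X.toSumOb σ
  δ := X.δ
  δ_mem i j := by
    have := X.δ_mem i j
    simpa only [sub_sub_sub_cancel_right] using this
  triangular := X.triangular
  maurerCartan := by
    refine Eq.trans (Finset.sum_congr rfl fun n _ => ?_) X.maurerCartan
    exact funext fun i => funext fun j => sumLifts_shiftSum X.toSumOb σ X.δ n i j _

/-- The morphisms from `X` to `Y` in the derived category `D A = H⁰(Tw A)`, whose objects are the
twisted complexes. -/
abbrev DHom (X Y : TwOb A) : Type v := A.tw.Hgr X Y 0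

/-- `B ≃ 0` in `D A`: `B` is a zero object. -/
def IsZero (B : TwOb A) : Prop :=
  ∀ X : TwOb A, Subsingleton (DHom X B) ∧ Subsingleton (DHom B X)

/-- `X^⊥`, the collection of all `B` with `hom(X, B[i]) = 0` in `D A` for all `i`. -/
def rightOrthogonal (X : TwOb A) : Set (TwOb A) :=
  {B | ∀ i : ℤ, Subsingleton (DHom X (B.shift i))}

/-- `Ω` is a spanning class of `D A`. -/
structure IsSpanningClass (Ω : Set (TwOb A)) : Prop where
  nontrivial : ∃ X ∈ Ω, ¬ X.IsZero
  right : ∀ B : TwOb A, (∀ X ∈ Ω, ∀ i : ℤ, Subsingleton (DHom X (B.shift i))) → B.IsZero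
  left : ∀ B : TwOb A, (∀ X ∈ Ω, ∀ i : ℤ, Subsingleton (DHom (B.shift i) X)) → B.IsZero

end TwOb

/-! The categorical argument is short. If `hom(V, B[i]) = 0` for all `i`, then `B` lies in `V^⊥`,
hence in `Ω`, so `B` may be tested against itself; then the identity of `B` vanishes and `B ≃ 0`.
This settles the first condition. For the second, `hom(B[i], V) = 0` for all `i` forces `hom(V,
B[i]) = 0` for all `i` by Poincaré duality for `V`, so again `B ∈ V^⊥`, and `hom(B[i], B) = 0` gives
`B ≃ 0`. Finally `V` is nonzero because `K[x]/(x^(n+1))` is a nonzero ring.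

Two inputs need work, because they are given for objects of `A` and are needed for twisted
complexes: the existence of cohomological units (`Twisted.exists_isUnitClass`) and the passage from
`hom(X, V)` to `hom(V, X)` (`Twisted.exactHom_of_isDualizing`). Both rest on induction over the
number of summands. A summand `z` of highest level is a sink of the differential, so a twisted
complex is an extension of a twisted complex with one summand fewer by a shifted object of `A`. The
complexes of morphisms to and from it become extensions of complexes, and `Acyclic.extension` passes
acyclicity to the middle term.

Units: `A` has no strict units, so there is no identity matrix to write down. Instead, closed
representatives of the units of the two pieces are completed to a closed block triangular `e`.
Multiplication by `e` is a quasi-isomorphism on both pieces, hence on the extension, and in any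
category-like structure an element that acts invertibly from both sides produces a unit
(`AInfCategory.exists_isUnitClass`).

Duality: the functional `∫` is extended to a functional `θ` on the complex `hom(V, V)`.
Nondegeneracy and finite dimension make `hom(X, V) → hom(V, X)^*` a quasi-isomorphism, that is, its
mapping cone is acyclic (`AInfCategory.IsDualizing.acyclic`); in this form the statement is stable
under extensions.

Signs: rescaling each matrix entry by a sign that depends on its degree and on the degree of its
source removes almost all signs from `Tw A`. The `A_∞`-relations are proved for this form,
`Twisted`, and `TwOb.homToTwisted_d` carries exactness of morphism complexes back to `Tw A`. -/

/-! ### Sums over multisets -/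

/-- The sum of the values of `F` on the elements of a multiset. -/
def msum {α M : Type*} [AddCommMonoid M] (S : Multiset α) (F : α → M) : M := (S.map F).sum

section msum

variable {α β M N : Type*} [AddCommMonoid M] [AddCommMonoid N]

@[simp] theorem msum_zero (F : α → M) : msum 0 F = 0 := by simp [msum]

@[simp] theorem msum_singleton (a : α) (F : α → M) : msum {a} F = F a := by simp [msum]

@[simp] theorem msum_add (S T : Multiset α) (F : α → M) :
    msum (S + T) F = msum S F + msum T F := by simp [msum]

@[simp] theorem msum_map (S : Multiset α) (f : α → β) (F : β → M) :
    msum (S.map f) F = msum S fun a => F (f a) := by simp [msum]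

@[simp] theorem msum_bind (S : Multiset α) (f : α → Multiset β) (F : β → M) :
    msum (S.bind f) F = msum S fun a => msum (f a) F := by
  simp [msum, Multiset.map_bind, Multiset.sum_bind]

@[simp] theorem msum_finset_sum {ι : Type*} (s : Finset ι) (S : ι → Multiset α) (F : α → M) :
    msum (∑ i ∈ s, S i) F = ∑ i ∈ s, msum (S i) F := by
  classical
  induction s using Finset.induction_on with
  | empty => simp
  | insert a s h ih => simp [Finset.sum_insert h, ih]

theorem msum_ite (p : Prop) [Decidable p] (S : Multiset α) (F : α → M) :
    msum (if p then S else 0) F = if p then msum S F else 0 := by split_ifs <;> simp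

theorem msum_congr {S : Multiset α} {F G : α → M} (h : ∀ a ∈ S, F a = G a) :
    msum S F = msum S G := by
  unfold msum
  rw [Multiset.map_congr rfl h]

@[simp] theorem msum_fun_add (S : Multiset α) (F G : α → M) :
    msum S (fun a => F a + G a) = msum S F + msum S G := by simp [msum]

@[simp] theorem msum_fun_zero (S : Multiset α) : msum S (fun _ => (0 : M)) = 0 := by simp [msum]

theorem msum_fun_sum {ι : Type*} (s : Finset ι) (S : Multiset α) (F : ι → α → M) :
    msum S (fun a => ∑ i ∈ s, F i a) = ∑ i ∈ s, msum S (F i) := by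
  classical
  induction s using Finset.induction_on with
  | empty => simp
  | insert a s h ih => simp [Finset.sum_insert h, ih]

theorem map_msum {G : Type*} [FunLike G M N] [AddMonoidHomClass G M N] (g : G) (S : Multiset α)
    (F : α → M) : g (msum S F) = msum S fun a => g (F a) := by
  simp only [msum, map_multiset_sum, Multiset.map_map, Function.comp_def]

theorem msum_fun_smul {R : Type*} [Monoid R] [DistribMulAction R M] (S : Multiset α) (c : R)
    (F : α → M) : msum S (fun a => c • F a) = c • msum S F := by
  exact (map_msum (DistribSMul.toAddMonoidHom M c) S F).symm

theorem msum_comm (S : Multiset α) (T : Multiset β) (F : α → β → M) :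
    msum S (fun a => msum T (F a)) = msum T fun b => msum S fun a => F a b :=
  Multiset.sum_map_sum_map S T

theorem msum_mem {R : Type*} [Semiring R] [Module R M] (W : Submodule R M) (S : Multiset α)
    (F : α → M) (h : ∀ a ∈ S, F a ∈ W) : msum S F ∈ W := by
  refine W.multiset_sum_mem _ fun c hc => ?_
  obtain ⟨a, ha, rfl⟩ := Multiset.mem_map.1 hc
  exact h a ha

end msum

/-! ### Splittings of paths -/

section sumSplit

variable {V : Type*} [Quiver V] {M : Type*} [AddCommGroup M]

theorem sumSplit_congr {X Z : V} (p : Path X Z) {F G : ∀ Y : V, Path X Y → Path Y Z → M}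
    (h : ∀ Y p₁ p₂, F Y p₁ p₂ = G Y p₁ p₂) : sumSplit p F = sumSplit p G := by
  have : F = G := by funext Y p₁ p₂; exact h Y p₁ p₂
  rw [this]

theorem map_sumSplit {N : Type*} [AddCommGroup N] (g : M →+ N) {X Z : V} (p : Path X Z)
    (F : ∀ Y : V, Path X Y → Path Y Z → M) :
    g (sumSplit p F) = sumSplit p fun Y p₁ p₂ => g (F Y p₁ p₂) := by
  induction p with
  | nil => rfl
  | cons p a ih => simp only [sumSplit, map_add, ih]

theorem msum_sumSplit {α : Type*} {X Z : V} (S : Multiset α) (p : Path X Z)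
    (F : α → ∀ Y : V, Path X Y → Path Y Z → M) :
    msum S (fun a => sumSplit p (F a)) = sumSplit p fun Y p₁ p₂ => msum S fun a => F a Y p₁ p₂ := by
  induction p with
  | nil => rfl
  | cons p a ih => simp only [sumSplit, msum_fun_add, ih]

theorem sum_sumSplit {α : Type*} {X Z : V} (s : Finset α) (p : Path X Z)
    (F : α → ∀ Y : V, Path X Y → Path Y Z → M) :
    ∑ a ∈ s, sumSplit p (F a) = sumSplit p fun Y p₁ p₂ => ∑ a ∈ s, F a Y p₁ p₂ := by
  induction p with
  | nil => rfl
  | cons p a ih => simp only [sumSplit, Finset.sum_add_distrib, ih]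

/-- Every cut of the path lies on exactly one side of the entry `a`. -/
theorem sumSplit_cons_comp {W X Y Z : V} (p : Path W X) (a : X ⟶ Y) (q : Path Y Z)
    (F : ∀ U : V, Path W U → Path U Z → M) :
    sumSplit ((p.cons a).comp q) F =
      sumSplit p (fun U p₁ p₂ => F U p₁ ((p₂.cons a).comp q)) +
        sumSplit q fun U q₁ q₂ => F U ((p.cons a).comp q₁) q₂ := by
  induction q with
  | nil => simp [sumSplit, add_comm]
  | cons q b ih =>
    simp only [Path.comp_cons, sumSplit, ih]
    abel

end sumSplit

/-! ### Chains in a triangular matrix of morphisms -/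

section chains

variable {ι : Type*} {V : Type*} [Quiver V] (obj : ι → V)

open Classical in
/-- The empty path from `obj i` to `obj j` if `i = j`, and nothing otherwise. -/
noncomputable def nilPaths (i j : ι) : Multiset (Path (obj i) (obj j)) :=
  if h : i = j then {h ▸ Path.nil} else 0

theorem nilPaths_self (i : ι) : nilPaths obj i i = {Path.nil} := by simp [nilPaths]

theorem nilPaths_ne {i j : ι} (h : i ≠ j) : nilPaths obj i j = 0 := by simp [nilPaths, h]

variable [Fintype ι] (level : ι → ℕ) (x : ∀ i j, obj i ⟶ obj j)

open Classical in
/-- The paths `(x i i₁, x i₁ i₂, …, x iₙ j)` for all `i, i₁, …, iₙ, j` of increasing level. -/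
noncomputable def chainPaths (i j : ι) : Multiset (Path (obj i) (obj j)) :=
  nilPaths obj i j + ∑ k : ι, if _h : level k < level j then
    (chainPaths i k).map (fun p => p.cons (x k j)) else 0
termination_by level j

theorem chainPaths_eq (i j : ι) : chainPaths obj level x i j =
    nilPaths obj i j + ∑ k : ι, if level k < level j then
      (chainPaths obj level x i k).map (fun p => p.cons (x k j)) else 0 := by
  rw [chainPaths]
  simp only [dite_eq_ite]

variable {obj level x}

theorem sum_msum_nilPaths {M : Type*} [AddCommGroup M] (j : ι)
    (F : ∀ m : ι, Path (obj m) (obj j) → M) :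
    ∑ m, msum (nilPaths obj m j) (F m) = F j .nil := by
  rw [Finset.sum_eq_single j]
  · simp [nilPaths_self]
  · intro m _ hm; simp [nilPaths_ne _ hm]
  · simp

/-- Levels increase strictly along a chain. -/
theorem chainPaths_eq_zero {i j : ι} (hij : i ≠ j) (h : ¬ level i < level j) :
    chainPaths obj level x i j = 0 := by
  induction hn : level j using Nat.strong_induction_on generalizing j with
  | _ n ih =>
    rw [chainPaths_eq, nilPaths_ne _ hij, zero_add]
    refine Finset.sum_eq_zero fun k _ => ?_
    split_ifs with hk
    · rw [ih (level k) (hn ▸ hk) (by rintro rfl; exact h hk) (fun hik => h (hik.trans hk)) rfl]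
      simp
    · rfl

theorem chainPaths_of_le {i j : ι} (h : level j ≤ level i) :
    chainPaths obj level x i j = nilPaths obj i j := by
  rw [chainPaths_eq]
  convert add_zero _
  refine Finset.sum_eq_zero fun k _ => ?_
  split_ifs with hk
  · rw [chainPaths_eq_zero (by rintro rfl; omega) (by omega)]; simp
  · rfl

/-- Cutting a chain at the summand `m` gives two chains, and two chains that meet at `m` can be
joined. This bijection is what turns splittings of inserted chains into a sum over an intermediate
index. -/
theorem msum_chainPaths_sumSplit {M : Type*} [AddCommGroup M] (i j : ι)
    (H : ∀ U : V, Path (obj i) U → Path U (obj j) → M) :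
    msum (chainPaths obj level x i j) (fun p => sumSplit p H) =
      ∑ m : ι, msum (chainPaths obj level x i m) fun p =>
        msum (chainPaths obj level x m j) fun q => H (obj m) p q := by
  classical
  induction hn : level j using Nat.strong_induction_on generalizing j with
  | _ n ih =>
    -- The second chain is either empty, which is the cut at the end, or it has a last entry `x k
    -- j`, to be treated by induction at the lower level of `k`.
    have h1 : ∀ m (p : Path (obj i) (obj m)),
        msum (chainPaths obj level x m j) (fun q => H (obj m) p q) =
          msum (nilPaths obj m j) (fun q => H (obj m) p q) +
          ∑ k : ι, if level k < level j then msum (chainPaths obj level x m k)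
            (fun q => H (obj m) p (q.cons (x k j))) else 0 := by
      intro m p
      rw [chainPaths_eq]
      simp [msum_ite]
    have h2 : ∀ F : ∀ m, Path (obj i) (obj m) → Path (obj m) (obj j) → M,
        ∑ m, msum (chainPaths obj level x i m) (fun p =>
          msum (nilPaths obj m j) (fun q => F m p q)) =
        msum (chainPaths obj level x i j) fun p => F j p .nil := by
      intro F
      simp only [msum_comm (chainPaths _ _ _ _ _) (nilPaths _ _ _)]
      exact sum_msum_nilPaths j fun m q => msum (chainPaths obj level x i m) fun p => F m p q
    simp only [h1, msum_fun_add, Finset.sum_add_distrib, h2, msum_fun_sum]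
    rw [Finset.sum_comm, chainPaths_eq]
    simp only [msum_add, msum_finset_sum, msum_ite, msum_map, sumSplit, msum_fun_add]
    rw [add_assoc, ← Finset.sum_add_distrib]
    congr 1
    · by_cases hij : i = j
      · subst hij; simp [nilPaths_self, sumSplit]
      · simp [nilPaths_ne _ hij]
    · refine Finset.sum_congr rfl fun k _ => ?_
      by_cases hk : level k < level j
      · simp only [hk, if_true]
        rw [ih (level k) (hn ▸ hk) k _ rfl]
      · simp [hk]

end chains

/-! ### Twisted complexes, without signs -/

/-- A twisted complex whose differential `x` has been rescaled in such a way that the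
Maurer--Cartan equation has no signs. -/
structure Twisted {K : Type w} [Field K] (A : AInfCategory.{w, u, v} K) where
  ι : Type
  [fintype : Fintype ι]
  obj : ι → A.Ob
  deg : ι → ℤ
  level : ι → ℕ
  x : ∀ i j, obj i ⟶ obj j
  x_mem : ∀ i j, x i j ∈ A.gr (obj i) (obj j) (1 - (deg j - deg i))
  mc : ∀ i j, msum (chainPaths obj level x i j) A.μ = 0

attribute [instance] Twisted.fintype

/-- The sign `(-1) ^ n` as a scalar. -/
def sgn (K : Type w) [Field K] (n : ℤ) : K := ((n.negOnePow : ℤ) : K)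

section sgn

variable {K : Type w} [Field K]

theorem sgn_add (m n : ℤ) : sgn K (m + n) = sgn K m * sgn K n := by
  simp [sgn, Int.negOnePow_add]

@[simp] theorem sgn_mul_self (m : ℤ) : sgn K m * sgn K m = 1 := by
  rw [← sgn_add, sgn, Int.negOnePow_even _ (Even.add_self m)]; simp

@[simp] theorem sgn_smul_sgn_smul {M : Type*} [AddCommGroup M] [Module K M] (m : ℤ) (a : M) :
    sgn K m • sgn K m • a = a := by
  rw [smul_smul, sgn_mul_self, one_smul]

theorem sgn_neg (m : ℤ) : sgn K (-m) = sgn K m := by simp [sgn]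

theorem sgn_sub (m n : ℤ) : sgn K (m - n) = sgn K m * sgn K n := by
  rw [sub_eq_add_neg, sgn_add, sgn_neg]

@[simp] theorem sgn_zero : sgn K 0 = 1 := by simp [sgn]

end sgn

namespace AInfCategory

variable {K : Type w} [Field K] (A : AInfCategory.{w, u, v} K)

theorem ε_eq {X Y : A.Ob} {k : ℤ} {a : X ⟶ Y} (ha : a ∈ A.gr X Y k) :
    A.ε X Y a = sgn K (k - 1) • a := A.ε_apply ha

/-- `μ` as a linear function of one entry of a path. -/
def μEntry {W X Y Z : A.Ob} (p : Path W X) (q : Path Y Z) : (X ⟶ Y) →ₗ[K] (W ⟶ Z) where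
  toFun a := A.μ ((p.cons a).comp q)
  map_add' a b := A.μ_add p a b q
  map_smul' c a := A.μ_smul p c a q

end AInfCategory

namespace Twisted

variable {K : Type w} [Field K] {A : AInfCategory.{w, u, v} K}

instance : Quiver.{v} (Twisted A) := ⟨fun X Y => ∀ (i : X.ι) (j : Y.ι), X.obj i ⟶ Y.obj j⟩

instance (X Y : Twisted A) : AddCommGroup (X ⟶ Y) :=
  inferInstanceAs (AddCommGroup (∀ (i : X.ι) (j : Y.ι), X.obj i ⟶ Y.obj j))

instance (X Y : Twisted A) : Module K (X ⟶ Y) :=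
  inferInstanceAs (Module K (∀ (i : X.ι) (j : Y.ι), X.obj i ⟶ Y.obj j))

instance (X Y : Twisted A) : Module.Finite K (X ⟶ Y) := by
  have := A.finite
  exact inferInstanceAs (Module.Finite K (∀ (i : X.ι) (j : Y.ι), X.obj i ⟶ Y.obj j))

theorem hom_ext {X Y : Twisted A} {a b : X ⟶ Y} (h : ∀ i j, a i j = b i j) : a = b :=
  funext fun i => funext fun j => h i j

@[simp] theorem add_apply {X Y : Twisted A} (a b : X ⟶ Y) (i : X.ι) (j : Y.ι) :
    (a + b) i j = a i j + b i j := rfl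

@[simp] theorem zero_apply {X Y : Twisted A} (i : X.ι) (j : Y.ι) :
    (0 : X ⟶ Y) i j = 0 := rfl

@[simp] theorem smul_apply {X Y : Twisted A} (c : K) (a : X ⟶ Y) (i : X.ι) (j : Y.ι) :
    (c • a) i j = c • a i j := rfl

/-- Entry `(i, j)` as a linear map. -/
def entry (X Y : Twisted A) (i : X.ι) (j : Y.ι) : (X ⟶ Y) →ₗ[K] (X.obj i ⟶ Y.obj j) where
  toFun a := a i j
  map_add' _ _ := rfl
  map_smul' _ _ := rfl

open Classical in
/-- The matrix with one nonzero entry, as a linear map. -/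
noncomputable def single (X Y : Twisted A) (i : X.ι) (j : Y.ι) :
    (X.obj i ⟶ Y.obj j) →ₗ[K] (X ⟶ Y) :=
  (LinearMap.single K (fun i => ∀ j, X.obj i ⟶ Y.obj j) i) ∘ₗ
    (LinearMap.single K (fun j => X.obj i ⟶ Y.obj j) j)

theorem single_same (X Y : Twisted A) (i : X.ι) (j : Y.ι) (a : X.obj i ⟶ Y.obj j) :
    single X Y i j a i j = a := by
  classical
  change (Pi.single i (Pi.single j a) : ∀ i j, X.obj i ⟶ Y.obj j) i j = a
  simp

theorem single_ne (X Y : Twisted A) (i : X.ι) (j : Y.ι) (a : X.obj i ⟶ Y.obj j) {i' : X.ι}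
    {j' : Y.ι} (h : ¬ (i' = i ∧ j' = j)) : single X Y i j a i' j' = 0 := by
  classical
  change (Pi.single i (Pi.single j a) : ∀ i j, X.obj i ⟶ Y.obj j) i' j' = 0
  by_cases hi : i' = i
  · subst hi
    have hj : j' ≠ j := fun hj => h ⟨rfl, hj⟩
    simp [hj]
  · simp [hi]

theorem sum_single (X Y : Twisted A) (a : X ⟶ Y) :
    ∑ i, ∑ j, single X Y i j (a i j) = a := by
  refine hom_ext fun i' j' => ?_
  suffices h : entry X Y i' j' (∑ i, ∑ j, single X Y i j (a i j)) = a i' j' from h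
  rw [map_sum, Finset.sum_eq_single i', map_sum, Finset.sum_eq_single j']
  · exact single_same X Y i' j' _
  · intro j _ hj; exact single_ne X Y _ _ _ (fun h => hj h.2.symm)
  · simp
  · intro i _ hi
    rw [map_sum]
    exact Finset.sum_eq_zero fun j _ => single_ne X Y _ _ _ (fun h => hi h.1.symm)
  · simp

/-- The matrices of degree `r`. -/
def gr (X Y : Twisted A) (r : ℤ) : Submodule K (X ⟶ Y) where
  carrier := {a | ∀ i j, a i j ∈ A.gr (X.obj i) (Y.obj j) (r - (Y.deg j - X.deg i))}
  add_mem' ha hb i j := Submodule.add_mem _ (ha i j) (hb i j)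
  zero_mem' _ _ := Submodule.zero_mem _
  smul_mem' c _ ha i j := Submodule.smul_mem _ c (ha i j)

/-- In each entry this is the grading of `A` with index shifted by a constant. Independence is
therefore checked entry by entry, and matrices with one nonzero entry suffice for spanning. -/
theorem gr_internal (X Y : Twisted A) : DirectSum.IsInternal (gr X Y) := by
  classical
  refine DirectSum.isInternal_submodule_of_iSupIndep_of_iSup_eq_top ?_ ?_
  · rw [iSupIndep_iff_dfinsupp_lsum_injective]
    intro f g hfg
    rw [← sub_eq_zero] at hfg ⊢
    rw [← map_sub] at hfg
    generalize f - g = e at hfg ⊢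
    refine DFinsupp.ext fun r => Subtype.ext (hom_ext fun i j => ?_)
    let c := Y.deg j - X.deg i
    have hind := (A.gr_internal (X.obj i) (Y.obj j)).submodule_iSupIndep.comp
      (f := fun r : ℤ => r - c) sub_left_injective
    rw [iSupIndep_iff_dfinsupp_lsum_injective] at hind
    let t : (Π₀ r, gr X Y r) →ₗ[K] Π₀ r, A.gr (X.obj i) (Y.obj j) (r - c) :=
      DFinsupp.mapRange.linearMap fun r =>
        ((entry X Y i j).restrict (p := gr X Y r) (q := A.gr (X.obj i) (Y.obj j) (r - c))
          (fun a ha => ha i j))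
    have ht : t e = 0 := by
      refine hind ?_
      rw [map_zero]
      refine Eq.trans ?_ (congrArg (entry X Y i j) hfg)
      rw [← LinearMap.comp_apply, ← LinearMap.comp_apply]
      congr 1
      ext r a
      simp [t, entry]
    have := DFunLike.congr_fun ht r
    exact congrArg Subtype.val this
  · rw [eq_top_iff]
    intro a _
    rw [← sum_single X Y a]
    refine Submodule.sum_mem _ fun i _ => Submodule.sum_mem _ fun j _ => ?_
    have ha : a i j ∈ ⨆ k, A.gr (X.obj i) (Y.obj j) k := by
      rw [(A.gr_internal _ _).submodule_iSup_eq_top]; trivial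
    generalize a i j = b at ha
    induction ha using Submodule.iSup_induction' with
    | mem k b hb =>
      refine Submodule.mem_iSup_of_mem (k + (Y.deg j - X.deg i)) fun i' j' => ?_
      by_cases h : i' = i ∧ j' = j
      · obtain ⟨rfl, rfl⟩ := h
        rw [single_same]; simpa using hb
      · rw [single_ne _ _ _ _ _ h]; exact Submodule.zero_mem _
    | zero => simp
    | add b b' _ _ h h' => rw [map_add]; exact Submodule.add_mem _ h h'

/-- The chains of entries of the differential. -/
noncomputable abbrev chains (X : Twisted A) (i j : X.ι) : Multiset (Path (X.obj i) (X.obj j)) :=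
  chainPaths X.obj X.level X.x i j

/-- All paths of entries that arise from a path of matrices by inserting chains of entries of the
differentials. -/
noncomputable def insertions {X : Twisted A} : ∀ {Y : Twisted A}, Path X Y → ∀ (i : X.ι) (j : Y.ι),
    Multiset (Path (X.obj i) (Y.obj j))
  | _, .nil, i, j => X.chains i j
  | _, .cons (b := Y) (c := Z) p a, i, j => ∑ k : Y.ι, ∑ l : Z.ι,
      (insertions p i k).bind fun q => (Z.chains l j).map fun r => (q.cons (a k l)).comp r

theorem msum_insertions_cons {M : Type*} [AddCommMonoid M] {X Y Z : Twisted A} (p : Path X Y)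
    (a : Y ⟶ Z) (i : X.ι) (j : Z.ι) (F : Path (X.obj i) (Z.obj j) → M) :
    msum (insertions (p.cons a) i j) F = ∑ k : Y.ι, ∑ l : Z.ι,
      msum (insertions p i k) fun q => msum (Z.chains l j) fun r =>
        F ((q.cons (a k l)).comp r) := by
  simp [insertions]

theorem sum_comm₄ {α β γ δ M : Type*} [Fintype α] [Fintype β] [Fintype γ] [Fintype δ]
    [AddCommMonoid M] (f : α → β → γ → δ → M) :
    ∑ a, ∑ b, ∑ c, ∑ d, f a b c d = ∑ c, ∑ d, ∑ a, ∑ b, f a b c d := by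
  have h := Finset.sum_comm (s := Finset.univ) (t := Finset.univ)
    (f := fun (p : α × β) (q : γ × δ) => f p.1 p.2 q.1 q.2)
  simpa only [Fintype.sum_prod_type] using h

/-- The chains inserted just before `a` are counted with `p`, those just after it with `q`. -/
theorem msum_insertions_cons_comp {M : Type*} [AddCommMonoid M] {W X Y Z : Twisted A}
    (p : Path W X) (a : X ⟶ Y) (q : Path Y Z) (i : W.ι) (j : Z.ι)
    (F : Path (W.obj i) (Z.obj j) → M) :
    msum (insertions ((p.cons a).comp q) i j) F = ∑ k : X.ι, ∑ l : Y.ι,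
      msum (insertions p i k) fun P => msum (insertions q l j) fun Q =>
        F ((P.cons (a k l)).comp Q) := by
  induction q with
  | nil => exact msum_insertions_cons p a i j F
  | @cons Y' Z q b ih =>
    rw [Path.comp_cons, msum_insertions_cons]
    simp only [ih, msum_insertions_cons, msum_fun_sum]
    simp only [← Path.comp_cons, Path.comp_assoc]
    exact sum_comm₄ _

/-- A cut of a path with insertions falls into one of the inserted chains, and it divides that chain
into the final insertion of the first part and the initial insertion of the second. This reduces the
`A_∞`-relations for matrices to those of `A`. -/
theorem msum_insertions_sumSplit {M : Type*} [AddCommGroup M] {X Z : Twisted A} (p : Path X Z)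
    (i : X.ι) (j : Z.ι) (H : ∀ U : A.Ob, Path (X.obj i) U → Path U (Z.obj j) → M) :
    msum (insertions p i j) (fun P => sumSplit P H) =
      sumSplit p fun Y p₁ p₂ => ∑ m : Y.ι, msum (insertions p₁ i m) fun P₁ =>
        msum (insertions p₂ m j) fun P₂ => H (Y.obj m) P₁ P₂ := by
  induction p with
  | nil => exact msum_chainPaths_sumSplit i j H
  | @cons Y Z p a ih =>
    rw [msum_insertions_cons]
    simp only [sumSplit_cons_comp, msum_fun_add, Finset.sum_add_distrib, sumSplit]
    rw [add_comm]
    congr 1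
    · simp only [msum_chainPaths_sumSplit, msum_insertions_cons, msum_fun_sum]
      conv_rhs => rw [Finset.sum_comm]
      refine Finset.sum_congr rfl fun k _ => ?_
      rw [Finset.sum_comm]
      rfl
    · simp only [msum_sumSplit, ih, sum_sumSplit, msum_insertions_cons, msum_fun_sum]
      refine sumSplit_congr _ fun Y p₁ p₂ => ?_
      conv_rhs => rw [Finset.sum_comm]
      refine Finset.sum_congr rfl fun k _ => ?_
      rw [Finset.sum_comm]
end Twisted

/-! ### Homogeneous functions of paths -/

namespace AInfCategory

variable {K : Type w} [Field K] (A : AInfCategory.{w, u, v} K)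

theorem pathSign_cons_comp {W X Y Z : A.Ob} (p : Path W X) (a : X ⟶ Y) (q : Path Y Z) :
    A.pathSign A.gr_internal ((p.cons a).comp q) =
      ((A.pathSign A.gr_internal p).cons (A.ε X Y a)).comp (A.pathSign A.gr_internal q) := by
  induction q with
  | nil => rfl
  | cons q b ih => simp only [Path.comp_cons, AInfData.pathSign, ih]

theorem hasRedDeg_cons_comp {W X Y Z : A.Ob} {p : Path W X} {a : X ⟶ Y} {q : Path Y Z}
    {r k s : ℤ} (hp : A.HasRedDeg p r) (ha : a ∈ A.gr X Y k) (hq : A.HasRedDeg q s) :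
    A.HasRedDeg ((p.cons a).comp q) (r + (k - 1) + s) := by
  induction q generalizing s with
  | nil =>
    obtain rfl : s = 0 := hq
    exact ⟨k, ha, by simpa using hp⟩
  | cons q b ih =>
    obtain ⟨l, hb, hq⟩ := hq
    refine ⟨l, hb, ?_⟩
    have := ih hq
    rwa [show r + (k - 1) + (s - (l - 1)) = r + (k - 1) + s - (l - 1) by ring] at this

/-- Functions of paths that are homogeneous in every entry. -/
def IsHomog {M : Type*} [AddCommGroup M] [Module K M] {X Z : A.Ob} (F : Path X Z → M) : Prop :=
  ∀ ⦃x y : A.Ob⦄ (p : Path X x) (c : K) (a : x ⟶ y) (q : Path y Z),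
    F ((p.cons (c • a)).comp q) = c • F ((p.cons a).comp q)

theorem isHomog_μ (X Z : A.Ob) : A.IsHomog (A.μ : Path X Z → _) := fun _ _ => A.μ_smul

variable {A}

theorem IsHomog.zero {M : Type*} [AddCommGroup M] [Module K M] {X Z : A.Ob}
    {F : Path X Z → M} (hF : A.IsHomog F) {x y : A.Ob} (p : Path X x) (q : Path y Z) :
    F ((p.cons (0 : x ⟶ y)).comp q) = 0 := by
  simpa using hF p 0 0 q

theorem IsHomog.comp_right {M : Type*} [AddCommGroup M] [Module K M] {X Y Z : A.Ob}
    {F : Path X Z → M} (hF : A.IsHomog F) (q : Path Y Z) : A.IsHomog fun p => F (p.comp q) := by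
  intro x y p c a q'
  simp only [Path.comp_assoc]
  exact hF _ _ _ _

theorem IsHomog.comp_left {M : Type*} [AddCommGroup M] [Module K M] {X Y Z : A.Ob}
    {F : Path X Z → M} (hF : A.IsHomog F) (p : Path X Y) : A.IsHomog fun q => F (p.comp q) := by
  intro x y q c a q'
  simp only [← Path.comp_assoc, Path.comp_cons]
  exact hF _ _ _ _

theorem IsHomog.msum {M α : Type*} [AddCommGroup M] [Module K M] {X Z : A.Ob}
    {F : α → Path X Z → M} (hF : ∀ a, A.IsHomog (F a)) (S : Multiset α) :
    A.IsHomog fun p => msum S fun a => F a p := by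
  intro x y p c a q
  simp only [← msum_fun_smul]
  exact msum_congr fun b _ => hF b p c a q

theorem IsHomog.cons {M : Type*} [AddCommGroup M] [Module K M] {X Y Z : A.Ob}
    {F : Path X Z → M} (hF : A.IsHomog F) (b : Y ⟶ Z) : A.IsHomog fun p => F (p.cons b) :=
  hF.comp_right b.toPath

end AInfCategory

/-! ### The `A_∞`-relations for twisted complexes -/

namespace Twisted

variable {K : Type w} [Field K] {A : AInfCategory.{w, u, v} K}

/-- The entry `x k j` has reduced degree `deg k - deg j`, so the sum along a chain telescopes. -/
theorem hasRedDeg_chains (X : Twisted A) (i j : X.ι) : ∀ p ∈ X.chains i j,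
    A.HasRedDeg p (X.deg i - X.deg j) := by
  classical
  induction hn : X.level j using Nat.strong_induction_on generalizing j with
  | _ n ih =>
    intro p hp
    rw [chains, chainPaths_eq, Multiset.mem_add, Multiset.mem_sum] at hp
    rcases hp with hp | ⟨k, _, hp⟩
    · by_cases hij : i = j
      · subst hij
        rw [nilPaths_self, Multiset.mem_singleton] at hp
        subst hp
        simp [AInfData.HasRedDeg]
      · rw [nilPaths_ne _ hij] at hp
        simp at hp
    · split_ifs at hp with hk
      · obtain ⟨q, hq, rfl⟩ := Multiset.mem_map.1 hp
        refine ⟨_, X.x_mem k j, ?_⟩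
        convert ih _ (hn ▸ hk) k rfl q hq using 1
        ring
      · simp at hp

/-- `μ^d(a_d, …, a₁)`. -/
noncomputable def μ {X Y : Twisted A} (p : Path X Y) : X ⟶ Y := fun i j =>
  sgn K (X.deg i) • msum (insertions p i j) A.μ

theorem μ_add {W X Y Z : Twisted A} (p : Path W X) (a b : X ⟶ Y) (q : Path Y Z) :
    μ ((p.cons (a + b)).comp q) = μ ((p.cons a).comp q) + μ ((p.cons b).comp q) := by
  refine hom_ext fun i j => ?_
  simp only [μ, msum_insertions_cons_comp, add_apply, A.μ_add, msum_fun_add,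
    Finset.sum_add_distrib, smul_add]

theorem μ_smul {W X Y Z : Twisted A} (p : Path W X) (c : K) (a : X ⟶ Y) (q : Path Y Z) :
    μ ((p.cons (c • a)).comp q) = c • μ ((p.cons a).comp q) := by
  refine hom_ext fun i j => ?_
  simp only [μ, msum_insertions_cons_comp, smul_apply, A.μ_smul, msum_fun_smul,
    ← Finset.smul_sum]
  rw [smul_comm]

variable (A) in
/-- The morphisms and operations of the category of twisted complexes. -/
noncomputable abbrev data : AInfData.{w, max u v 1, v} K where
  Ob := Twisted A
  gr := gr
  μ := μ
  μ_nil X := hom_ext fun i j => by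
    have := X.mc i j
    simp only [μ, insertions, zero_apply]
    rw [this, smul_zero]
  μ_add := μ_add
  μ_smul := μ_smul

theorem hasRedDeg_insertions {X Y : Twisted A} (p : Path X Y) (r : ℤ)
    (hp : (data A).HasRedDeg p r) (i : X.ι) (j : Y.ι) : ∀ P ∈ insertions p i j,
    A.HasRedDeg P (r - (Y.deg j - X.deg i)) := by
  induction p generalizing r with
  | nil =>
    obtain rfl : r = 0 := hp
    intro P hP
    convert hasRedDeg_chains X i j P hP using 1
    ring
  | @cons Y Z p a ih =>
    obtain ⟨s, ha, hp⟩ := hp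
    intro P hP
    simp only [insertions, Multiset.mem_sum, Multiset.mem_bind, Multiset.mem_map] at hP
    obtain ⟨k, _, l, _, q, hq, t, ht, rfl⟩ := hP
    convert A.hasRedDeg_cons_comp (ih _ hp k q hq) (ha k l) (hasRedDeg_chains Z l j t ht) using 1
    ring

/-- The degree of an entry differs from that of the matrix by `deg j - deg i`, which accounts for
the two signs. -/
theorem ε_entry {X Y : Twisted A} (a : X ⟶ Y) (i : X.ι) (j : Y.ι) :
    signTwist (gr X Y) (gr_internal X Y) 1 a i j =
      (sgn K (X.deg i) * sgn K (Y.deg j)) • A.ε _ _ (a i j) := by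
  refine eq_of_homogeneous (gr X Y) (gr_internal X Y)
    (f := entry X Y i j ∘ₗ signTwist (gr X Y) (gr_internal X Y) 1)
    (f' := (sgn K (X.deg i) * sgn K (Y.deg j)) • (A.ε _ _ ∘ₗ entry X Y i j)) (fun k b hb => ?_) a
  have h := signTwist_apply (gr X Y) (gr_internal X Y) 1 k hb
  simp only [LinearMap.comp_apply, LinearMap.smul_apply, h, map_smul]
  change _ • b i j = _ • A.ε _ _ (b i j)
  rw [A.ε_eq (hb i j), smul_smul, ← sgn, ← sgn_add, ← sgn_add, one_mul]
  congr 1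
  rw [show X.deg i + Y.deg j + (k - (Y.deg j - X.deg i) - 1) =
    (X.deg i + X.deg i) + (k - 1) by ring, sgn_add (_ + _), sgn_add (X.deg i), sgn_mul_self, one_mul]

/-- Each entry of the differential contributes the sign of the difference of the degrees of its
ends; along a chain these signs telescope. -/
theorem msum_chains_pathSign {M : Type*} [AddCommGroup M] [Module K M] (X : Twisted A)
    (i j : X.ι) (F : Path (X.obj i) (X.obj j) → M) (hF : A.IsHomog F) :
    msum (X.chains i j) (fun p => F (A.pathSign A.gr_internal p)) =
      (sgn K (X.deg i) * sgn K (X.deg j)) • msum (X.chains i j) F := by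
  classical
  induction hn : X.level j using Nat.strong_induction_on generalizing j with
  | _ n ih =>
    rw [chains, chainPaths_eq]
    simp only [msum_add, msum_finset_sum, msum_ite, msum_map, smul_add, Finset.smul_sum]
    congr 1
    · by_cases hij : i = j
      · subst hij; simp [nilPaths_self, AInfData.pathSign]
      · simp [nilPaths_ne _ hij]
    · refine Finset.sum_congr rfl fun k _ => ?_
      split_ifs with hk
      · have h : ∀ p : Path (X.obj i) (X.obj k), F (A.pathSign A.gr_internal (p.cons (X.x k j))) =
            (sgn K (X.deg k) * sgn K (X.deg j)) •
              F ((A.pathSign A.gr_internal p).cons (X.x k j)) := fun p => by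
          rw [AInfData.pathSign, A.ε_eq (X.x_mem k j)]
          refine (hF _ _ _ .nil).trans ?_
          congr 1
          rw [← sgn_add, ← sgn_neg]
          rw [show -(1 - (X.deg j - X.deg k) - 1) = X.deg j - X.deg k by ring, sgn_sub, sgn_add,
            mul_comm]
        simp only [h, msum_fun_smul]
        rw [ih (X.level k) (hn ▸ hk) k (fun p => F (p.cons (X.x k j))) (hF.cons _) rfl, smul_smul]
        congr 1
        linear_combination sgn K (X.deg i) * sgn K (X.deg j) * sgn_mul_self (K := K) (X.deg k)
      · simp

/-- The discrepancies between the signs in `A` and the signs for matrices cancel at every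
intermediate summand, leaving those of the two ends. -/
theorem msum_insertions_pathSign {M : Type*} [AddCommGroup M] [Module K M] {X Y : Twisted A}
    (p : Path X Y) (i : X.ι) (j : Y.ι) (F : Path (X.obj i) (Y.obj j) → M) (hF : A.IsHomog F) :
    msum (insertions ((data A).pathSign gr_internal p) i j) F =
      (sgn K (X.deg i) * sgn K (Y.deg j)) •
        msum (insertions p i j) fun P => F (A.pathSign A.gr_internal P) := by
  induction p with
  | nil =>
    refine Eq.trans ?_ (congrArg _ (msum_chains_pathSign X i j F hF).symm)
    rw [smul_smul, mul_mul_mul_comm, sgn_mul_self, sgn_mul_self, one_mul, one_smul]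
    rfl
  | @cons Y Z p a ih =>
    rw [AInfData.pathSign, msum_insertions_cons, msum_insertions_cons, Finset.smul_sum]
    refine Finset.sum_congr rfl fun k _ => ?_
    rw [Finset.smul_sum]
    refine Finset.sum_congr rfl fun l _ => ?_
    simp only [A.pathSign_cons_comp, ε_entry a k l, hF _ _ _ _, msum_fun_smul]
    rw [ih k _ (AInfCategory.IsHomog.msum (fun r => (hF.comp_right r).cons _) _)]
    have h : ∀ P, msum (Z.chains l j) (fun r => F (((A.pathSign A.gr_internal P).cons
        (A.ε _ _ (a k l))).comp (A.pathSign A.gr_internal r))) = _ := fun P =>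
      msum_chains_pathSign Z l j _ (hF.comp_left ((A.pathSign A.gr_internal P).cons
        (A.ε _ _ (a k l))))
    simp only [h, msum_fun_smul, smul_smul]
    congr 1
    linear_combination (sgn K (X.deg i) * sgn K (Z.deg l)) *
      (sgn_mul_self (K := K) (Y.deg k) - sgn_mul_self (K := K) (Z.deg j))

variable (A) in
/-- The category of twisted complexes. -/
noncomputable abbrev category : AInfCategory.{w, max u v 1, v} K where
  toAInfData := data A
  gr_internal := gr_internal
  finite X Y := inferInstance
  μ_mem p r hp i j := by
    refine Submodule.smul_mem _ _ (msum_mem _ _ _ fun P hP => ?_)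
    convert A.μ_mem P _ (hasRedDeg_insertions p r hp i j P hP) using 1
    ring_nf
  relation {X Y} p := by
    refine hom_ext fun i j => ?_
    -- The relation is the sum of the relations of `A` over all insertions. Reorganized by
    -- `msum_insertions_sumSplit`, it agrees with the desired one up to signs.
    have hrel := msum_congr (S := insertions p i j) fun P _ => A.relation P
    rw [msum_fun_zero, msum_insertions_sumSplit] at hrel
    refine Eq.trans ?_ hrel
    refine (map_sumSplit (entry X Y i j).toAddMonoidHom p _).trans ?_
    refine sumSplit_congr p fun Y p₁ r => ?_
    simp only [msum_insertions_sumSplit, msum_sumSplit, sum_sumSplit]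
    refine (map_sumSplit (entry _ _ i j).toAddMonoidHom r _).trans ?_
    refine sumSplit_congr r fun Z q p₂ => ?_
    change sgn K (X.deg i) • msum (insertions _ i j) A.μ = _
    rw [msum_insertions_cons_comp]
    simp only [μ, A.μ_smul, msum_fun_smul]
    rw [Finset.smul_sum]
    refine Finset.sum_congr rfl fun m _ => ?_
    rw [Finset.smul_sum, msum_fun_sum]
    refine Finset.sum_congr rfl fun m' _ => ?_
    rw [msum_insertions_pathSign p₁ i m _ (AInfCategory.IsHomog.msum (fun P₂ =>
      ((A.isHomog_μ _ _).comp_right P₂).cons _) _), smul_smul, smul_smul]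
    -- One factor `sgn (deg i)` comes from the outer operation and `sgn (deg m)` from the inner one;
    -- the remaining two come from the signs of the path `p₁`.
    have hs : sgn K (X.deg i) * sgn K (Y.deg m) * (sgn K (X.deg i) * sgn K (Y.deg m)) = 1 := by
      rw [← sgn_add, sgn_mul_self]
    rw [hs, one_smul]
    refine msum_congr fun P₁ _ => ?_
    rw [msum_comm]
    refine msum_congr fun P₂ _ => ?_
    exact map_msum (A.μEntry _ P₂) _ _

end Twisted

/-! ### Splitting off a summand of highest level -/

namespace Twisted

variable {K : Type w} [Field K] {A : AInfCategory.{w, u, v} K}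

/-- The differential `μ^1`. -/
noncomputable def diff (X Y : Twisted A) : (X ⟶ Y) →ₗ[K] (X ⟶ Y) := (category A).d X Y

/-- The product `μ^2`. -/
noncomputable def prod (X Y Z : Twisted A) : (X ⟶ Y) →ₗ[K] (Y ⟶ Z) →ₗ[K] (X ⟶ Z) :=
  (category A).μ₂ X Y Z

/-- The sign `a ↦ (-1)^(|a| - 1) a`. -/
noncomputable def ε (X Y : Twisted A) : (X ⟶ Y) →ₗ[K] (X ⟶ Y) := (category A).ε X Y

theorem diff_apply {X Y : Twisted A} (a : X ⟶ Y) (i : X.ι) (j : Y.ι) :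
    diff X Y a i j = sgn K (X.deg i) • ∑ k, ∑ l, msum (X.chains i k) fun p =>
      msum (Y.chains l j) fun q => A.μ ((p.cons (a k l)).comp q) := by
  change sgn K (X.deg i) • msum (insertions a.toPath i j) A.μ = _
  rw [Hom.toPath, msum_insertions_cons]
  rfl

theorem prod_apply {X Y Z : Twisted A} (a : X ⟶ Y) (b : Y ⟶ Z) (i : X.ι) (j : Z.ι) :
    prod X Y Z a b i j = sgn K (X.deg i) • ∑ k', ∑ l', ∑ k, ∑ l,
      msum (X.chains i k) fun p => msum (Y.chains l k') fun q => msum (Z.chains l' j) fun r =>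
        A.μ ((((p.cons (a k l)).comp q).cons (b k' l')).comp r) := by
  change sgn K (X.deg i) • msum (insertions (a.toPath.cons b) i j) A.μ = _
  simp only [Hom.toPath, msum_insertions_cons]
  rfl

theorem ε_apply {X Y : Twisted A} (a : X ⟶ Y) (i : X.ι) (j : Y.ι) :
    ε X Y a i j = (sgn K (X.deg i) * sgn K (Y.deg j)) • A.ε _ _ (a i j) := ε_entry a i j

theorem diff_prod {X Y Z : Twisted A} (a : X ⟶ Y) (b : Y ⟶ Z) :
    diff X Z (prod X Y Z a b) + prod X Y Z (diff X Y a) b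
      + prod X Y Z (ε X Y a) (diff Y Z b) = 0 := (category A).relation₂ a b

/-- An object as a twisted complex. -/
noncomputable abbrev ofOb (V : A.Ob) (n : ℤ) : Twisted A where
  ι := Unit
  obj _ := V
  deg _ := n
  level _ := 0
  x _ _ := 0
  x_mem _ _ := Submodule.zero_mem _
  mc i j := by
    rw [chainPaths_of_le (level := fun _ : Unit => 0) le_rfl]
    cases i; cases j
    rw [nilPaths_self, msum_singleton, A.μ_nil]

theorem chains_self (B : Twisted A) (i : B.ι) : B.chains i i = {Path.nil} := by
  rw [chains, chainPaths_of_le le_rfl, nilPaths_self]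

theorem sum_ofOb {M : Type*} [AddCommMonoid M] (V : A.Ob) (n : ℤ) (f : (ofOb V n).ι → M)
    (j : (ofOb V n).ι) : ∑ i, f i = f j :=
  Fintype.sum_unique f

section erase

variable (B : Twisted A) (z : B.ι)

open Classical in
noncomputable instance eraseFintype : Fintype {i : B.ι // i ≠ z} :=
  inferInstance

/-- A chain that ends at another summand never passes through `z`, since nothing lies above `z`. -/
theorem chainPaths_erase (hz : ∀ k, B.level k ≤ B.level z) (i j : {i : B.ι // i ≠ z}) :
    chainPaths (fun k : {i : B.ι // i ≠ z} => B.obj k) (fun k => B.level k)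
      (fun k l => B.x k l) i j = B.chains i.1 j.1 := by
  induction hn : B.level j.1 using Nat.strong_induction_on generalizing j with
  | _ n ih =>
    rw [chains, chainPaths_eq, chainPaths_eq]
    congr 1
    · by_cases hij : i = j
      · subst hij; rw [nilPaths_self, nilPaths_self]
      · rw [nilPaths_ne _ hij, nilPaths_ne _ (fun h => hij (Subtype.ext h))]
    · classical
      refine Eq.trans ?_ (Fintype.sum_eq_add_sum_subtype_ne _ z).symm
      rw [if_neg (not_lt.2 (hz _)), zero_add]
      refine Finset.sum_congr rfl fun k _ => ?_
      split_ifs with hk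
      · rw [ih _ (hn ▸ hk) k rfl]
      · rfl

/-- The twisted complex with the summand `z` of highest level removed. -/
noncomputable abbrev erase (hz : ∀ k, B.level k ≤ B.level z) : Twisted A where
  ι := {i : B.ι // i ≠ z}
  obj k := B.obj k
  deg k := B.deg k
  level k := B.level k
  x k l := B.x k l
  x_mem k l := B.x_mem k l
  mc i j := by rw [chainPaths_erase B z hz]; exact B.mc i j

/-- The summand `z`. -/
noncomputable abbrev sink : Twisted A := ofOb (B.obj z) (B.deg z)

open Classical in
/-- The entries of the differential that go to the summand `z`. -/
noncomputable def sinkEntry (k : B.ι) : B.obj k ⟶ B.obj z :=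
  if B.level k < B.level z then B.x k z else 0

variable {B z} (hz : ∀ k, B.level k ≤ B.level z)

theorem chains_erase (i j : (B.erase z hz).ι) :
    (B.erase z hz).chains i j = B.chains i.1 j.1 :=
  chainPaths_erase B z hz i j

theorem sum_erase {M : Type*} [AddCommMonoid M] (f : B.ι → M) :
    ∑ i, f i = f z + ∑ i : (B.erase z hz).ι, f i.1 := by
  classical
  exact Fintype.sum_eq_add_sum_subtype_ne f z

theorem chains_sink_left (hz : ∀ k, B.level k ≤ B.level z) (j : (B.erase z hz).ι) :
    B.chains z j.1 = 0 :=
  chainPaths_eq_zero (Ne.symm j.2) (not_lt.2 (hz _))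

/-- The component of the differential that goes to the summand `z`. -/
noncomputable def toSink : B.erase z hz ⟶ B.sink z := fun k _ => sinkEntry B z k.1

/-- A chain from another summand to `z` has a last entry, and what precedes it avoids `z`.
Homogeneity of `F` disposes of the entries that `sinkEntry` replaces by zero. -/
theorem msum_chains_sink {M : Type*} [AddCommGroup M] [Module K M] (i : (B.erase z hz).ι)
    (F : Path (B.obj i.1) (B.obj z) → M) (hF : A.IsHomog F) :
    msum (B.chains i.1 z) F = ∑ k : (B.erase z hz).ι, msum (B.chains i.1 k.1) fun p =>
      F (p.cons (sinkEntry B z k.1)) := by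
  classical
  rw [chains, chainPaths_eq, nilPaths_ne _ i.2]
  simp only [zero_add, msum_finset_sum, msum_ite, msum_map]
  rw [sum_erase hz, if_neg (lt_irrefl _), zero_add]
  refine Finset.sum_congr rfl fun k _ => ?_
  unfold sinkEntry
  split_ifs with hk
  · rfl
  · exact ((msum_congr fun p _ => hF.zero p .nil).trans (msum_fun_zero _)).symm

theorem toSink_mem : toSink hz ∈ gr (B.erase z hz) (B.sink z) 1 := by
  intro k j
  change sinkEntry B z k.1 ∈ A.gr (B.obj k.1) (B.obj z) (1 - (B.deg z - B.deg k.1))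
  unfold sinkEntry
  split_ifs with hk
  · exact B.x_mem k.1 z
  · exact Submodule.zero_mem _

/-- This is the Maurer--Cartan equation of `B` in the entries with target `z`. Hence `B` is the
mapping cone of a closed morphism. -/
theorem diff_toSink : diff (B.erase z hz) (B.sink z) (toSink hz) = 0 := by
  refine hom_ext fun i j => ?_
  rw [diff_apply]
  simp only [sum_ofOb _ _ _ j, chains_self, msum_singleton, Path.comp_nil, chains_erase]
  have h := msum_chains_sink hz i A.μ (A.isHomog_μ _ _)
  rw [B.mc] at h
  exact (congrArg _ h.symm).trans (smul_zero _)

variable (X : Twisted A)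

/-- Morphisms to `B`, without the component at `z`. -/
def colErase : (X ⟶ B) →ₗ[K] (X ⟶ B.erase z hz) where
  toFun a i j := a i j.1
  map_add' _ _ := rfl
  map_smul' _ _ := rfl

/-- The component of morphisms to `B` at `z`. -/
def colSink (z : B.ι) : (X ⟶ B) →ₗ[K] (X ⟶ B.sink z) where
  toFun a i _ := a i z
  map_add' _ _ := rfl
  map_smul' _ _ := rfl

/-- Morphisms from `B`, without the component at `z`. -/
def rowErase : (B ⟶ X) →ₗ[K] (B.erase z hz ⟶ X) where
  toFun a i j := a i.1 j
  map_add' _ _ := rfl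
  map_smul' _ _ := rfl

/-- The component of morphisms from `B` at `z`. -/
def rowSink (z : B.ι) : (B ⟶ X) →ₗ[K] (B.sink z ⟶ X) where
  toFun a _ j := a z j
  map_add' _ _ := rfl
  map_smul' _ _ := rfl

variable {X}

@[simp] theorem colErase_apply (a : X ⟶ B) (i : X.ι) (j : (B.erase z hz).ι) :
    colErase hz X a i j = a i j.1 := rfl

@[simp] theorem colSink_apply (a : X ⟶ B) (i : X.ι) (j : (B.sink z).ι) :
    colSink X z a i j = a i z := rfl

@[simp] theorem rowErase_apply (a : B ⟶ X) (i : (B.erase z hz).ι) (j : X.ι) :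
    rowErase hz X a i j = a i.1 j := rfl

@[simp] theorem rowSink_apply (a : B ⟶ X) (i : (B.sink z).ι) (j : X.ι) :
    rowSink X z a i j = a z j := rfl

@[simp] theorem toSink_apply (i : (B.erase z hz).ι) (j : (B.sink z).ι) :
    toSink hz i j = sinkEntry B z i.1 := rfl

/-- No chain leaves `z` for another summand, so the column of `z` does not contribute. Thus the
morphisms to the sink form a subcomplex, with quotient the morphisms to `B.erase z hz`. -/
theorem colErase_diff (a : X ⟶ B) :
    colErase hz X (diff X B a) = diff X (B.erase z hz) (colErase hz X a) := by
  refine hom_ext fun i j => ?_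
  simp only [colErase_apply, diff_apply, sum_erase hz, chains_sink_left hz, chains_erase,
    msum_zero, msum_fun_zero, zero_add]

/-- For morphisms out of `B` the roles are exchanged: those that vanish on `z` form the subcomplex,
and restriction to `z` is the quotient map. -/
theorem rowSink_diff (hz : ∀ k, B.level k ≤ B.level z) (b : B ⟶ X) :
    rowSink X z (diff B X b) = diff (B.sink z) X (rowSink X z b) := by
  refine hom_ext fun i j => ?_
  simp only [rowSink_apply, diff_apply, sum_erase hz, chains_sink_left hz, chains_self, msum_zero,
    msum_singleton, sum_ofOb _ _ _ i, Finset.sum_const_zero, add_zero]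

theorem sum_comm₃ {α β γ M : Type*} [Fintype α] [Fintype β] [Fintype γ]
    [AddCommMonoid M] (f : α → β → γ → M) :
    ∑ a, ∑ b, ∑ c, f a b c = ∑ c, ∑ a, ∑ b, f a b c := by
  have h := Finset.sum_comm (s := Finset.univ) (t := Finset.univ)
    (f := fun (p : α × β) (q : γ) => f p.1 p.2 q)
  simpa only [Fintype.sum_prod_type] using h

/-- Chains ending at `z` are empty or end with an entry into `z`; the latter give the product with
`toSink hz`. -/
theorem colSink_diff (a : X ⟶ B) :
    colSink X z (diff X B a) = diff X (B.sink z) (colSink X z a) +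
      prod X (B.erase z hz) (B.sink z) (colErase hz X a) (toSink hz) := by
  refine hom_ext fun i j => ?_
  simp only [colSink_apply, add_apply, diff_apply, prod_apply, ← smul_add]
  congr 1
  simp only [sum_erase hz, chains_self, msum_singleton, sum_ofOb _ _ _ j, Path.comp_nil,
    Finset.sum_add_distrib, colErase_apply, toSink_apply, chains_erase]
  congr 1
  have h : ∀ (k : X.ι) (l : (B.erase z hz).ι) (p : Path (X.obj i) (X.obj k)),
      A.IsHomog fun q : Path (B.obj l.1) (B.obj z) => A.μ ((p.cons (a k l.1)).comp q) :=
    fun k l p => (A.isHomog_μ _ _).comp_left _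
  simp only [fun k l p => msum_chains_sink hz l _ (h k l p), msum_fun_sum]
  exact sum_comm₃ _

theorem rowErase_diff (b : B ⟶ X) :
    rowErase hz X (diff B X b) = diff (B.erase z hz) X (rowErase hz X b) +
      prod (B.erase z hz) (B.sink z) X (toSink hz) (rowSink X z b) := by
  refine hom_ext fun i j => ?_
  simp only [rowErase_apply, add_apply, diff_apply, prod_apply, ← smul_add]
  congr 1
  simp only [sum_erase hz, chains_self, msum_singleton, sum_ofOb _ _ _ (default : (B.sink z).ι),
    Path.comp_nil, toSink_apply, chains_erase, rowSink_apply]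
  rw [add_comm]
  congr 1
  have h : ∀ l, A.IsHomog fun p : Path (B.obj i.1) (B.obj z) =>
      msum (X.chains l j) fun q => A.μ ((p.cons (b z l)).comp q) := fun l =>
    AInfCategory.IsHomog.msum (fun q => ((A.isHomog_μ _ _).comp_right q).cons _) _
  simp only [fun l => msum_chains_sink hz i _ (h l)]

variable {Y : Twisted A}

theorem colErase_prod (a : X ⟶ Y) (b : Y ⟶ B) :
    colErase hz X (prod X Y B a b) = prod X Y (B.erase z hz) a (colErase hz Y b) := by
  refine hom_ext fun i j => ?_
  simp only [colErase_apply, prod_apply, sum_erase (B := B) hz, chains_sink_left hz, chains_erase,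
    msum_zero, msum_fun_zero, zero_add, Finset.sum_const_zero]

theorem rowSink_prod (hz : ∀ k, B.level k ≤ B.level z) (a : B ⟶ X) (b : X ⟶ Y) :
    rowSink Y z (prod B X Y a b) = prod (B.sink z) X Y (rowSink X z a) b := by
  refine hom_ext fun i j => ?_
  simp only [rowSink_apply, prod_apply, sum_erase (B := B) hz, chains_sink_left hz, chains_self,
    msum_zero, msum_singleton, sum_ofOb _ _ _ i, Finset.sum_const_zero, add_zero]

theorem colSink_prod (a : X ⟶ Y) (b : Y ⟶ B) (hb : colErase hz Y b = 0) :
    colSink X z (prod X Y B a b) = prod X Y (B.sink z) a (colSink Y z b) := by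
  have hb' : ∀ i (j : (B.erase z hz).ι), b i j.1 = 0 := fun i j => congrFun (congrFun hb i) j
  have h0 : ∀ {U V W T : A.Ob} (p : Path U V) (q : Path W T),
      A.μ ((p.cons (0 : V ⟶ W)).comp q) = 0 := fun p q => (A.isHomog_μ _ _).zero p q
  refine hom_ext fun i j => ?_
  simp only [colSink_apply, prod_apply, sum_erase (B := B) hz, chains_self,
    msum_singleton, sum_ofOb _ _ _ j, hb', h0, msum_fun_zero, Finset.sum_const_zero, add_zero]

theorem rowErase_prod (a : B ⟶ X) (b : X ⟶ Y) (ha : rowSink X z a = 0) :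
    rowErase hz Y (prod B X Y a b) = prod (B.erase z hz) X Y (rowErase hz X a) b := by
  have ha' : ∀ j, a z j = 0 := fun j => congrFun (congrFun ha ()) j
  have h0 : ∀ {U V W T T' S : A.Ob} (p : Path U V) (q : Path W T) (c : T ⟶ T') (r : Path T' S),
      A.μ ((((p.cons (0 : V ⟶ W)).comp q).cons c).comp r) = 0 := fun p q c r => by
    have := (A.isHomog_μ _ _).zero p ((q.cons c).comp r)
    rwa [← Path.comp_assoc, Path.comp_cons] at this
  refine hom_ext fun i j => ?_
  simp only [rowErase_apply, prod_apply, sum_erase (B := B) hz, chains_erase, ha', h0,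
    msum_fun_zero, Finset.sum_const_zero, zero_add]

/-- If `a` meets only `z`, then the chain inserted in `B` starts at `z`, hence is empty. -/
theorem prod_eq_prod_sink (a : X ⟶ B) (b : B ⟶ Y) (ha : colErase hz X a = 0) :
    prod X B Y a b = prod X (B.sink z) Y (colSink X z a) (rowSink Y z b) := by
  have ha' : ∀ i (j : (B.erase z hz).ι), a i j.1 = 0 := fun i j => congrFun (congrFun ha i) j
  have h0 : ∀ {U V W T T' S : A.Ob} (p : Path U V) (q : Path W T) (c : T ⟶ T') (r : Path T' S),
      A.μ ((((p.cons (0 : V ⟶ W)).comp q).cons c).comp r) = 0 := fun p q c r => by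
    have := (A.isHomog_μ _ _).zero p ((q.cons c).comp r)
    rwa [← Path.comp_assoc, Path.comp_cons] at this
  refine hom_ext fun i j => ?_
  simp only [prod_apply, sum_erase (B := B) hz, chains_self, chains_sink_left hz, ha', h0,
    msum_fun_zero, Finset.sum_const_zero, add_zero, msum_zero, msum_singleton, colSink_apply,
    rowSink_apply, sum_ofOb _ _ _ (default : (B.sink z).ι), Path.comp_nil]

theorem prod_eq_prod_erase (a : X ⟶ B) (b : B ⟶ Y) (hb : rowSink Y z b = 0) :
    prod X B Y a b = prod X (B.erase z hz) Y (colErase hz X a) (rowErase hz Y b) := by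
  have hb' : ∀ j, b z j = 0 := fun j => congrFun (congrFun hb ()) j
  have h0 : ∀ {U V W T : A.Ob} (p : Path U V) (q : Path W T),
      A.μ ((p.cons (0 : V ⟶ W)).comp q) = 0 := fun p q => (A.isHomog_μ _ _).zero p q
  refine hom_ext fun i j => ?_
  simp only [prod_apply, sum_erase (B := B) hz, chains_erase, chains_sink_left hz, hb', h0,
    msum_fun_zero, Finset.sum_const_zero, zero_add, msum_zero, colErase_apply, rowErase_apply]

theorem colErase_ε (a : X ⟶ B) :
    colErase hz X (ε X B a) = ε X (B.erase z hz) (colErase hz X a) :=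
  hom_ext fun i j => by simp only [colErase_apply, ε_apply]

theorem colSink_ε (a : X ⟶ B) : colSink X z (ε X B a) = ε X (B.sink z) (colSink X z a) :=
  hom_ext fun i j => by simp only [colSink_apply, ε_apply]

theorem rowErase_ε (a : B ⟶ X) :
    rowErase hz X (ε B X a) = ε (B.erase z hz) X (rowErase hz X a) :=
  hom_ext fun i j => by simp only [rowErase_apply, ε_apply]

theorem rowSink_ε (a : B ⟶ X) : rowSink X z (ε B X a) = ε (B.sink z) X (rowSink X z a) :=
  hom_ext fun i j => by simp only [rowSink_apply, ε_apply]

end erase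

end Twisted

/-! ### Acyclicity -/

section Acyclic

variable {R E E' E'' : Type*} [Ring R] [AddCommGroup E] [Module R E] [AddCommGroup E'] [Module R E']
  [AddCommGroup E''] [Module R E'']

/-- The kernel of `d₁` is contained in the range of `d₀`. -/
def Acyclic (d₀ d₁ : E →ₗ[R] E) : Prop := ∀ x, d₁ x = 0 → ∃ y, d₀ y = x

theorem Acyclic.of_subsingleton [Subsingleton E] (d₀ d₁ : E →ₗ[R] E) : Acyclic d₀ d₁ :=
  fun _ _ => ⟨0, Subsingleton.elim _ _⟩

/-- Acyclicity of an extension. -/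
theorem Acyclic.extension {d₀ d₁ : E →ₗ[R] E} {d₀' d₁' : E' →ₗ[R] E'} {d₀'' d₁'' : E'' →ₗ[R] E''}
    (p : E →ₗ[R] E'') (q : E →ₗ[R] E') (hd : ∀ x, d₁ (d₀ x) = 0)
    (hsurj : ∀ y'' y', ∃ y, p y = y'' ∧ q y = y') (hinj : ∀ x, p x = 0 → q x = 0 → x = 0)
    (hp₀ : ∀ x, p (d₀ x) = d₀'' (p x)) (hp₁ : ∀ x, p (d₁ x) = d₁'' (p x))
    (hq₀ : ∀ x, p x = 0 → q (d₀ x) = d₀' (q x)) (hq₁ : ∀ x, p x = 0 → q (d₁ x) = d₁' (q x))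
    (h'' : Acyclic d₀'' d₁'') (h' : Acyclic d₀' d₁') : Acyclic d₀ d₁ := by
  intro x hx
  obtain ⟨y'', hy''⟩ := h'' (p x) (by rw [← hp₁, hx, map_zero])
  obtain ⟨y, hy, -⟩ := hsurj y'' 0
  -- A lifted primitive corrects `x` to an element of the kernel of `p`, where `q` is compatible
  -- with the differentials.
  have hpx : p (x - d₀ y) = 0 := by rw [map_sub, hp₀, hy, hy'', sub_self]
  obtain ⟨y', hy'⟩ := h' (q (x - d₀ y)) (by
    rw [← hq₁ _ hpx, map_sub, hx, hd, sub_self, map_zero])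
  obtain ⟨y₁, hy₁, hy₁'⟩ := hsurj 0 y'
  refine ⟨y + y₁, ?_⟩
  rw [map_add, add_comm, ← eq_sub_iff_add_eq, ← sub_eq_zero]
  refine hinj _ ?_ ?_
  · rw [map_sub, hpx, hp₀, hy₁, map_zero, sub_zero]
  · rw [map_sub, hq₀ _ hy₁, hy₁', hy', sub_self]

end Acyclic

/-! ### Units and mapping cones of multiplication -/

namespace AInfCategory

variable {K : Type w} [Field K] (C : AInfCategory.{w, u, v} K)

theorem d_d {X Y : C.Ob} (a : X ⟶ Y) : C.d X Y (C.d X Y a) = 0 := by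
  have h := C.relation a.toPath
  have h0 : ∀ {U V W : C.Ob} (p : Path U V) (q : Path V W),
      C.μ ((p.cons (0 : V ⟶ V)).comp q) = 0 := fun p q => by
    simpa using C.μ_smul p (0 : K) (0 : _ ⟶ _) q
  have h1 := @h0 _ _ _ (C.pathSign C.gr_internal a.toPath) .nil
  have h2 := h0 (.nil : Path X X) a.toPath
  simp only [sumSplit, Hom.toPath, AInfData.pathSign, C.μ_nil, Path.comp_cons, Path.comp_nil]
    at h h1 h2
  rw [h1, h2] at h
  rw [← h]
  simp only [AInfData.d, Hom.toPath, LinearMap.coe_mk, AddHom.coe_mk]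
  abel

/-- A two-sided identity in the cohomological category. -/
def IsUnitClass (B : C.Ob) (e : C.H B B) : Prop :=
  (∀ (Y : C.Ob) (a : C.H B Y), C.hComp B B Y e a = a) ∧
    ∀ (Y : C.Ob) (a : C.H Y B), C.hComp Y B B a e = a

/-- The mapping cone of multiplication by `e` on `X ⟶ B`. -/
def coneRight (X B : C.Ob) (e : B ⟶ B) : ((X ⟶ B) × (X ⟶ B)) →ₗ[K] ((X ⟶ B) × (X ⟶ B)) :=
  (C.d X B ∘ₗ LinearMap.fst K _ _).prod
    ((C.μ₂ X B B).flip e ∘ₗ LinearMap.fst K _ _ + C.d X B ∘ₗ LinearMap.snd K _ _)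

/-- The mapping cone of multiplication by `e` on `B ⟶ X`. -/
def coneLeft (B X : C.Ob) (e : B ⟶ B) : ((B ⟶ X) × (B ⟶ X)) →ₗ[K] ((B ⟶ X) × (B ⟶ X)) :=
  (C.d B X ∘ₗ LinearMap.fst K _ _).prod
    (C.μ₂ B B X e ∘ₗ LinearMap.fst K _ _ + C.d B X ∘ₗ LinearMap.snd K _ _)

theorem coneRight_apply {X B : C.Ob} (e : B ⟶ B) (a b : X ⟶ B) :
    C.coneRight X B e (a, b) = (C.d X B a, C.μ₂ X B B a e + C.d X B b) := rfl

theorem coneLeft_apply {X B : C.Ob} (e : B ⟶ B) (a b : B ⟶ X) :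
    C.coneLeft B X e (a, b) = (C.d B X a, C.μ₂ B B X e a + C.d B X b) := rfl

variable {C}

theorem coneRight_coneRight {X B : C.Ob} {e : B ⟶ B} (he : C.d B B e = 0)
    (x : (X ⟶ B) × (X ⟶ B)) : C.coneRight X B e (C.coneRight X B e x) = 0 := by
  obtain ⟨a, b⟩ := x
  have h := C.relation₂ a e
  rw [he, map_zero, add_zero] at h
  rw [coneRight_apply, coneRight_apply, map_add, C.d_d, C.d_d, add_zero, add_comm, h]
  rfl

/-- In `relation₂` the first factor acquires the sign `ε` when the differential acts on the second.
For multiplication by `e` on that side, the two successive maps of the cone therefore differ by `ε`;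
this is why `Acyclic` allows two maps. -/
theorem coneLeft_coneLeft {X B : C.Ob} {e : B ⟶ B} (he : C.d B B e = 0)
    (x : (B ⟶ X) × (B ⟶ X)) : C.coneLeft B X (C.ε B B e) (C.coneLeft B X e x) = 0 := by
  obtain ⟨a, b⟩ := x
  have h := C.relation₂ e a
  rw [he, map_zero, LinearMap.zero_apply, add_zero] at h
  rw [coneLeft_apply, coneLeft_apply, map_add, C.d_d, C.d_d, add_zero, add_comm, h]
  rfl

theorem d_ε_eq_zero {X Y : C.Ob} {a : X ⟶ Y} (ha : C.d X Y a = 0) :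
    C.d X Y (C.ε X Y a) = 0 := by rw [C.d_ε, ha, map_zero, neg_zero]

theorem exact_of_exact_ε {X Y : C.Ob} {a c : X ⟶ Y} (h : C.d X Y c = C.ε X Y a) :
    C.d X Y (-C.ε X Y c) = a := by
  rw [map_neg, C.d_ε, neg_neg, h, C.ε_ε]

theorem IsUnitClass.exists_right {B : C.Ob} {e : B ⟶ B} {he : C.d B B e = 0}
    (hu : C.IsUnitClass B (C.cls e he)) {X : C.Ob} {a : X ⟶ B} (ha : C.d X B a = 0) :
    ∃ c, C.d X B c = -C.μ₂ X B B (C.ε X B a) e - a := by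
  have h := hu.2 X (C.cls a ha)
  rw [C.hComp_cls, C.cls_eq_cls] at h
  exact h

theorem IsUnitClass.exists_left {B : C.Ob} {e : B ⟶ B} {he : C.d B B e = 0}
    (hu : C.IsUnitClass B (C.cls e he)) {X : C.Ob} {a : B ⟶ X} (ha : C.d B X a = 0) :
    ∃ c, C.d B X c = C.μ₂ B B X e a - a := by
  have h := hu.1 X (C.cls (C.ε B X a) (d_ε_eq_zero ha))
  rw [C.hComp_cls, C.cls_eq_cls] at h
  obtain ⟨c, hc⟩ := h
  refine ⟨-C.ε B X c, exact_of_exact_ε ?_⟩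
  rw [hc, map_sub, C.ε_μ₂]
  rfl

/-- Multiplication by `e` is the identity on cohomology up to the sign conventions, hence a
quasi-isomorphism, and the cone of a quasi-isomorphism is acyclic. -/
theorem IsUnitClass.acyclic_coneRight {B : C.Ob} {e : B ⟶ B} {he : C.d B B e = 0}
    (hu : C.IsUnitClass B (C.cls e he)) (X : C.Ob) :
    Acyclic (C.coneRight X B e) (C.coneRight X B e) := by
  rintro ⟨a, b⟩ h
  rw [coneRight_apply, Prod.mk_eq_zero] at h
  obtain ⟨ha, hb⟩ := h
  obtain ⟨c, hc⟩ := hu.exists_right (d_ε_eq_zero ha)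
  rw [C.ε_ε] at hc
  -- The second component `b` bounds the product of `a` with `e` up to sign, and `c` compares this
  -- product with `a`; together they bound `a`.
  have hy : C.d X B (-C.ε X B (b - c)) = a := exact_of_exact_ε (by
    rw [map_sub, hc, eq_neg_of_add_eq_zero_right hb]; abel)
  generalize -C.ε X B (b - c) = y at hy
  have hb' : C.d X B (b - C.μ₂ X B B y e) = 0 := by
    have h := C.relation₂ y e
    rw [he, map_zero, add_zero, hy] at h
    rw [map_sub, eq_neg_of_add_eq_zero_right hb, eq_neg_of_add_eq_zero_left h, sub_self]
  obtain ⟨c', hc'⟩ := hu.exists_right hb'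
  -- The primitive `y` of `a` is corrected by a cocycle whose product with `e` represents what is
  -- left of `b`.
  refine ⟨(y - C.ε X B (b - C.μ₂ X B B y e), -c'), ?_⟩
  rw [coneRight_apply, map_sub, hy, d_ε_eq_zero hb', sub_zero, map_neg, hc', map_sub,
    LinearMap.sub_apply]
  congr 1
  abel

theorem IsUnitClass.acyclic_coneLeft {B : C.Ob} {e : B ⟶ B} {he : C.d B B e = 0}
    (hu : C.IsUnitClass B (C.cls e he)) (X : C.Ob) :
    Acyclic (C.coneLeft B X e) (C.coneLeft B X (C.ε B B e)) := by
  rintro ⟨b, c⟩ h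
  rw [coneLeft_apply, Prod.mk_eq_zero] at h
  obtain ⟨hb, hc⟩ := h
  have h := hu.1 X (C.cls b hb)
  rw [C.hComp_cls, C.cls_eq_cls] at h
  obtain ⟨w, hw⟩ := h
  have hy : C.d B X (c - w) = b := by
    rw [map_sub, hw, eq_neg_of_add_eq_zero_right hc]
    simp only [cochainComp, LinearMap.neg_apply, LinearMap.comp_apply]
    abel
  generalize c - w = y at hy
  have hc' : C.d B X (c - C.μ₂ B B X e y) = 0 := by
    have h := C.relation₂ e y
    rw [he, map_zero, LinearMap.zero_apply, add_zero, hy] at h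
    rw [map_sub, eq_neg_of_add_eq_zero_right hc, eq_neg_of_add_eq_zero_left h, sub_self]
  obtain ⟨c', hc''⟩ := hu.exists_left hc'
  refine ⟨(y + (c - C.μ₂ B B X e y), -c'), ?_⟩
  rw [coneLeft_apply, map_add, hy, hc', add_zero, map_neg, hc'', map_add]
  congr 1
  abel

/-- An element that acts invertibly on cohomology yields a unit. -/
theorem exists_isUnitClass {B : C.Ob} {e : B ⟶ B} (he : C.d B B e = 0)
    (hr : ∀ X, Acyclic (C.coneRight X B e) (C.coneRight X B e))
    (hl : ∀ X, Acyclic (C.coneLeft B X e) (C.coneLeft B X (C.ε B B e))) :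
    ∃ u, C.IsUnitClass B u := by
  -- Surjectivity of multiplication by `[e]`, applied to `[e]` itself: `(0, e)` is a cocycle of the
  -- cone, and the first component of a primitive yields `u`.
  have hrs : ∃ u, C.hComp B B B u (C.cls e he) = C.cls e he := by
    obtain ⟨⟨a, c⟩, h⟩ := hr B (0, e) (by rw [coneRight_apply]; simp [he])
    rw [coneRight_apply, Prod.mk.injEq] at h
    refine ⟨C.cls (-C.ε B B a) (by rw [map_neg, d_ε_eq_zero h.1, neg_zero]), ?_⟩
    rw [C.hComp_cls, C.cls_eq_cls]
    refine ⟨-c, ?_⟩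
    rw [map_neg, cochainComp, LinearMap.neg_apply, LinearMap.comp_apply, map_neg, C.ε_ε, map_neg,
      LinearMap.neg_apply, LinearMap.neg_apply, neg_neg, eq_sub_of_add_eq' h.2]
    abel
  have hls : ∃ u, C.hComp B B B (C.cls e he) u = C.cls e he := by
    obtain ⟨⟨b, w⟩, h⟩ := hl B (0, C.ε B B e) (by
      rw [coneLeft_apply]; simp [d_ε_eq_zero he])
    rw [coneLeft_apply, Prod.mk.injEq] at h
    refine ⟨C.cls (C.ε B B b) (d_ε_eq_zero h.1), ?_⟩
    rw [C.hComp_cls, C.cls_eq_cls]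
    refine ⟨C.ε B B w, ?_⟩
    have h2 := congrArg (C.ε B B) h.2
    rw [map_add, C.ε_ε, C.ε_μ₂] at h2
    rw [C.d_ε, cochainComp, LinearMap.neg_apply, LinearMap.comp_apply, LinearMap.neg_apply,
      eq_sub_of_add_eq' h2]
    abel
  -- Injectivity: a primitive `c` of the product completes `a`, up to `ε`, to a cocycle of the cone,
  -- and the first component of a primitive of that cocycle bounds `a`.
  have hri : ∀ (X : C.Ob) (a : C.H X B), C.hComp X B B a (C.cls e he) = 0 → a = 0 := by
    intro X a h
    obtain ⟨a, ha, rfl⟩ := C.cls_surjective a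
    rw [C.hComp_cls, C.cls_eq_zero] at h
    obtain ⟨c, hc⟩ := h
    obtain ⟨⟨y, _⟩, hy⟩ := hr X (C.ε X B a, c) (by
      rw [coneRight_apply, d_ε_eq_zero ha, hc, cochainComp, LinearMap.neg_apply,
        LinearMap.comp_apply, LinearMap.neg_apply, add_neg_cancel]; rfl)
    rw [coneRight_apply, Prod.mk.injEq] at hy
    rw [C.cls_eq_zero]
    exact ⟨_, exact_of_exact_ε hy.1⟩
  have hli : ∀ (X : C.Ob) (a : C.H B X), C.hComp B B X (C.cls e he) a = 0 → a = 0 := by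
    intro X a h
    obtain ⟨a, ha, rfl⟩ := C.cls_surjective a
    rw [C.hComp_cls, C.cls_eq_zero] at h
    obtain ⟨c, hc⟩ := h
    obtain ⟨⟨y, _⟩, hy⟩ := hl X (a, c) (by
      rw [coneLeft_apply, ha, hc, cochainComp, LinearMap.neg_apply,
        LinearMap.comp_apply, LinearMap.neg_apply, add_neg_cancel]; rfl)
    rw [coneLeft_apply, Prod.mk.injEq] at hy
    rw [C.cls_eq_zero]
    exact ⟨y, hy.1⟩
  obtain ⟨u, hu⟩ := hls
  obtain ⟨u', hu'⟩ := hrs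
  -- Since `[e]` absorbs `u`, it cannot distinguish the product of `u` with `a` from `a`; cancel it.
  have h1 : ∀ (Y : C.Ob) (a : C.H B Y), C.hComp B B Y u a = a := fun Y a => by
    rw [← sub_eq_zero]
    refine hli Y _ ?_
    rw [map_sub, ← C.hComp_assoc, hu, sub_self]
  have h2 : ∀ (Y : C.Ob) (a : C.H Y B), C.hComp Y B B a u' = a := fun Y a => by
    rw [← sub_eq_zero]
    refine hri Y _ ?_
    rw [map_sub, LinearMap.sub_apply, C.hComp_assoc, hu', sub_self]
  -- A left identity and a right identity coincide.
  have huu : u = u' := (h2 B u).symm.trans (h1 B u')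
  exact ⟨u, h1, fun Y a => huu ▸ h2 Y a⟩

end AInfCategory

/-! ### Units for twisted complexes -/

namespace Twisted

variable {K : Type w} [Field K] {A : AInfCategory.{w, u, v} K}

/-- Induction on the number of summands: a nonempty finite family has a summand of highest level. -/
theorem sink_induction {P : Twisted A → Prop} (empty : ∀ B, IsEmpty B.ι → P B)
    (step : ∀ (B : Twisted A) (z : B.ι) (hz : ∀ k, B.level k ≤ B.level z),
      P (B.erase z hz) → P B) (B : Twisted A) : P B := by
  classical
  induction hn : Fintype.card B.ι using Nat.strong_induction_on generalizing B with
  | _ n ih =>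
    rcases isEmpty_or_nonempty B.ι with h | h
    · exact empty B h
    · obtain ⟨z, hz⟩ := Finite.exists_max B.level
      refine step B z hz (ih _ ?_ _ rfl)
      subst hn
      exact Fintype.card_subtype_lt (x := z) (by simp)

instance subsingleton_left (X Y : Twisted A) [IsEmpty X.ι] : Subsingleton (X ⟶ Y) :=
  ⟨fun _ _ => funext fun i => isEmptyElim i⟩

instance subsingleton_right (X Y : Twisted A) [IsEmpty Y.ι] : Subsingleton (X ⟶ Y) :=
  ⟨fun _ _ => funext fun _ => funext fun j => isEmptyElim j⟩

section erase

variable {B : Twisted A} {z : B.ι} (hz : ∀ k, B.level k ≤ B.level z) {X : Twisted A}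

open Classical in
theorem exists_col (b : X ⟶ B.erase z hz) (c : X ⟶ B.sink z) :
    ∃ a : X ⟶ B, colErase hz X a = b ∧ colSink X z a = c := by
  refine ⟨fun i j => if h : j = z then cast (by rw [h]) (c i ()) else b i ⟨j, h⟩, ?_, ?_⟩
  · refine hom_ext fun i j => ?_
    exact dif_neg j.2
  · refine hom_ext fun i j => ?_
    exact dif_pos rfl

open Classical in
theorem exists_row (b : B.erase z hz ⟶ X) (c : B.sink z ⟶ X) :
    ∃ a : B ⟶ X, rowErase hz X a = b ∧ rowSink X z a = c := by
  refine ⟨fun i j => if h : i = z then cast (by rw [h]) (c () j) else b ⟨i, h⟩ j, ?_, ?_⟩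
  · refine hom_ext fun i j => ?_
    exact dif_neg i.2
  · refine hom_ext fun i j => ?_
    exact dif_pos rfl

theorem col_eq_zero {a : X ⟶ B} (h : colErase hz X a = 0) (h' : colSink X z a = 0) : a = 0 := by
  refine hom_ext fun i j => ?_
  by_cases hj : j = z
  · subst hj; exact congrFun (congrFun h' i) ()
  · exact congrFun (congrFun h i) ⟨j, hj⟩

theorem row_eq_zero {a : B ⟶ X} (h : rowErase hz X a = 0) (h' : rowSink X z a = 0) : a = 0 := by
  refine hom_ext fun i j => ?_
  by_cases hi : i = z
  · subst hi; exact congrFun (congrFun h' ()) j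
  · exact congrFun (congrFun h ⟨i, hi⟩) j

/-- Acyclicity of an extension, for pairs of morphisms to `B`. -/
theorem acyclic_col {d₀ d₁ : ((X ⟶ B) × (X ⟶ B)) →ₗ[K] ((X ⟶ B) × (X ⟶ B))}
    {d₀' d₁' : ((X ⟶ B.sink z) × (X ⟶ B.sink z)) →ₗ[K] ((X ⟶ B.sink z) × (X ⟶ B.sink z))}
    {d₀'' d₁'' : ((X ⟶ B.erase z hz) × (X ⟶ B.erase z hz)) →ₗ[K]
      ((X ⟶ B.erase z hz) × (X ⟶ B.erase z hz))}
    (hd : ∀ x, d₁ (d₀ x) = 0)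
    (hp₀ : ∀ x, (colErase hz X).prodMap (colErase hz X) (d₀ x) =
      d₀'' ((colErase hz X).prodMap (colErase hz X) x))
    (hp₁ : ∀ x, (colErase hz X).prodMap (colErase hz X) (d₁ x) =
      d₁'' ((colErase hz X).prodMap (colErase hz X) x))
    (hq₀ : ∀ x, (colErase hz X).prodMap (colErase hz X) x = 0 →
      (colSink X z).prodMap (colSink X z) (d₀ x) = d₀' ((colSink X z).prodMap (colSink X z) x))
    (hq₁ : ∀ x, (colErase hz X).prodMap (colErase hz X) x = 0 →
      (colSink X z).prodMap (colSink X z) (d₁ x) = d₁' ((colSink X z).prodMap (colSink X z) x))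
    (h'' : Acyclic d₀'' d₁'') (h' : Acyclic d₀' d₁') : Acyclic d₀ d₁ := by
  refine Acyclic.extension _ _ hd ?_ ?_ hp₀ hp₁ hq₀ hq₁ h'' h'
  · rintro ⟨b, b'⟩ ⟨c, c'⟩
    obtain ⟨a, rfl, rfl⟩ := exists_col hz b c
    obtain ⟨a', rfl, rfl⟩ := exists_col hz b' c'
    exact ⟨(a, a'), rfl, rfl⟩
  · rintro ⟨a, a'⟩ h h'
    rw [LinearMap.prodMap_apply, Prod.mk_eq_zero] at h h'
    exact Prod.ext (col_eq_zero hz h.1 h'.1) (col_eq_zero hz h.2 h'.2)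

/-- Acyclicity of an extension, for pairs of morphisms from `B`. -/
theorem acyclic_row {d₀ d₁ : ((B ⟶ X) × (B ⟶ X)) →ₗ[K] ((B ⟶ X) × (B ⟶ X))}
    {d₀'' d₁'' : ((B.sink z ⟶ X) × (B.sink z ⟶ X)) →ₗ[K] ((B.sink z ⟶ X) × (B.sink z ⟶ X))}
    {d₀' d₁' : ((B.erase z hz ⟶ X) × (B.erase z hz ⟶ X)) →ₗ[K]
      ((B.erase z hz ⟶ X) × (B.erase z hz ⟶ X))}
    (hd : ∀ x, d₁ (d₀ x) = 0)
    (hp₀ : ∀ x, (rowSink X z).prodMap (rowSink X z) (d₀ x) =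
      d₀'' ((rowSink X z).prodMap (rowSink X z) x))
    (hp₁ : ∀ x, (rowSink X z).prodMap (rowSink X z) (d₁ x) =
      d₁'' ((rowSink X z).prodMap (rowSink X z) x))
    (hq₀ : ∀ x, (rowSink X z).prodMap (rowSink X z) x = 0 →
      (rowErase hz X).prodMap (rowErase hz X) (d₀ x) =
        d₀' ((rowErase hz X).prodMap (rowErase hz X) x))
    (hq₁ : ∀ x, (rowSink X z).prodMap (rowSink X z) x = 0 →
      (rowErase hz X).prodMap (rowErase hz X) (d₁ x) =
        d₁' ((rowErase hz X).prodMap (rowErase hz X) x))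
    (h'' : Acyclic d₀'' d₁'') (h' : Acyclic d₀' d₁') : Acyclic d₀ d₁ := by
  refine Acyclic.extension _ _ hd ?_ ?_ hp₀ hp₁ hq₀ hq₁ h'' h'
  · rintro ⟨c, c'⟩ ⟨b, b'⟩
    obtain ⟨a, rfl, rfl⟩ := exists_row hz b c
    obtain ⟨a', rfl, rfl⟩ := exists_row hz b' c'
    exact ⟨(a, a'), rfl, rfl⟩
  · rintro ⟨a, a'⟩ h h'
    rw [LinearMap.prodMap_apply, Prod.mk_eq_zero] at h h'
    exact Prod.ext (row_eq_zero hz h'.1 h.1) (row_eq_zero hz h'.2 h.2)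

end erase

/-- The mapping cone of multiplication by `e` on `X ⟶ B`. -/
noncomputable def coneRight (X B : Twisted A) (e : B ⟶ B) :
    ((X ⟶ B) × (X ⟶ B)) →ₗ[K] ((X ⟶ B) × (X ⟶ B)) := (category A).coneRight X B e

/-- The mapping cone of multiplication by `e` on `B ⟶ X`. -/
noncomputable def coneLeft (B X : Twisted A) (e : B ⟶ B) :
    ((B ⟶ X) × (B ⟶ X)) →ₗ[K] ((B ⟶ X) × (B ⟶ X)) := (category A).coneLeft B X e

theorem coneRight_apply {X B : Twisted A} (e : B ⟶ B) (a b : X ⟶ B) :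
    coneRight X B e (a, b) = (diff X B a, prod X B B a e + diff X B b) := rfl

theorem coneLeft_apply {X B : Twisted A} (e : B ⟶ B) (a b : B ⟶ X) :
    coneLeft B X e (a, b) = (diff B X a, prod B B X e a + diff B X b) := rfl

theorem coneRight_coneRight {X B : Twisted A} {e : B ⟶ B} (he : diff B B e = 0)
    (x : (X ⟶ B) × (X ⟶ B)) : coneRight X B e (coneRight X B e x) = 0 :=
  AInfCategory.coneRight_coneRight (C := category A) he x

theorem coneLeft_coneLeft {X B : Twisted A} {e : B ⟶ B} (he : diff B B e = 0)
    (x : (B ⟶ X) × (B ⟶ X)) : coneLeft B X (ε B B e) (coneLeft B X e x) = 0 :=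
  AInfCategory.coneLeft_coneLeft (C := category A) he x

section ofOb

variable {V W : A.Ob} {m n : ℤ}

/-- A morphism between objects of `A` as a morphism of twisted complexes. -/
def ofHom (m n : ℤ) : (V ⟶ W) →ₗ[K] (ofOb V m ⟶ ofOb W n) where
  toFun a _ _ := a
  map_add' _ _ := rfl
  map_smul' _ _ := rfl

theorem ofHom_surjective (a : ofOb V m ⟶ ofOb W n) : ∃ b, ofHom m n b = a :=
  ⟨a () (), rfl⟩

theorem diff_ofHom (a : V ⟶ W) :
    diff (ofOb V m) (ofOb W n) (ofHom m n a) = sgn K m • ofHom m n (A.d V W a) := by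
  refine hom_ext fun i j => ?_
  rw [diff_apply]
  simp only [sum_ofOb _ _ _ j, chains_self, msum_singleton]
  rfl

theorem prod_ofHom {U : A.Ob} {l : ℤ} (a : U ⟶ V) (b : V ⟶ W) :
    prod (ofOb U l) (ofOb V m) (ofOb W n) (ofHom l m a) (ofHom m n b) =
      sgn K l • ofHom l n (A.μ₂ U V W a b) := by
  refine hom_ext fun i j => ?_
  rw [prod_apply]
  simp only [sum_ofOb _ _ _ j, chains_self, msum_singleton]
  rfl

theorem ε_ofHom (a : V ⟶ W) :
    ε (ofOb V m) (ofOb W n) (ofHom m n a) = (sgn K m * sgn K n) • ofHom m n (A.ε V W a) :=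
  hom_ext fun i j => by rw [ε_apply]; rfl

theorem acyclic_coneRight_ofHom {e : W ⟶ W}
    (h : Acyclic (A.coneRight V W e) (A.coneRight V W e)) :
    Acyclic (coneRight (ofOb V m) (ofOb W n) (ofHom n n e))
      (coneRight (ofOb V m) (ofOb W n) (ofHom n n e)) := by
  have key : ∀ a b, coneRight (ofOb V m) (ofOb W n) (ofHom n n e) (ofHom m n a, ofHom m n b) =
      sgn K m • (ofHom m n).prodMap (ofHom m n) (A.coneRight V W e (a, b)) := fun a b => by
    rw [coneRight_apply, diff_ofHom, diff_ofHom, prod_ofHom, ← smul_add, ← map_add]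
    rfl
  rintro ⟨a, b⟩ hab
  obtain ⟨a, rfl⟩ := ofHom_surjective a
  obtain ⟨b, rfl⟩ := ofHom_surjective b
  rw [key] at hab
  have hab' := congrArg (fun x => sgn K m • x) hab
  simp only [sgn_smul_sgn_smul, smul_zero] at hab'
  obtain ⟨⟨a', b'⟩, h'⟩ := h (a, b) (by
    refine Prod.ext ?_ ?_
    · exact congrFun (congrFun (congrArg Prod.fst hab') ()) ()
    · exact congrFun (congrFun (congrArg Prod.snd hab') ()) ())
  refine ⟨sgn K m • (ofHom m n a', ofHom m n b'), ?_⟩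
  rw [map_smul, key, h', sgn_smul_sgn_smul]
  rfl

theorem acyclic_coneLeft_ofHom {e : V ⟶ V}
    (h : Acyclic (A.coneLeft V W e) (A.coneLeft V W (A.ε V V e))) :
    Acyclic (coneLeft (ofOb V m) (ofOb W n) (ofHom m m e))
      (coneLeft (ofOb V m) (ofOb W n) (ε _ _ (ofHom m m e))) := by
  have key : ∀ e a b, coneLeft (ofOb V m) (ofOb W n) (ofHom m m e) (ofHom m n a, ofHom m n b) =
      sgn K m • (ofHom m n).prodMap (ofHom m n) (A.coneLeft V W e (a, b)) := fun e a b => by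
    rw [coneLeft_apply, diff_ofHom, diff_ofHom, prod_ofHom, ← smul_add, ← map_add]
    rfl
  rintro ⟨a, b⟩ hab
  obtain ⟨a, rfl⟩ := ofHom_surjective a
  obtain ⟨b, rfl⟩ := ofHom_surjective b
  rw [ε_ofHom, sgn_mul_self, one_smul, key] at hab
  have hab' := congrArg (fun x => sgn K m • x) hab
  simp only [sgn_smul_sgn_smul, smul_zero] at hab'
  obtain ⟨⟨a', b'⟩, h'⟩ := h (a, b) (by
    refine Prod.ext ?_ ?_
    · exact congrFun (congrFun (congrArg Prod.fst hab') ()) ()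
    · exact congrFun (congrFun (congrArg Prod.snd hab') ()) ())
  refine ⟨sgn K m • (ofHom m n a', ofHom m n b'), ?_⟩
  rw [map_smul, key, h', sgn_smul_sgn_smul]
  rfl

end ofOb

/-- An identity morphism in the cohomological category of twisted complexes. -/
abbrev IsUnitClass (B : Twisted A) (e : (category A).H B B) : Prop :=
  (category A).IsUnitClass B e

/-- A unit `e` of `V` in `A` is a unit only against objects of `A`. Acyclicity of the cones of
multiplication by `e` extends to all twisted complexes `X` by induction on `X`, and this already
produces a unit. -/
theorem exists_isUnitClass_ofOb [A.CUnital] (V : A.Ob) (n : ℤ) :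
    ∃ e, IsUnitClass (ofOb V n) e := by
  obtain ⟨u, hu⟩ := AInfCategory.CUnital.exists_unit (A := A) V
  obtain ⟨e, he, rfl⟩ := A.cls_surjective u
  have hu : A.IsUnitClass V (A.cls e he) := hu
  have hE : diff (ofOb V n) (ofOb V n) (ofHom n n e) = 0 := by
    rw [diff_ofHom, he, map_zero, smul_zero]
  refine AInfCategory.exists_isUnitClass (C := category A) (e := ofHom n n e) hE ?_ ?_
  · intro X
    change Acyclic (coneRight X (ofOb V n) (ofHom n n e)) (coneRight X (ofOb V n) (ofHom n n e))
    induction X using sink_induction with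
    | empty X hX => exact Acyclic.of_subsingleton _ _
    | step X z hz ih =>
      have h1 : ∀ x, (rowSink (ofOb V n) z).prodMap (rowSink (ofOb V n) z)
          (coneRight X (ofOb V n) (ofHom n n e) x) =
          coneRight (X.sink z) (ofOb V n) (ofHom n n e)
            ((rowSink (ofOb V n) z).prodMap (rowSink (ofOb V n) z) x) := by
        rintro ⟨a, b⟩
        simp only [coneRight_apply, LinearMap.prodMap_apply, map_add, rowSink_diff hz,
          rowSink_prod hz]
      have h2 : ∀ x, (rowSink (ofOb V n) z).prodMap (rowSink (ofOb V n) z) x = 0 →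
          (rowErase hz (ofOb V n)).prodMap (rowErase hz (ofOb V n))
          (coneRight X (ofOb V n) (ofHom n n e) x) =
          coneRight (X.erase z hz) (ofOb V n) (ofHom n n e)
            ((rowErase hz (ofOb V n)).prodMap (rowErase hz (ofOb V n)) x) := by
        rintro ⟨a, b⟩ hab
        rw [LinearMap.prodMap_apply, Prod.mk_eq_zero] at hab
        simp only [coneRight_apply, LinearMap.prodMap_apply, map_add, rowErase_diff,
          rowErase_prod hz _ _ hab.1, hab.1, hab.2, map_zero, add_zero]
      exact acyclic_row hz (coneRight_coneRight hE) h1 h1 h2 h2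
        (acyclic_coneRight_ofHom (hu.acyclic_coneRight _)) ih
  · intro X
    change Acyclic (coneLeft (ofOb V n) X (ofHom n n e))
      (coneLeft (ofOb V n) X (ε _ _ (ofHom n n e)))
    induction X using sink_induction with
    | empty X hX => exact Acyclic.of_subsingleton _ _
    | step X z hz ih =>
      have h1 : ∀ e x, (colErase hz (ofOb V n)).prodMap (colErase hz (ofOb V n))
          (coneLeft (ofOb V n) X e x) = coneLeft (ofOb V n) (X.erase z hz) e
            ((colErase hz (ofOb V n)).prodMap (colErase hz (ofOb V n)) x) := by
        rintro e ⟨a, b⟩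
        simp only [coneLeft_apply, LinearMap.prodMap_apply, map_add, colErase_diff,
          colErase_prod]
      have h2 : ∀ e x, (colErase hz (ofOb V n)).prodMap (colErase hz (ofOb V n)) x = 0 →
          (colSink (ofOb V n) z).prodMap (colSink (ofOb V n) z)
          (coneLeft (ofOb V n) X e x) = coneLeft (ofOb V n) (X.sink z) e
            ((colSink (ofOb V n) z).prodMap (colSink (ofOb V n) z) x) := by
        rintro e ⟨a, b⟩ hab
        rw [LinearMap.prodMap_apply, Prod.mk_eq_zero] at hab
        simp only [coneLeft_apply, LinearMap.prodMap_apply, map_add, colSink_diff hz,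
          colSink_prod hz _ _ hab.1, hab.1, hab.2, map_zero, LinearMap.zero_apply, add_zero]
      exact acyclic_col hz (coneLeft_coneLeft hE) (h1 _) (h1 _) (h2 _) (h2 _) ih
        (acyclic_coneLeft_ofHom (hu.acyclic_coneLeft _))

section extension

variable {B : Twisted A} {z : B.ι} (hz : ∀ k, B.level k ≤ B.level z)

/-- `e` is block triangular with diagonal blocks `e'` and `e''`. -/
structure IsBlock (e : B ⟶ B) (e' : B.erase z hz ⟶ B.erase z hz) (e'' : B.sink z ⟶ B.sink z) :
    Prop where
  erase_erase : rowErase hz _ (colErase hz _ e) = e'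
  sink_erase : rowSink _ z (colErase hz _ e) = 0
  sink_sink : colSink _ z (rowSink _ z e) = e''

variable {hz} {e : B ⟶ B} {e' : B.erase z hz ⟶ B.erase z hz} {e'' : B.sink z ⟶ B.sink z}

theorem IsBlock.erase_sink (h : IsBlock hz e e' e'') : colErase hz _ (rowSink _ z e) = 0 :=
  h.sink_erase

theorem IsBlock.ε (h : IsBlock hz e e' e'') :
    IsBlock hz (ε B B e) (ε _ _ e') (ε _ _ e'') where
  erase_erase := by rw [colErase_ε, rowErase_ε, h.erase_erase]
  sink_erase := by rw [colErase_ε, rowSink_ε, h.sink_erase, map_zero]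
  sink_sink := by rw [rowSink_ε, colSink_ε, h.sink_sink]

/-- Block triangularity makes the cone for `e` an extension of the cones for the two diagonal
blocks. -/
theorem IsBlock.acyclic_coneRight (h : IsBlock hz e e' e'') (he : diff B B e = 0) (X : Twisted A)
    (h' : Acyclic (coneRight X _ e') (coneRight X _ e'))
    (h'' : Acyclic (coneRight X _ e'') (coneRight X _ e'')) :
    Acyclic (coneRight X B e) (coneRight X B e) := by
  have h1 : ∀ x, (colErase hz X).prodMap (colErase hz X) (coneRight X B e x) =
      coneRight X _ e' ((colErase hz X).prodMap (colErase hz X) x) := by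
    rintro ⟨a, b⟩
    simp only [coneRight_apply, LinearMap.prodMap_apply, map_add, colErase_diff, colErase_prod,
      prod_eq_prod_erase hz _ _ h.sink_erase, h.erase_erase]
  have h2 : ∀ x, (colErase hz X).prodMap (colErase hz X) x = 0 →
      (colSink X z).prodMap (colSink X z) (coneRight X B e x) =
      coneRight X _ e'' ((colSink X z).prodMap (colSink X z) x) := by
    rintro ⟨a, b⟩ hab
    rw [LinearMap.prodMap_apply, Prod.mk_eq_zero] at hab
    simp only [coneRight_apply, LinearMap.prodMap_apply, map_add, colSink_diff hz,
      prod_eq_prod_sink hz _ _ hab.1, colSink_prod hz _ _ h.erase_sink, h.sink_sink, hab.1, hab.2,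
      map_zero, LinearMap.zero_apply, add_zero]
  exact acyclic_col hz (coneRight_coneRight he) h1 h1 h2 h2 h' h''

theorem IsBlock.acyclic_coneLeft (h : IsBlock hz e e' e'') (he : diff B B e = 0) (X : Twisted A)
    (h' : Acyclic (coneLeft _ X e') (coneLeft _ X (Twisted.ε _ _ e')))
    (h'' : Acyclic (coneLeft _ X e'') (coneLeft _ X (Twisted.ε _ _ e''))) :
    Acyclic (coneLeft B X e) (coneLeft B X (Twisted.ε _ _ e)) := by
  have h1 : ∀ {e e' e''}, IsBlock hz e e' e'' → ∀ x,
      (rowSink X z).prodMap (rowSink X z) (coneLeft B X e x) =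
      coneLeft _ X e'' ((rowSink X z).prodMap (rowSink X z) x) := by
    rintro e e' e'' h ⟨a, b⟩
    simp only [coneLeft_apply, LinearMap.prodMap_apply, map_add, rowSink_diff hz, rowSink_prod hz,
      prod_eq_prod_sink hz _ _ h.erase_sink, h.sink_sink]
  have h2 : ∀ {e e' e''}, IsBlock hz e e' e'' → ∀ x,
      (rowSink X z).prodMap (rowSink X z) x = 0 →
      (rowErase hz X).prodMap (rowErase hz X) (coneLeft B X e x) =
      coneLeft _ X e' ((rowErase hz X).prodMap (rowErase hz X) x) := by
    rintro e e' e'' h ⟨a, b⟩ hab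
    rw [LinearMap.prodMap_apply, Prod.mk_eq_zero] at hab
    simp only [coneLeft_apply, LinearMap.prodMap_apply, map_add, rowErase_diff,
      prod_eq_prod_erase hz _ _ hab.1, rowErase_prod hz _ _ h.sink_erase, h.erase_erase, hab.1,
      hab.2, map_zero, add_zero]
  exact acyclic_row hz (coneLeft_coneLeft he) (h1 h) (h1 h.ε) (h2 h) (h2 h.ε) h'' h'

/-- The hypothesis `ht` is the vanishing of the off-diagonal block of the differential of `e`:
besides the differential of `t` it contains the two products of the diagonal blocks with `toSink
hz`. -/
theorem exists_isBlock (hz : ∀ k, B.level k ≤ B.level z)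
    (e' : B.erase z hz ⟶ B.erase z hz) (e'' : B.sink z ⟶ B.sink z) (t : B.erase z hz ⟶ B.sink z)
    (he' : diff _ _ e' = 0) (he'' : diff _ _ e'' = 0)
    (ht : diff _ _ t + (prod _ _ _ (toSink hz) e'' + prod _ _ _ e' (toSink hz)) = 0) :
    ∃ e, IsBlock hz e e' e'' ∧ diff B B e = 0 := by
  obtain ⟨c, hc, hc'⟩ := exists_row hz e' 0
  obtain ⟨s, hs, hs'⟩ := exists_row hz t e''
  obtain ⟨e, rfl, rfl⟩ := exists_col hz c s
  refine ⟨e, ⟨hc, hc', hs'⟩, col_eq_zero hz ?_ ?_⟩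
  · rw [colErase_diff]
    refine row_eq_zero hz ?_ ?_
    · rw [rowErase_diff, hc, he', hc', map_zero, add_zero]
    · rw [rowSink_diff hz, hc', map_zero]
  · rw [colSink_diff hz]
    refine row_eq_zero hz ?_ ?_
    · rw [map_add, rowErase_diff, hs, hs', rowErase_prod hz _ _ hc', hc, add_assoc]
      exact ht
    · rw [map_add, rowSink_diff hz, hs', he'', rowSink_prod hz, hc', map_zero,
        LinearMap.zero_apply, add_zero]

end extension

/-- The category of twisted complexes is cohomologically unital. -/
theorem exists_isUnitClass [A.CUnital] (B : Twisted A) : ∃ e, IsUnitClass B e := by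
  induction B using sink_induction with
  | empty B hB =>
    refine ⟨0, fun Y a => ?_, fun Y a => ?_⟩
    · obtain ⟨a, ha, rfl⟩ := (category A).cls_surjective a
      rw [map_zero, LinearMap.zero_apply, eq_comm]
      exact ((category A).cls_eq_zero ha).2 ⟨0, (subsingleton_left B Y).elim _ _⟩
    · obtain ⟨a, ha, rfl⟩ := (category A).cls_surjective a
      rw [map_zero, eq_comm]
      exact ((category A).cls_eq_zero ha).2 ⟨0, (subsingleton_right Y B).elim _ _⟩
  | step B z hz ih =>
    obtain ⟨u', hu'⟩ := ih
    obtain ⟨u'', hu''⟩ := exists_isUnitClass_ofOb (B.obj z) (B.deg z)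
    obtain ⟨e', he', rfl⟩ := (category A).cls_surjective u'
    obtain ⟨e'', he'', rfl⟩ := (category A).cls_surjective u''
    -- The connecting morphism has degree one, so its reduced sign is trivial.
    have hf : ε _ _ (toSink hz) = toSink hz := by
      refine ((category A).ε_apply (toSink_mem hz)).trans ?_
      simp
    obtain ⟨c, hc⟩ := hu''.exists_right (diff_toSink hz)
    obtain ⟨c', hc'⟩ := hu'.exists_left (diff_toSink hz)
    change diff _ _ c = -prod _ _ _ (ε _ _ (toSink hz)) e'' - toSink hz at hc
    change diff _ _ c' = prod _ _ _ e' (toSink hz) - toSink hz at hc'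
    rw [hf] at hc
    -- Both `e'` and `e''` act on the class of the connecting morphism as identities, up to sign.
    -- The difference of the two homotopies is the off-diagonal block.
    obtain ⟨e, hb, he⟩ := exists_isBlock hz e' e'' (c - c') he' he'' (by
      rw [map_sub, hc, hc']; abel)
    exact AInfCategory.exists_isUnitClass (C := category A) he
      (fun X => hb.acyclic_coneRight he X (hu'.acyclic_coneRight X) (hu''.acyclic_coneRight X))
      (fun X => hb.acyclic_coneLeft he X (hu'.acyclic_coneLeft X) (hu''.acyclic_coneLeft X))

/-- The morphism complex is exact. -/
def ExactHom (X Y : Twisted A) : Prop := ∀ a, diff X Y a = 0 → ∃ c, diff X Y c = a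

/-- The unit of `B` is a boundary, so every class is its product with zero. -/
theorem ExactHom.left [A.CUnital] {B : Twisted A} (h : ExactHom B B) (X : Twisted A) :
    ExactHom X B := by
  obtain ⟨e, he⟩ := exists_isUnitClass B
  obtain ⟨e, he', rfl⟩ := (category A).cls_surjective e
  intro a ha₀
  have ha := he.2 X ((category A).cls a ha₀)
  rw [((category A).cls_eq_zero he').2 (h e he'), map_zero, eq_comm] at ha
  exact ((category A).cls_eq_zero ha₀).1 ha

theorem ExactHom.right [A.CUnital] {B : Twisted A} (h : ExactHom B B) (X : Twisted A) :
    ExactHom B X := by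
  obtain ⟨e, he⟩ := exists_isUnitClass B
  obtain ⟨e, he', rfl⟩ := (category A).cls_surjective e
  intro a ha₀
  have ha := he.1 X ((category A).cls a ha₀)
  rw [((category A).cls_eq_zero he').2 (h e he'), map_zero, LinearMap.zero_apply, eq_comm] at ha
  exact ((category A).cls_eq_zero ha₀).1 ha

end Twisted

/-! ### Homogeneous components of cocycles -/

namespace AInfCategory

variable {K : Type w} [Field K] (C : AInfCategory.{w, u, v} K)

/-- The projection to the degree `k` part. -/
noncomputable def proj (X Y : C.Ob) (k : ℤ) : (X ⟶ Y) →ₗ[K] (X ⟶ Y) :=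
  (C.gr X Y k).subtype ∘ₗ DirectSum.component K ℤ (fun k => C.gr X Y k) k ∘ₗ
    (LinearEquiv.ofBijective (DirectSum.coeLinearMap (C.gr X Y)) (C.gr_internal X Y)).symm.toLinearMap

variable {C}

theorem proj_mem {X Y : C.Ob} (k : ℤ) (x : X ⟶ Y) : C.proj X Y k x ∈ C.gr X Y k :=
  Submodule.coe_mem _

theorem proj_of_mem {X Y : C.Ob} {l : ℤ} {x : X ⟶ Y} (hx : x ∈ C.gr X Y l) (k : ℤ) :
    C.proj X Y k x = if l = k then x else 0 := by
  have h : (LinearEquiv.ofBijective (DirectSum.coeLinearMap (C.gr X Y)) (C.gr_internal X Y)).symm x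
      = DirectSum.lof K ℤ (fun k => C.gr X Y k) l ⟨x, hx⟩ := by
    rw [LinearEquiv.symm_apply_eq]
    exact (DirectSum.coeLinearMap_lof (C.gr X Y) l ⟨x, hx⟩).symm
  rw [proj, LinearMap.comp_apply, LinearMap.comp_apply, LinearEquiv.coe_coe, h]
  split_ifs with hk
  · subst hk
    rw [DirectSum.component.lof_self]; rfl
  · rw [DirectSum.component.of, dif_neg hk]; rfl

theorem exists_eq_sum_proj {X Y : C.Ob} (x : X ⟶ Y) :
    ∃ s : Finset ℤ, x = ∑ k ∈ s, C.proj X Y k x := by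
  let e := LinearEquiv.ofBijective (DirectSum.coeLinearMap (C.gr X Y)) (C.gr_internal X Y)
  classical
  refine ⟨(e.symm x).support, ?_⟩
  conv_lhs => rw [← e.apply_symm_apply x]
  exact DirectSum.coeLinearMap_eq_dfinsuppSum (C.gr X Y) (e.symm x)

theorem d_proj {X Y : C.Ob} (k : ℤ) (x : X ⟶ Y) :
    C.d X Y (C.proj X Y k x) = C.proj X Y (k + 1) (C.d X Y x) := by
  refine eq_of_homogeneous (C.gr X Y) (C.gr_internal X Y) (f := C.d X Y ∘ₗ C.proj X Y k)
    (f' := C.proj X Y (k + 1) ∘ₗ C.d X Y) (fun l x hx => ?_) x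
  rw [LinearMap.comp_apply, LinearMap.comp_apply, proj_of_mem hx, proj_of_mem (C.d_mem hx)]
  by_cases h : l = k
  · simp [h]
  · simp [h]

theorem d_proj_eq_zero {X Y : C.Ob} {x : X ⟶ Y} (hx : C.d X Y x = 0) (k : ℤ) :
    C.d X Y (C.proj X Y k x) = 0 := by rw [d_proj, hx, map_zero]

/-- A morphism has finitely many homogeneous components, so primitives can be summed. -/
theorem exact_of_exact_proj {X Y : C.Ob} {x : X ⟶ Y}
    (h : ∀ k, ∃ c, C.d X Y c = C.proj X Y k x) : ∃ c, C.d X Y c = x := by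
  choose c hc using h
  obtain ⟨s, hs⟩ := exists_eq_sum_proj x
  refine ⟨∑ k ∈ s, c k, ?_⟩
  rw [map_sum]
  exact (Finset.sum_congr rfl fun k _ => hc k).trans hs.symm

theorem cochainComp_mem {X Y Z : C.Ob} {k l : ℤ} {a : X ⟶ Y} {b : Y ⟶ Z} (ha : a ∈ C.gr X Y k)
    (hb : b ∈ C.gr Y Z l) : C.cochainComp X Y Z a b ∈ C.gr X Z (k + l) := by
  rw [cochainComp, LinearMap.neg_apply, LinearMap.neg_apply, LinearMap.comp_apply, C.ε_apply ha,
    map_smul, LinearMap.smul_apply]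
  exact Submodule.neg_mem _ (Submodule.smul_mem _ _ (C.μ₂_mem ha hb))

theorem proj_cochainComp_left {X Y Z : C.Ob} {k : ℤ} {a : X ⟶ Y} (ha : a ∈ C.gr X Y k)
    (b : Y ⟶ Z) (m : ℤ) : C.proj X Z m (C.cochainComp X Y Z a b) =
      C.cochainComp X Y Z a (C.proj Y Z (m - k) b) := by
  refine eq_of_homogeneous (C.gr Y Z) (C.gr_internal Y Z)
    (f := C.proj X Z m ∘ₗ C.cochainComp X Y Z a)
    (f' := C.cochainComp X Y Z a ∘ₗ C.proj Y Z (m - k)) (fun l b hb => ?_) b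
  rw [LinearMap.comp_apply, LinearMap.comp_apply, proj_of_mem (cochainComp_mem ha hb),
    proj_of_mem hb]
  by_cases h : l = m - k
  · rw [if_pos h, if_pos (by omega)]
  · rw [if_neg h, if_neg (by omega), map_zero]

theorem proj_cochainComp_right {X Y Z : C.Ob} {l : ℤ} (a : X ⟶ Y) {b : Y ⟶ Z}
    (hb : b ∈ C.gr Y Z l) (m : ℤ) : C.proj X Z m (C.cochainComp X Y Z a b) =
      C.cochainComp X Y Z (C.proj X Y (m - l) a) b := by
  refine eq_of_homogeneous (C.gr X Y) (C.gr_internal X Y)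
    (f := C.proj X Z m ∘ₗ (C.cochainComp X Y Z).flip b)
    (f' := (C.cochainComp X Y Z).flip b ∘ₗ C.proj X Y (m - l)) (fun k a ha => ?_) a
  rw [LinearMap.comp_apply, LinearMap.comp_apply, LinearMap.flip_apply,
    proj_of_mem (cochainComp_mem ha hb), proj_of_mem ha]
  by_cases h : k = m - l
  · rw [if_pos h, if_pos (by omega), LinearMap.flip_apply]
  · rw [if_neg h, if_neg (by omega), map_zero]

theorem cls_mem_Hgr {X Y : C.Ob} {k : ℤ} {a : X ⟶ Y} (ha : C.d X Y a = 0)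
    (hk : a ∈ C.gr X Y k) : C.cls a ha ∈ C.Hgr X Y k := ⟨⟨a, ha⟩, hk, rfl⟩

theorem exists_of_mem_Hgr {X Y : C.Ob} {k : ℤ} {x : C.H X Y} (hx : x ∈ C.Hgr X Y k) :
    ∃ a, ∃ ha : C.d X Y a = 0, a ∈ C.gr X Y k ∧ C.cls a ha = x := by
  obtain ⟨⟨a, ha⟩, hk, rfl⟩ := hx
  exact ⟨a, ha, hk, rfl⟩

/-! ### Duality -/

/-- A functional on the degree `m` part of the cohomology comes from a functional on the
morphism complex that vanishes in other degrees. -/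
theorem exists_functional (V : C.Ob) (m : ℤ) (I : C.Hgr V V m →ₗ[K] K) :
    ∃ θ : (V ⟶ V) →ₗ[K] K, (∀ x, θ (C.d V V x) = 0) ∧ ∀ x (hx : C.d V V x = 0),
      θ x = I ⟨C.cls _ (d_proj_eq_zero hx m), cls_mem_Hgr _ (proj_mem m x)⟩ := by
  let π : LinearMap.ker (C.d V V) →ₗ[K] LinearMap.ker (C.d V V) :=
    (C.proj V V m).restrict fun x hx => d_proj_eq_zero hx m
  let θ₀ : LinearMap.ker (C.d V V) →ₗ[K] K := I ∘ₗ
    ((C.boundaries V V).mkQ ∘ₗ π).codRestrict (C.Hgr V V m) fun x =>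
      cls_mem_Hgr (d_proj_eq_zero x.2 m) (proj_mem m x.1)
  -- Any linear extension from cocycles to all morphisms will do: boundaries are cocycles, so
  -- vanishing on them is decided by `I`.
  obtain ⟨θ, hθ⟩ := θ₀.exists_extend
  have key : ∀ x (hx : C.d V V x = 0),
      θ x = I ⟨C.cls _ (d_proj_eq_zero hx m), cls_mem_Hgr _ (proj_mem m x)⟩ := fun x hx =>
    LinearMap.congr_fun hθ ⟨x, hx⟩
  refine ⟨θ, fun x => ?_, key⟩
  rw [key _ (C.d_d x)]
  have h0 : C.cls (C.proj V V m (C.d V V x)) (d_proj_eq_zero (C.d_d x) m) = 0 := by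
    rw [C.cls_eq_zero]
    refine ⟨C.proj V V (m - 1) x, ?_⟩
    rw [d_proj, sub_add_cancel]
  rw [← map_zero I]
  congr 1
  exact Subtype.ext h0

/-- `θ` induces a perfect pairing between `H(V, X)` and `H(X, V)`. -/
structure IsDualizing (V : C.Ob) (θ : (V ⟶ V) →ₗ[K] K) : Prop where
  d_eq_zero : ∀ x, θ (C.d V V x) = 0
  exact_left : ∀ {X : C.Ob} {b : X ⟶ V}, C.d X V b = 0 →
    (∀ a, C.d V X a = 0 → θ (C.cochainComp V X V a b) = 0) → ∃ c, C.d X V c = b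
  exact_right : ∀ {X : C.Ob} {a : V ⟶ X}, C.d V X a = 0 →
    (∀ b, C.d X V b = 0 → θ (C.cochainComp V X V a b) = 0) → ∃ c, C.d V X c = a

/-- Against a homogeneous cocycle, `θ` sees only the component of complementary degree.
Nondegeneracy in each degree thus gives nondegeneracy on total cohomology. -/
theorem exists_isDualizing {V : C.Ob} {m : ℤ} {I : C.Hgr V V m →ₗ[K] K}
    (hI : ∀ (X : C.Ob) (k : ℤ), (C.pairing V m I X k).Nondegenerate) :
    ∃ θ, IsDualizing V θ := by
  obtain ⟨θ, hθ, hθI⟩ := exists_functional V m I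
  have hd : ∀ {X : C.Ob} {a : V ⟶ X} {b : X ⟶ V}, C.d V X a = 0 → C.d X V b = 0 →
      C.d V V (C.cochainComp V X V a b) = 0 := fun ha hb => by
    rw [C.d_cochainComp, ha, hb]; simp
  refine ⟨θ, hθ, fun {X b} hb h => exact_of_exact_proj fun k => ?_,
    fun {X a} ha h => exact_of_exact_proj fun k => ?_⟩
  · obtain ⟨l, rfl⟩ : ∃ l, k = m - l := ⟨m - k, by ring⟩
    rw [← C.cls_eq_zero (d_proj_eq_zero hb _)]
    refine congrArg Subtype.val ((hI X l).1 ⟨_, cls_mem_Hgr (d_proj_eq_zero hb _) (proj_mem _ b)⟩ ?_)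
    rintro ⟨y, hy⟩
    obtain ⟨a, ha, hal, rfl⟩ := exists_of_mem_Hgr hy
    rw [← h a ha, hθI _ (hd ha hb)]
    change I _ = I _
    congr 1
    refine Subtype.ext ?_
    change C.cls _ _ = C.cls _ _
    congr 1
    rw [proj_cochainComp_left hal]
  · rw [← C.cls_eq_zero (d_proj_eq_zero ha _)]
    refine congrArg Subtype.val ((hI X k).2 ⟨_, cls_mem_Hgr (d_proj_eq_zero ha _) (proj_mem _ a)⟩ ?_)
    rintro ⟨y, hy⟩
    obtain ⟨b, hb, hbl, rfl⟩ := exists_of_mem_Hgr hy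
    rw [← h b hb, hθI _ (hd ha hb)]
    change I _ = I _
    congr 1
    refine Subtype.ext ?_
    change C.cls _ _ = C.cls _ _
    congr 1
    rw [proj_cochainComp_right a hbl, sub_sub_cancel]

/-- The pairing on cohomology is injective in both variables. As the spaces are finite-dimensional,
the dimensions agree and every functional on `H(V, X)` is represented by a class in `H(X, V)`. -/
theorem IsDualizing.exists_eq {V : C.Ob} {θ : (V ⟶ V) →ₗ[K] K} (h : IsDualizing V θ) {X : C.Ob}
    (ψ : Module.Dual K (V ⟶ X)) (hψ : ∀ a, ψ (C.d V X a) = 0) :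
    ∃ b, C.d X V b = 0 ∧ ∀ a, C.d V X a = 0 → θ (C.cochainComp V X V a b) = ψ a := by
  have := C.finite V X
  have := C.finite X V
  let Θ : C.H V V →ₗ[K] K := (C.boundaries V V).liftQ (θ ∘ₗ (LinearMap.ker (C.d V V)).subtype) (by
    rintro ⟨x, hx⟩ ⟨y, hy⟩
    have hy' : C.d V V y = x := hy
    rw [LinearMap.mem_ker]
    change θ x = 0
    rw [← hy', h.d_eq_zero])
  let Ψ : C.H V X →ₗ[K] K := (C.boundaries V X).liftQ (ψ ∘ₗ (LinearMap.ker (C.d V X)).subtype) (by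
    rintro ⟨x, hx⟩ ⟨y, hy⟩
    have hy' : C.d V X y = x := hy
    rw [LinearMap.mem_ker]
    change ψ x = 0
    rw [← hy', hψ])
  let β : C.H V X →ₗ[K] C.H X V →ₗ[K] K := (C.hComp V X V).compr₂ Θ
  have hβ : ∀ a (ha : C.d V X a = 0) b (hb : C.d X V b = 0),
      β (C.cls a ha) (C.cls b hb) = θ (C.cochainComp V X V a b) := fun a ha b hb => rfl
  have h1 : Function.Injective β := by
    rw [injective_iff_map_eq_zero]
    intro x hx
    obtain ⟨a, ha, rfl⟩ := C.cls_surjective x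
    rw [C.cls_eq_zero]
    exact h.exact_right ha fun b hb => by rw [← hβ a ha b hb, hx]; rfl
  have h2 : Function.Injective β.flip := by
    rw [injective_iff_map_eq_zero]
    intro x hx
    obtain ⟨b, hb, rfl⟩ := C.cls_surjective x
    rw [C.cls_eq_zero]
    exact h.exact_left hb fun a ha => by
      rw [← hβ a ha b hb, ← LinearMap.flip_apply, hx]; rfl
  have hfin : Module.finrank K (C.H X V) = Module.finrank K (C.H V X →ₗ[K] K) := by
    refine le_antisymm (LinearMap.finrank_le_finrank_of_injective h2) ?_
    have := LinearMap.finrank_le_finrank_of_injective h1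
    rwa [Subspace.dual_finrank_eq, ← Subspace.dual_finrank_eq (V := C.H V X)] at this
  obtain ⟨y, hy⟩ := (LinearMap.injective_iff_surjective_of_finrank_eq_finrank hfin).1 h2 Ψ
  obtain ⟨b, hb, rfl⟩ := C.cls_surjective y
  refine ⟨b, hb, fun a ha => ?_⟩
  rw [← hβ a ha b hb, ← LinearMap.flip_apply, hy]
  rfl

variable (C) in
/-- `b ↦ (a ↦ θ (μ^2(b, a)))`. -/
def dualMap (V : C.Ob) (θ : (V ⟶ V) →ₗ[K] K) (X : C.Ob) :
    (X ⟶ V) →ₗ[K] Module.Dual K (V ⟶ X) := ((C.μ₂ V X V).compr₂ θ).flip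

variable (C) in
/-- The mapping cone of `(X ⟶ V) → (V ⟶ X)^*`. -/
noncomputable def coneDual₁ (V : C.Ob) (θ : (V ⟶ V) →ₗ[K] K) (X : C.Ob) :
    ((X ⟶ V) × Module.Dual K (V ⟶ X)) →ₗ[K] ((X ⟶ V) × Module.Dual K (V ⟶ X)) :=
  (C.d X V ∘ₗ LinearMap.fst K _ _).prod
    (C.dualMap V θ X ∘ₗ LinearMap.fst K _ _ - (C.d V X).dualMap ∘ₗ LinearMap.snd K _ _)

variable (C) in
/-- A variant of `coneDual₁` with another sign. -/
noncomputable def coneDual₀ (V : C.Ob) (θ : (V ⟶ V) →ₗ[K] K) (X : C.Ob) :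
    ((X ⟶ V) × Module.Dual K (V ⟶ X)) →ₗ[K] ((X ⟶ V) × Module.Dual K (V ⟶ X)) :=
  (C.d X V ∘ₗ LinearMap.fst K _ _).prod
    ((C.ε V X).dualMap ∘ₗ C.dualMap V θ X ∘ₗ LinearMap.fst K _ _ -
      (C.d V X).dualMap ∘ₗ LinearMap.snd K _ _)

theorem coneDual₁_apply {V : C.Ob} (θ : (V ⟶ V) →ₗ[K] K) {X : C.Ob} (b : X ⟶ V)
    (χ : Module.Dual K (V ⟶ X)) : C.coneDual₁ V θ X (b, χ) =
      (C.d X V b, C.dualMap V θ X b - (C.d V X).dualMap χ) := rfl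

theorem coneDual₀_apply {V : C.Ob} (θ : (V ⟶ V) →ₗ[K] K) {X : C.Ob} (b : X ⟶ V)
    (χ : Module.Dual K (V ⟶ X)) : C.coneDual₀ V θ X (b, χ) =
      (C.d X V b, (C.ε V X).dualMap (C.dualMap V θ X b) - (C.d V X).dualMap χ) := rfl

/-- Apply `θ`, which kills boundaries, to `relation₂`. The `ε` that appears is the reason for the
two sign variants of the cone. -/
theorem dualMap_d {V : C.Ob} {θ : (V ⟶ V) →ₗ[K] K} (hθ : ∀ x, θ (C.d V V x) = 0) {X : C.Ob}
    (b : X ⟶ V) (a : V ⟶ X) :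
    C.dualMap V θ X b (C.ε V X (C.d V X a)) = C.dualMap V θ X (C.d X V b) a := by
  change θ (C.μ₂ V X V (C.ε V X (C.d V X a)) b) = θ (C.μ₂ V X V a (C.d X V b))
  have h := congrArg θ (C.relation₂ (C.ε V X a) b)
  rw [map_add, map_add, hθ, zero_add, C.ε_ε, C.d_ε, map_neg, LinearMap.neg_apply, map_neg,
    map_zero] at h
  exact neg_add_eq_zero.1 h

theorem coneDual₁_coneDual₀ {V : C.Ob} {θ : (V ⟶ V) →ₗ[K] K} (hθ : ∀ x, θ (C.d V V x) = 0)
    {X : C.Ob} (x : (X ⟶ V) × Module.Dual K (V ⟶ X)) :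
    C.coneDual₁ V θ X (C.coneDual₀ V θ X x) = 0 := by
  obtain ⟨b, χ⟩ := x
  rw [coneDual₀_apply, coneDual₁_apply, C.d_d]
  refine Prod.ext rfl (LinearMap.ext fun a => ?_)
  change C.dualMap V θ X (C.d X V b) a - (C.dualMap V θ X b (C.ε V X (C.d V X a)) -
    χ (C.d V X (C.d V X a))) = 0
  rw [dualMap_d hθ, C.d_d, map_zero, sub_zero, sub_self]

theorem IsDualizing.acyclic {V : C.Ob} {θ : (V ⟶ V) →ₗ[K] K} (h : IsDualizing V θ) (X : C.Ob) :
    Acyclic (C.coneDual₀ V θ X) (C.coneDual₁ V θ X) := by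
  rintro ⟨b, χ⟩ hx
  rw [coneDual₁_apply, Prod.mk_eq_zero, sub_eq_zero] at hx
  obtain ⟨hb, hχ⟩ := hx
  have hcomp : ∀ a b, θ (C.cochainComp V X V a b) = - C.dualMap V θ X b (C.ε V X a) := fun a b => by
    rw [cochainComp, LinearMap.neg_apply, LinearMap.neg_apply, map_neg]; rfl
  -- On cocycles the functional of `b` agrees, up to sign, with `χ` of a boundary, hence vanishes;
  -- so `b` is exact.
  obtain ⟨y, rfl⟩ := h.exact_left hb fun a ha => by
    rw [hcomp, hχ, LinearMap.dualMap_apply, d_ε_eq_zero ha, map_zero, neg_zero]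
  -- The error in the second component vanishes on boundaries, so a cocycle `y'` represents it on
  -- cohomology.
  obtain ⟨y', hy', hy''⟩ := h.exists_eq ((C.ε V X).dualMap (C.dualMap V θ X y) - χ) (fun a => by
    rw [LinearMap.sub_apply, LinearMap.dualMap_apply, dualMap_d h.d_eq_zero, hχ,
      LinearMap.dualMap_apply, sub_self])
  -- The corrected error vanishes on all cocycles; over a field it therefore factors through the
  -- differential.
  have hker : χ - (C.ε V X).dualMap (C.dualMap V θ X (y + y')) ∈
      LinearMap.range (C.d V X).dualMap := by
    rw [LinearMap.range_dualMap_eq_dualAnnihilator_ker, Submodule.mem_dualAnnihilator]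
    intro a ha
    have := hy'' a ha
    rw [hcomp] at this
    simp only [LinearMap.sub_apply, LinearMap.dualMap_apply, map_add, LinearMap.add_apply] at this ⊢
    rw [← sub_sub, sub_eq_zero, ← neg_inj, ← this.symm, neg_sub]
  obtain ⟨ω, hω⟩ := hker
  refine ⟨(y + y', -ω), ?_⟩
  rw [coneDual₀_apply, map_add, hy', add_zero, map_neg, hω]
  congr 1
  abel

end AInfCategory

/-! ### Duality for twisted complexes -/

namespace Twisted

variable {K : Type w} [Field K] {A : AInfCategory.{w, u, v} K}

section erase

variable {B : Twisted A} {z : B.ι} (hz : ∀ k, B.level k ≤ B.level z) (X : Twisted A)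

/-- Morphisms to `B` as pairs of morphisms to `B` without `z` and to `z`. -/
noncomputable def colEquiv : (X ⟶ B) ≃ₗ[K] (X ⟶ B.erase z hz) × (X ⟶ B.sink z) :=
  LinearEquiv.ofBijective ((colErase hz X).prod (colSink X z)) ⟨by
    rw [injective_iff_map_eq_zero]
    intro a ha
    exact col_eq_zero hz (congrArg Prod.fst ha) (congrArg Prod.snd ha), by
    rintro ⟨b, c⟩
    obtain ⟨a, hb, hc⟩ := exists_col hz b c
    exact ⟨a, Prod.ext hb hc⟩⟩

/-- Extension by zero. -/
noncomputable def ofColErase : (X ⟶ B.erase z hz) →ₗ[K] (X ⟶ B) :=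
  (colEquiv hz X).symm.toLinearMap ∘ₗ LinearMap.inl K _ _

/-- Extension by zero. -/
noncomputable def ofColSink : (X ⟶ B.sink z) →ₗ[K] (X ⟶ B) :=
  (colEquiv hz X).symm.toLinearMap ∘ₗ LinearMap.inr K _ _

variable {X}

theorem colErase_ofColErase (b : X ⟶ B.erase z hz) : colErase hz X (ofColErase hz X b) = b :=
  congrArg Prod.fst ((colEquiv hz X).apply_symm_apply (b, 0))

theorem colSink_ofColErase (b : X ⟶ B.erase z hz) : colSink X z (ofColErase hz X b) = 0 :=
  congrArg Prod.snd ((colEquiv hz X).apply_symm_apply (b, 0))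

theorem colErase_ofColSink (b : X ⟶ B.sink z) : colErase hz X (ofColSink hz X b) = 0 :=
  congrArg Prod.fst ((colEquiv hz X).apply_symm_apply (0, b))

theorem colSink_ofColSink (b : X ⟶ B.sink z) : colSink X z (ofColSink hz X b) = b :=
  congrArg Prod.snd ((colEquiv hz X).apply_symm_apply (0, b))

theorem ofCol_add (a : X ⟶ B) :
    ofColErase hz X (colErase hz X a) + ofColSink hz X (colSink X z a) = a := by
  rw [← sub_eq_zero]
  refine col_eq_zero hz ?_ ?_
  · rw [map_sub, map_add, colErase_ofColErase, colErase_ofColSink, add_zero, sub_self]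
  · rw [map_sub, map_add, colSink_ofColErase, colSink_ofColSink, zero_add, sub_self]

theorem diff_ofColSink (a : X ⟶ B.sink z) :
    diff X B (ofColSink hz X a) = ofColSink hz X (diff X _ a) := by
  rw [← sub_eq_zero]
  refine col_eq_zero hz ?_ ?_
  · rw [map_sub, colErase_diff, colErase_ofColSink, colErase_ofColSink, map_zero, sub_zero]
  · rw [map_sub, colSink_diff hz, colErase_ofColSink, colSink_ofColSink, colSink_ofColSink,
      map_zero, LinearMap.zero_apply, add_zero, sub_self]

end erase

section dual

variable (V : A.Ob) (θ : (V ⟶ V) →ₗ[K] K)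

/-- A functional on the endomorphisms of an object. -/
def functional : (ofOb V 0 ⟶ ofOb V 0) →ₗ[K] K where
  toFun x := θ (x () ())
  map_add' a b := map_add θ (a () ()) (b () ())
  map_smul' c a := map_smul θ c (a () ())

variable (X : Twisted A)

/-- `b ↦ (a ↦ θ (μ^2(b, a)))`. -/
noncomputable def dualMap : (X ⟶ ofOb V 0) →ₗ[K] Module.Dual K (ofOb V 0 ⟶ X) :=
  (category A).dualMap (ofOb V 0) (functional V θ) X

/-- The mapping cone of `(X ⟶ V) → (V ⟶ X)^*`. -/
noncomputable def coneDual₀ : ((X ⟶ ofOb V 0) × Module.Dual K (ofOb V 0 ⟶ X)) →ₗ[K]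
    ((X ⟶ ofOb V 0) × Module.Dual K (ofOb V 0 ⟶ X)) :=
  (category A).coneDual₀ (ofOb V 0) (functional V θ) X

/-- The mapping cone of `(X ⟶ V) → (V ⟶ X)^*`, with another sign. -/
noncomputable def coneDual₁ : ((X ⟶ ofOb V 0) × Module.Dual K (ofOb V 0 ⟶ X)) →ₗ[K]
    ((X ⟶ ofOb V 0) × Module.Dual K (ofOb V 0 ⟶ X)) :=
  (category A).coneDual₁ (ofOb V 0) (functional V θ) X

variable {V θ X}

theorem dualMap_apply (b : X ⟶ ofOb V 0) (a : ofOb V 0 ⟶ X) :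
    dualMap V θ X b a = functional V θ (prod _ _ _ a b) := rfl

theorem coneDual₀_apply (b : X ⟶ ofOb V 0) (χ : Module.Dual K (ofOb V 0 ⟶ X)) :
    coneDual₀ V θ X (b, χ) = (diff _ _ b, dualMap V θ X b ∘ₗ ε _ _ - χ ∘ₗ diff _ _) := rfl

theorem coneDual₁_apply (b : X ⟶ ofOb V 0) (χ : Module.Dual K (ofOb V 0 ⟶ X)) :
    coneDual₁ V θ X (b, χ) = (diff _ _ b, dualMap V θ X b - χ ∘ₗ diff _ _) := rfl

theorem functional_diff (hθ : ∀ x, θ (A.d V V x) = 0) (x : ofOb V 0 ⟶ ofOb V 0) :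
    functional V θ (diff _ _ x) = 0 := by
  obtain ⟨x, rfl⟩ := ofHom_surjective x
  rw [diff_ofHom, map_smul]
  refine (congrArg _ ?_).trans (smul_zero _)
  exact hθ x

theorem acyclic_coneDual_ofOb (h : AInfCategory.IsDualizing V θ) (W : A.Ob) (m : ℤ) :
    Acyclic (coneDual₀ V θ (ofOb W m)) (coneDual₁ V θ (ofOb W m)) := by
  rintro ⟨b, χ⟩ hx
  obtain ⟨b, rfl⟩ := ofHom_surjective b
  rw [coneDual₁_apply, Prod.mk_eq_zero, sub_eq_zero, diff_ofHom] at hx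
  obtain ⟨hb, hχ⟩ := hx
  have hb' : A.d W V b = 0 := by
    have := congrArg (fun x => sgn K m • x) hb
    simp only [sgn_smul_sgn_smul, smul_zero] at this
    exact congrFun (congrFun this ()) ()
  obtain ⟨⟨y, ω⟩, hy⟩ := h.acyclic W (b, χ ∘ₗ ofHom 0 m) (by
    rw [AInfCategory.coneDual₁_apply, hb']
    refine Prod.ext rfl (LinearMap.ext fun a => ?_)
    have := LinearMap.congr_fun hχ (ofHom 0 m a)
    rw [dualMap_apply, prod_ofHom, LinearMap.comp_apply, diff_ofHom, sgn_zero, one_smul,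
      one_smul] at this
    exact sub_eq_zero.2 this)
  rw [AInfCategory.coneDual₀_apply, Prod.mk.injEq] at hy
  refine ⟨(sgn K m • ofHom m 0 y, ω ∘ₗ entry (ofOb V 0) (ofOb W m) () ()), ?_⟩
  rw [coneDual₀_apply, map_smul, diff_ofHom, sgn_smul_sgn_smul, hy.1]
  refine Prod.ext rfl (LinearMap.ext fun a => ?_)
  obtain ⟨a, rfl⟩ := ofHom_surjective a
  have := LinearMap.congr_fun hy.2 a
  rw [LinearMap.sub_apply, LinearMap.comp_apply, LinearMap.comp_apply, map_smul, ε_ofHom, sgn_zero,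
    one_mul, diff_ofHom, sgn_zero, one_smul, map_smul, LinearMap.smul_apply, sgn_smul_sgn_smul,
    dualMap_apply, prod_ofHom, sgn_zero, one_smul]
  exact this

/-- Removing a sink from `X` filters `X ⟶ V` by rows and `V ⟶ X` by columns. Dualizing reverses the
second filtration, so the sink is the quotient in both components, and the cone is an extension. -/
theorem acyclic_coneDual (h : AInfCategory.IsDualizing V θ) (X : Twisted A) :
    Acyclic (coneDual₀ V θ X) (coneDual₁ V θ X) := by
  induction X using sink_induction with
  | empty X hX =>
    have : Subsingleton (Module.Dual K (ofOb V 0 ⟶ X)) :=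
      ⟨fun f g => LinearMap.ext fun a => by
        rw [Subsingleton.elim a 0, map_zero, map_zero]⟩
    exact Acyclic.of_subsingleton _ _
  | step X z hz ih =>
    let p : ((X ⟶ ofOb V 0) × Module.Dual K (ofOb V 0 ⟶ X)) →ₗ[K]
        ((X.sink z ⟶ ofOb V 0) × Module.Dual K (ofOb V 0 ⟶ X.sink z)) :=
      (rowSink (ofOb V 0) z).prodMap (ofColSink hz (ofOb V 0)).dualMap
    let q : ((X ⟶ ofOb V 0) × Module.Dual K (ofOb V 0 ⟶ X)) →ₗ[K]
        ((X.erase z hz ⟶ ofOb V 0) × Module.Dual K (ofOb V 0 ⟶ X.erase z hz)) :=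
      (rowErase hz (ofOb V 0)).prodMap (ofColErase hz (ofOb V 0)).dualMap
    have hp : ∀ (b : X ⟶ ofOb V 0) a, dualMap V θ X b (ofColSink hz (ofOb V 0) a) =
        dualMap V θ (X.sink z) (rowSink _ z b) a := fun b a => by
      rw [dualMap_apply, prod_eq_prod_sink hz _ _ (colErase_ofColSink hz a), colSink_ofColSink]
      rfl
    have hp' : ∀ a, ε _ _ (ofColSink hz (ofOb V 0) a) = ofColSink hz _ (ε _ _ a) := fun a => by
      rw [← sub_eq_zero]
      refine col_eq_zero hz ?_ ?_
      · rw [map_sub, colErase_ε, colErase_ofColSink, colErase_ofColSink, map_zero, sub_zero]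
      · rw [map_sub, colSink_ε, colSink_ofColSink, colSink_ofColSink, sub_self]
    have hq : ∀ (b : X ⟶ ofOb V 0) (hb : rowSink _ z b = 0) a,
        dualMap V θ X b (ofColErase hz (ofOb V 0) a) =
        dualMap V θ (X.erase z hz) (rowErase hz _ b) a := fun b hb a => by
      rw [dualMap_apply, prod_eq_prod_erase hz _ _ hb, colErase_ofColErase]
      rfl
    have hq' : ∀ a, ε _ _ (ofColErase hz (ofOb V 0) a) = ofColErase hz _ (ε _ _ a) := fun a => by
      rw [← sub_eq_zero]
      refine col_eq_zero hz ?_ ?_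
      · rw [map_sub, colErase_ε, colErase_ofColErase, colErase_ofColErase, sub_self]
      · rw [map_sub, colSink_ε, colSink_ofColErase, colSink_ofColErase, map_zero, sub_zero]
    -- The extension by zero fails to commute with the differential only by a term into the sink,
    -- which `χ` does not see.
    have hχ : ∀ (χ : Module.Dual K (ofOb V 0 ⟶ X)), (ofColSink hz (ofOb V 0)).dualMap χ = 0 →
        ∀ a, χ (diff _ _ (ofColErase hz _ a)) = χ (ofColErase hz _ (diff _ _ a)) := by
      intro χ h a
      conv_lhs => rw [← ofCol_add hz (diff _ _ (ofColErase hz _ a))]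
      rw [map_add, colErase_diff, colErase_ofColErase]
      exact (congrArg _ (LinearMap.congr_fun h _)).trans (add_zero _)
    refine Acyclic.extension p q
      (AInfCategory.coneDual₁_coneDual₀ (C := category A) (functional_diff h.d_eq_zero))
      ?_ ?_ ?_ ?_ ?_ ?_ (acyclic_coneDual_ofOb h _ _) ih
    · rintro ⟨b'', χ''⟩ ⟨b', χ'⟩
      obtain ⟨b, hb, hb'⟩ := exists_row hz b' b''
      refine ⟨(b, χ' ∘ₗ colErase hz _ + χ'' ∘ₗ colSink _ z), Prod.ext hb' ?_, Prod.ext hb ?_⟩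
      · refine LinearMap.ext fun a => ?_
        change χ' (colErase hz _ (ofColSink hz _ a)) + χ'' (colSink _ z (ofColSink hz _ a)) = χ'' a
        rw [colErase_ofColSink, colSink_ofColSink, map_zero, zero_add]
      · refine LinearMap.ext fun a => ?_
        change χ' (colErase hz _ (ofColErase hz _ a)) + χ'' (colSink _ z (ofColErase hz _ a)) = χ' a
        rw [colErase_ofColErase, colSink_ofColErase, map_zero, add_zero]
    · rintro ⟨b, χ⟩ h h'
      refine Prod.ext (row_eq_zero hz (congrArg Prod.fst h') (congrArg Prod.fst h)) ?_
      refine LinearMap.ext fun a => ?_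
      change χ a = 0
      have h1 : χ (ofColErase hz _ (colErase hz _ a)) = 0 :=
        LinearMap.congr_fun (congrArg Prod.snd h') _
      have h2 : χ (ofColSink hz _ (colSink _ z a)) = 0 :=
        LinearMap.congr_fun (congrArg Prod.snd h) _
      rw [← ofCol_add hz a, map_add, h1, h2, add_zero]
    · rintro ⟨b, χ⟩
      refine Prod.ext (rowSink_diff hz b) (LinearMap.ext fun a => ?_)
      change dualMap V θ X b (ε _ _ (ofColSink hz _ a)) - χ (diff _ _ (ofColSink hz _ a)) =
        dualMap V θ _ (rowSink _ z b) (ε _ _ a) - χ (ofColSink hz _ (diff _ _ a))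
      rw [hp', hp, diff_ofColSink]
    · rintro ⟨b, χ⟩
      refine Prod.ext (rowSink_diff hz b) (LinearMap.ext fun a => ?_)
      change dualMap V θ X b (ofColSink hz _ a) - χ (diff _ _ (ofColSink hz _ a)) =
        dualMap V θ _ (rowSink _ z b) a - χ (ofColSink hz _ (diff _ _ a))
      rw [hp, diff_ofColSink]
    · rintro ⟨b, χ⟩ hx
      have hb : rowSink _ z b = 0 := congrArg Prod.fst hx
      refine Prod.ext ?_ (LinearMap.ext fun a => ?_)
      · change rowErase hz _ (diff _ _ b) = diff _ _ (rowErase hz _ b)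
        rw [rowErase_diff, hb, map_zero, add_zero]
      change dualMap V θ X b (ε _ _ (ofColErase hz _ a)) - χ (diff _ _ (ofColErase hz _ a)) =
        dualMap V θ _ (rowErase hz _ b) (ε _ _ a) - χ (ofColErase hz _ (diff _ _ a))
      rw [hq', hq _ hb, hχ χ (congrArg Prod.snd hx)]
    · rintro ⟨b, χ⟩ hx
      have hb : rowSink _ z b = 0 := congrArg Prod.fst hx
      refine Prod.ext ?_ (LinearMap.ext fun a => ?_)
      · change rowErase hz _ (diff _ _ b) = diff _ _ (rowErase hz _ b)
        rw [rowErase_diff, hb, map_zero, add_zero]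
      change dualMap V θ X b (ofColErase hz _ a) - χ (diff _ _ (ofColErase hz _ a)) =
        dualMap V θ _ (rowErase hz _ b) a - χ (ofColErase hz _ (diff _ _ a))
      rw [hq _ hb, hχ χ (congrArg Prod.snd hx)]

/-- `H(V, X)` embeds into the dual of `H(X, V)`. Concretely, a cocycle is a boundary once every
functional `ψ` that kills boundaries kills it. -/
theorem exactHom_of_isDualizing (h : AInfCategory.IsDualizing V θ)
    {X : Twisted A} (hX : ExactHom X (ofOb V 0)) : ExactHom (ofOb V 0) X := by
  intro a ha
  change a ∈ LinearMap.range (diff (ofOb V 0) X)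
  rw [← Subspace.forall_mem_dualAnnihilator_apply_eq_zero_iff]
  intro ψ hψ
  rw [Submodule.mem_dualAnnihilator] at hψ
  obtain ⟨⟨y, ω⟩, hy⟩ := acyclic_coneDual h X (0, ψ) (by
    rw [coneDual₁_apply, map_zero, map_zero, zero_sub]
    refine Prod.ext rfl (LinearMap.ext fun b => ?_)
    exact neg_eq_zero.2 (hψ _ ⟨b, rfl⟩))
  rw [coneDual₀_apply, Prod.mk.injEq] at hy
  -- Exactness of `X ⟶ V` bounds the representing cocycle by `c`, and then `relation₂` shows that `ψ
  -- a` is `θ` of a boundary, up to sign.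
  obtain ⟨c, rfl⟩ := hX y hy.1
  have h1 := congrArg (functional V θ) (diff_prod a c)
  rw [map_add, map_add, functional_diff h.d_eq_zero, ha, map_zero, LinearMap.zero_apply, map_zero,
    zero_add, zero_add] at h1
  rw [← hy.2]
  change functional V θ (prod _ _ _ (ε _ _ a) (diff _ _ c)) - ω (diff _ _ a) = 0
  rw [h1, ha, map_zero, sub_zero]

end dual

end Twisted

theorem signTwist_mem {K : Type w} [Field K] {M : Type*} [AddCommGroup M] [Module K M]
    (g : ℤ → Submodule K M) (hg : DirectSum.IsInternal g) (n : ℤ) {k : ℤ} {x : M} (hx : x ∈ g k) :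
    signTwist g hg n x ∈ g k := by
  rw [signTwist_apply g hg n k hx]
  exact Submodule.smul_mem _ _ hx

theorem signTwist_signTwist {K : Type w} [Field K] {M : Type*} [AddCommGroup M] [Module K M]
    (g : ℤ → Submodule K M) (hg : DirectSum.IsInternal g) (n : ℤ) (x : M) :
    signTwist g hg n (signTwist g hg n x) = x := by
  refine eq_of_homogeneous g hg (f := signTwist g hg n ∘ₗ signTwist g hg n)
    (f' := LinearMap.id) (fun k x hx => ?_) x
  rw [LinearMap.comp_apply, signTwist_apply g hg n k hx, map_smul, signTwist_apply g hg n k hx]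
  exact sgn_smul_sgn_smul _ _

namespace Twisted

/-- Every cocycle of degree zero is a coboundary. -/
def ExactHomZero {K : Type w} [Field K] {A : AInfCategory.{w, u, v} K} (X Y : Twisted A) : Prop :=
  ∀ a ∈ gr X Y 0, diff X Y a = 0 → ∃ c, diff X Y c = a

end Twisted

/-! ### Removing the signs from sums over lifts -/

namespace SumOb

variable {K : Type w} [Field K] {A : AInfCategory.{w, u, v} K}

theorem sum_apply {α : Type*} {X Y : SumOb A} (s : Finset α) (f : α → (X ⟶ Y)) (i : X.ι)
    (j : Y.ι) : (∑ n ∈ s, f n) i j = ∑ n ∈ s, f n i j :=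
  map_sum (AddMonoidHom.mk' (fun a : X ⟶ Y => a i j) fun _ _ => rfl) f s

/-- The matrix with entries `(-1) ^ (deg i * (|a i j| - 1)) a i j`. -/
noncomputable def rescale (X Y : SumOb A) : (X ⟶ Y) →ₗ[K] (X ⟶ Y) where
  toFun a i j := signTwist (A.gr (X.obj i) (Y.obj j)) (A.gr_internal _ _) (X.deg i) (a i j)
  map_add' a b := funext fun i => funext fun j => map_add _ (a i j) (b i j)
  map_smul' c a := funext fun i => funext fun j => map_smul _ c (a i j)

theorem rescale_apply {X Y : SumOb A} (a : X ⟶ Y) (i : X.ι) (j : Y.ι) : rescale X Y a i j =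
    signTwist (A.gr (X.obj i) (Y.obj j)) (A.gr_internal _ _) (X.deg i) (a i j) := rfl

theorem rescale_rescale {X Y : SumOb A} (a : X ⟶ Y) : rescale X Y (rescale X Y a) = a :=
  funext fun _ => funext fun _ => signTwist_signTwist _ _ _ _

theorem rescale_mem {X Y : SumOb A} {r : ℤ} {a : X ⟶ Y} (ha : a ∈ gr X Y r) :
    rescale X Y a ∈ gr X Y r := fun i j => signTwist_mem _ _ _ (ha i j)

/-- The paths of rescaled entries of a path of matrices. -/
noncomputable def lifts {X : SumOb A} : ∀ {Y : SumOb A}, Path X Y → ∀ (i : X.ι) (j : Y.ι),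
    Multiset (Path (X.obj i) (Y.obj j))
  | _, .nil, i, j => nilPaths X.obj i j
  | _, .cons (b := Y) (c := Z) p a, i, j => ∑ k : Y.ι,
      (lifts p i k).map fun q => q.cons (rescale Y Z a k j)

/-- The sign exponent at an entry is `(deg i_{q-1} - deg i₀)(|x_q| - 1)`. The part with `deg
i_{q-1}` is absorbed by `rescale`; the part with `deg i₀` adds up over the path to one sign that
depends only on the reduced degree and the end points. -/
theorem sumLifts_eq {M : Type*} [AddCommGroup M] [Module K M] {X Y : SumOb A} (p : Path X Y)
    (r : ℤ) (hp : A.additive.HasRedDeg p r) (i : X.ι) (j : Y.ι) (F : Path (X.obj i) (Y.obj j) → M)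
    (hF : A.IsHomog F) :
    sumLifts p i j F = sgn K (X.deg i * (r - (Y.deg j - X.deg i))) • msum (lifts p i j) F := by
  classical
  induction p generalizing r with
  | nil =>
    obtain rfl : r = 0 := hp
    by_cases hij : i = j
    · subst hij; simp [sumLifts, lifts, nilPaths_self]
    · simp [sumLifts, lifts, nilPaths_ne _ hij, hij]
  | @cons Y Z p a ih =>
    obtain ⟨k, ha, hp⟩ := hp
    simp only [sumLifts, lifts, msum_finset_sum, msum_map, Finset.smul_sum]
    refine Finset.sum_congr rfl fun l _ => ?_
    have h : ∀ q : Path (X.obj i) (Y.obj l), F (q.cons (signTwist (A.gr (Y.obj l) (Z.obj j))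
        (A.gr_internal _ _) (Y.deg l - X.deg i) (a l j))) =
        sgn K (X.deg i * (k - (Z.deg j - Y.deg l) - 1)) • F (q.cons (rescale Y Z a l j)) := by
      intro q
      rw [rescale_apply, signTwist_apply _ _ _ _ (ha l j), signTwist_apply _ _ _ _ (ha l j)]
      refine ((hF _ _ _ .nil).trans ?_).trans (congrArg _ (hF _ _ _ .nil).symm)
      rw [smul_smul]
      congr 1
      change sgn K _ = _ * sgn K _
      rw [sub_mul, sgn_sub, mul_comm]
    simp only [h, sumLifts_fun_smul]
    rw [ih _ hp l _ (hF.cons _), smul_smul, ← sgn_add]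
    congr 2
    ring

theorem msum_lifts_cons {M : Type*} [AddCommMonoid M] {X Y Z : SumOb A} (p : Path X Y)
    (a : Y ⟶ Z) (i : X.ι) (j : Z.ι) (F : Path (X.obj i) (Z.obj j) → M) :
    msum (lifts (p.cons a) i j) F =
      ∑ k, msum (lifts p i k) fun q => F (q.cons (rescale Y Z a k j)) := by
  simp [lifts]

theorem msum_lifts_cons_comp {M : Type*} [AddCommGroup M] {W X Y Z : SumOb A}
    (p : Path W X) (a : X ⟶ Y) (q : Path Y Z) (i : W.ι) (j : Z.ι)
    (F : Path (W.obj i) (Z.obj j) → M) :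
    msum (lifts ((p.cons a).comp q) i j) F = ∑ k : X.ι, ∑ l : Y.ι,
      msum (lifts p i k) fun P => msum (lifts q l j) fun Q =>
        F ((P.cons (rescale X Y a k l)).comp Q) := by
  induction q with
  | nil =>
    rw [Path.comp_nil, msum_lifts_cons]
    refine Finset.sum_congr rfl fun k _ => ?_
    simp only [lifts, msum_comm (lifts p i k) (nilPaths _ _ _)]
    exact (sum_msum_nilPaths j fun l Q => msum (lifts p i k) fun P =>
      F ((P.cons (rescale X _ a k l)).comp Q)).symm
  | @cons Y' Z q b ih =>
    rw [Path.comp_cons, msum_lifts_cons]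
    simp only [ih, msum_lifts_cons, msum_fun_sum]
    exact (Twisted.sum_comm₃ _).symm

/-- Strings of entries of `δ` contribute only along increasing levels. Such a string ending at `j`
has at most `level j` entries, so the cutoff `N` loses nothing. -/
theorem sum_msum_lifts_constPath {M : Type*} [AddCommGroup M] [Module K M] {X : SumOb A}
    {δ : X ⟶ X} {level : X.ι → ℕ} (h : ∀ i j, ¬ level i < level j → δ i j = 0) (N : ℕ)
    (i j : X.ι) (hN : level j < N) (F : Path (X.obj i) (X.obj j) → M) (hF : A.IsHomog F) :
    ∑ n ∈ Finset.range N, msum (lifts (constPath δ n) i j) F =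
      msum (chainPaths X.obj level (rescale X X δ) i j) F := by
  induction N generalizing j with
  | zero => exact absurd hN (Nat.not_lt_zero _)
  | succ N ih =>
    rw [Finset.sum_range_succ', chainPaths_eq, add_comm]
    simp only [msum_add, msum_finset_sum, msum_ite, msum_map, constPath, msum_lifts_cons]
    congr 1
    rw [Finset.sum_comm]
    refine Finset.sum_congr rfl fun k _ => ?_
    split_ifs with hk
    · exact ih k (by omega) _ (hF.cons _)
    · have h0 : rescale X X δ k j = 0 := by rw [rescale_apply, h k j hk, map_zero]
      refine Finset.sum_eq_zero fun n _ => ?_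
      rw [h0]
      exact (msum_congr fun q _ => hF.zero q .nil).trans (msum_fun_zero _)

theorem hasRedDeg_constPath {X : SumOb A} {δ : X ⟶ X} (hδ : δ ∈ gr X X 1) (n : ℕ) :
    A.additive.HasRedDeg (constPath δ n) 0 := by
  induction n with
  | zero => rfl
  | succ n ih => exact ⟨1, hδ, by simpa using ih⟩

theorem hasRedDeg_comp_constPath {X Y : SumOb A} {δ : Y ⟶ Y} (hδ : δ ∈ gr Y Y 1) (n : ℕ)
    {p : Path X Y} {r : ℤ} (hp : A.additive.HasRedDeg p r) :
    A.additive.HasRedDeg (p.comp (constPath δ n)) r := by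
  induction n with
  | zero => exact hp
  | succ n ih => exact ⟨1, hδ, by simpa using ih⟩

end SumOb

/-! ### Comparison with the rescaled twisted complexes -/

namespace TwOb

variable {K : Type w} [Field K] {A : AInfCategory.{w, u, v} K}

/-- The position of a summand in the filtration. -/
noncomputable def level (X : TwOb A) (i : X.ι) : ℕ :=
  (Finset.univ.filter fun k => X.triangular.choose k < X.triangular.choose i).card

/-- A summand does not precede itself. This bound makes the truncated sums of `TwOb` reach every
increasing chain, which arbitrary levels would not guarantee. -/
theorem level_lt_card (X : TwOb A) (i : X.ι) : X.level i < Fintype.card X.ι :=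
  Finset.card_lt_univ_of_notMem (x := i) (by simp)

theorem δ_eq_zero (X : TwOb A) (i j : X.ι) (h : ¬ X.level i < X.level j) : X.δ i j = 0 := by
  refine X.triangular.choose_spec i j fun hij => h (Finset.card_lt_card ?_)
  refine Finset.ssubset_iff_subset_ne.2 ⟨fun k hk => ?_, fun he => ?_⟩
  · simp only [Finset.mem_filter_univ] at hk ⊢
    exact hk.trans hij
  · have : i ∈ Finset.univ.filter fun k => X.triangular.choose k < X.triangular.choose j := by
      simpa using hij
    rw [← he] at this
    simp at this

theorem sum_msum_lifts {M : Type*} [AddCommGroup M] [Module K M] (X : TwOb A)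
    (i j : X.ι) (F : Path (X.obj i) (X.obj j) → M) (hF : A.IsHomog F) :
    ∑ n ∈ Finset.range (Fintype.card X.ι), msum (SumOb.lifts (constPath X.δ n) i j) F =
      msum (chainPaths X.obj X.level (SumOb.rescale _ _ X.δ) i j) F :=
  SumOb.sum_msum_lifts_constPath X.δ_eq_zero _ i j (X.level_lt_card j) F hF

/-- The rescaled twisted complex. -/
noncomputable abbrev toTwisted (X : TwOb A) : Twisted A where
  ι := X.ι
  obj := X.obj
  deg := X.deg
  level := X.level
  x := SumOb.rescale _ _ X.δ
  x_mem := SumOb.rescale_mem X.δ_mem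
  mc i j := by
    have h : ∑ n ∈ Finset.range (Fintype.card X.ι), SumOb.sumLifts (constPath X.δ n) i j A.μ = 0 := by
      exact (SumOb.sum_apply _ _ i j).symm.trans (congrFun (congrFun X.maurerCartan i) j)
    have h := (Finset.sum_congr rfl fun n _ => SumOb.sumLifts_eq (constPath X.δ n) 0
      (SumOb.hasRedDeg_constPath X.δ_mem n) i j A.μ (A.isHomog_μ _ _)).symm.trans h
    rw [← Finset.smul_sum, X.sum_msum_lifts i j _ (A.isHomog_μ _ _)] at h
    rw [← sgn_smul_sgn_smul (K := K) (X.deg i * (0 - (X.deg j - X.deg i))) (msum _ _), h, smul_zero]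

/-- A morphism of twisted complexes, rescaled. -/
noncomputable def homToTwisted (X Y : TwOb A) : (X ⟶ Y) →ₗ[K] (X.toTwisted ⟶ Y.toTwisted) :=
  SumOb.rescale X.toSumOb Y.toSumOb

theorem homToTwisted_surjective {X Y : TwOb A} (a : X.toTwisted ⟶ Y.toTwisted) :
    ∃ b, homToTwisted X Y b = a := ⟨SumOb.rescale X.toSumOb Y.toSumOb a, SumOb.rescale_rescale _⟩

theorem homToTwisted_injective (X Y : TwOb A) : Function.Injective (homToTwisted X Y) :=
  Function.LeftInverse.injective (g := SumOb.rescale X.toSumOb Y.toSumOb) SumOb.rescale_rescale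

/-- Copies of `δ` have reduced degree zero, so every inserted path has reduced degree `r - 1` and
carries the same sign. It differs from the stated one by `sgn (deg i)`, which `Twisted.diff`
contributes. -/
theorem homToTwisted_d_apply {X Y : TwOb A} {r : ℤ} {a : X ⟶ Y}
    (ha : a ∈ SumOb.gr X.toSumOb Y.toSumOb r) (i : X.ι) (j : Y.ι) :
    A.tw.d X Y a i j = sgn K (X.deg i * (r - (Y.deg j - X.deg i))) •
      X.toTwisted.diff Y.toTwisted (homToTwisted X Y a) i j := by
  let b : X.toSumOb ⟶ Y.toSumOb := a
  have h : A.tw.d X Y a i j = ∑ n ∈ Finset.range (Fintype.card X.ι),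
      ∑ m ∈ Finset.range (Fintype.card Y.ι), SumOb.sumLifts
        (((constPath X.δ n).cons b).comp (constPath Y.δ m)) i j A.μ := by
    have h₀ : A.tw.d X Y a = (∑ n ∈ Finset.range (Fintype.card X.ι),
      ∑ m ∈ Finset.range (Fintype.card Y.ι),
        SumOb.μ (((constPath X.δ n).cons b).comp (constPath Y.δ m)) : X.toSumOb ⟶ Y.toSumOb) := rfl
    rw [h₀]
    refine (SumOb.sum_apply _ _ i j).trans (Finset.sum_congr rfl fun n _ => ?_)
    exact SumOb.sum_apply _ _ i j
  have hp : ∀ n m, A.additive.HasRedDeg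
      (((constPath X.δ n).cons b).comp (constPath Y.δ m)) (r - 1) := fun n m => by
    refine SumOb.hasRedDeg_comp_constPath Y.δ_mem m ⟨r, ha, ?_⟩
    rw [sub_self]
    exact SumOb.hasRedDeg_constPath X.δ_mem n
  rw [h]
  refine Eq.trans ?_ (congrArg _ (Twisted.diff_apply (X := X.toTwisted) (Y := Y.toTwisted) _ i j).symm)
  rw [Finset.sum_congr rfl fun n _ => Finset.sum_congr rfl fun m _ =>
    SumOb.sumLifts_eq (((constPath X.δ n).cons b).comp (constPath Y.δ m)) _ (hp n m) i j A.μ (A.isHomog_μ _ _)]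
  simp only [SumOb.msum_lifts_cons_comp, ← Finset.smul_sum]
  rw [smul_smul]
  congr 1
  · change _ = _ * sgn K (X.deg i)
    rw [← sgn_sub]
    congr 1
    ring
  · have hF : ∀ k l (Q : Path (Y.obj l) (Y.obj j)), A.IsHomog fun P : Path (X.obj i) (X.obj k) =>
        A.μ ((P.cons (SumOb.rescale X.toSumOb Y.toSumOb b k l)).comp Q) := fun k l Q =>
      ((A.isHomog_μ _ _).comp_right Q).cons _
    refine (Finset.sum_congr rfl fun n _ => Finset.sum_comm).trans (Finset.sum_comm.trans
      (Finset.sum_congr rfl fun k _ => (Finset.sum_congr rfl fun n _ => Finset.sum_comm).trans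
        (Finset.sum_comm.trans (Finset.sum_congr rfl fun l _ => ?_))))
    have h₁ := X.sum_msum_lifts i k _ (AInfCategory.IsHomog.msum (fun Q => hF k l Q)
      (chainPaths Y.obj Y.level (SumOb.rescale _ _ Y.δ) l j))
    refine Eq.trans ?_ h₁
    refine Finset.sum_congr rfl fun n _ => ?_
    rw [← msum_fun_sum]
    refine msum_congr fun P _ => ?_
    exact Y.sum_msum_lifts l j _ ((A.isHomog_μ _ _).comp_left _)

/-- The boundary has degree `r + 1`, so rescaling its entries produces exactly the sign of
`homToTwisted_d_apply` a second time. -/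
theorem homToTwisted_d {X Y : TwOb A} (a : X ⟶ Y) : homToTwisted X Y (A.tw.d X Y a) =
    X.toTwisted.diff Y.toTwisted (homToTwisted X Y a) := by
  refine eq_of_homogeneous (Twisted.gr X.toTwisted Y.toTwisted) (Twisted.gr_internal _ _)
    (f := homToTwisted X Y ∘ₗ A.tw.d X Y)
    (f' := X.toTwisted.diff Y.toTwisted ∘ₗ homToTwisted X Y) (fun r b hb => ?_) a
  refine Twisted.hom_ext fun i j => ?_
  have h := (Twisted.category A).d_mem (X := X.toTwisted) (Y := Y.toTwisted)
    (SumOb.rescale_mem hb) i j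
  refine (congrArg (signTwist _ (A.gr_internal _ _) (X.deg i)) (homToTwisted_d_apply hb i j)).trans ?_
  rw [map_smul]
  refine (congrArg _ (signTwist_apply _ _ _ _ h)).trans ?_
  change _ • sgn K _ • _ = _
  rw [show r + 1 - (Y.toTwisted.deg j - X.toTwisted.deg i) - 1 = r - (Y.deg j - X.deg i) by ring]
  exact sgn_smul_sgn_smul _ _

theorem d_eq_zero_iff {X Y : TwOb A} (a : X ⟶ Y) : A.tw.d X Y a = (0 : X ⟶ Y) ↔
    X.toTwisted.diff Y.toTwisted (homToTwisted X Y a) = 0 := by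
  rw [← homToTwisted_d]
  exact (map_eq_zero_iff _ (homToTwisted_injective X Y)).symm

theorem subsingleton_dHom_iff {X Y : TwOb A} : Subsingleton (DHom X Y) ↔
    X.toTwisted.ExactHomZero Y.toTwisted := by
  constructor
  · intro h a ha ha₀
    obtain ⟨b, rfl⟩ := homToTwisted_surjective a
    have hb := (d_eq_zero_iff b).2 ha₀
    have hmem : A.tw.cls b hb ∈ A.tw.Hgr X Y 0 := by
      refine ⟨⟨b, hb⟩, ?_, rfl⟩
      have := SumOb.rescale_mem ha
      rwa [show SumOb.rescale _ _ (homToTwisted X Y b) = b from SumOb.rescale_rescale b] at this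
    have h0 : A.tw.cls b hb = 0 := congrArg Subtype.val (h.elim ⟨_, hmem⟩ 0)
    obtain ⟨c, hc⟩ := (Submodule.Quotient.mk_eq_zero _).1 h0
    exact ⟨homToTwisted X Y c, (homToTwisted_d c).symm.trans (congrArg _ hc)⟩
  · intro h
    refine subsingleton_of_forall_eq 0 ?_
    rintro ⟨_, ⟨a, ha₀⟩, ha, rfl⟩
    refine Subtype.ext ((Submodule.Quotient.mk_eq_zero _).2 ?_)
    obtain ⟨c, hc⟩ := h (homToTwisted X Y a) (SumOb.rescale_mem ha) ((d_eq_zero_iff a).1 ha₀)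
    obtain ⟨c, rfl⟩ := homToTwisted_surjective c
    exact ⟨c, homToTwisted_injective X Y ((homToTwisted_d c).trans hc)⟩

end TwOb

namespace Twisted

variable {K : Type w} [Field K] {A : AInfCategory.{w, u, v} K}

/-! ### Shifts -/

/-- The signs are differences of a function of the summands and telescope along chains. -/
theorem msum_chainPaths_sgn {ι M : Type*} [Fintype ι] [AddCommGroup M] [Module K M]
    {obj : ι → A.Ob} {level : ι → ℕ} {x : ∀ i j, obj i ⟶ obj j} (c : ι → ℤ)
    (i j : ι) (F : Path (obj i) (obj j) → M) (hF : A.IsHomog F) :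
    msum (chainPaths obj level (fun k l => sgn K (c k - c l) • x k l) i j) F =
      sgn K (c i - c j) • msum (chainPaths obj level x i j) F := by
  induction hn : level j using Nat.strong_induction_on generalizing j with
  | _ n ih =>
    rw [chainPaths_eq, chainPaths_eq]
    simp only [msum_add, msum_finset_sum, msum_ite, msum_map, smul_add, Finset.smul_sum]
    congr 1
    · by_cases hij : i = j
      · subst hij; simp
      · simp [nilPaths_ne _ hij]
    · refine Finset.sum_congr rfl fun k _ => ?_
      split_ifs with hk
      · have h : ∀ p : Path (obj i) (obj k), F (p.cons (sgn K (c k - c j) • x k j)) =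
            sgn K (c k - c j) • F (p.cons (x k j)) := fun p => hF _ _ _ .nil
        simp only [h, msum_fun_smul]
        rw [ih (level k) (hn ▸ hk) k (fun p => F (p.cons (x k j))) (hF.cons _) rfl, smul_smul,
          ← sgn_add]
        congr 2
        ring
      · simp

/-- The shift of a twisted complex. -/
noncomputable abbrev shift (B : Twisted A) (σ : ℤ) : Twisted A where
  ι := B.ι
  obj := B.obj
  deg i := B.deg i - σ
  level := B.level
  x i j := sgn K (σ * B.deg i - σ * B.deg j) • B.x i j
  x_mem i j := by
    have := Submodule.smul_mem _ (sgn K (σ * B.deg i - σ * B.deg j)) (B.x_mem i j)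
    simpa only [sub_sub_sub_cancel_right] using this
  mc i j := by
    rw [msum_chainPaths_sgn (fun i => σ * B.deg i) i j _ (A.isHomog_μ _ _), B.mc, smul_zero]

theorem msum_chains_shift {M : Type*} [AddCommGroup M] [Module K M] (B : Twisted A) (σ : ℤ)
    (i j : B.ι) (F : Path (B.obj i) (B.obj j) → M) (hF : A.IsHomog F) :
    msum ((B.shift σ).chains i j) F =
      sgn K (σ * B.deg i - σ * B.deg j) • msum (B.chains i j) F :=
  msum_chainPaths_sgn (fun i => σ * B.deg i) i j F hF

/-- The identification of morphisms to a twisted complex with morphisms to its shift. -/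
noncomputable def toShift (X B : Twisted A) (σ : ℤ) : (X ⟶ B) →ₗ[K] (X ⟶ B.shift σ) where
  toFun a i j := sgn K (σ * B.deg j) • a i j
  map_add' a b := hom_ext fun i j => smul_add _ (a i j) (b i j)
  map_smul' c a := hom_ext fun i j => smul_comm _ c (a i j)

/-- The identification of morphisms from a twisted complex with morphisms from its shift. -/
noncomputable def fromShift (B X : Twisted A) (σ : ℤ) : (B ⟶ X) →ₗ[K] (B.shift σ ⟶ X) where
  toFun a i j := sgn K (σ * B.deg i) • a i j
  map_add' a b := hom_ext fun i j => smul_add _ (a i j) (b i j)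
  map_smul' c a := hom_ext fun i j => smul_comm _ c (a i j)

theorem toShift_apply {X B : Twisted A} {σ : ℤ} (a : X ⟶ B) (i : X.ι) (j : B.ι) :
    toShift X B σ a i j = sgn K (σ * B.deg j) • a i j := rfl

theorem fromShift_apply {B X : Twisted A} {σ : ℤ} (a : B ⟶ X) (i : B.ι) (j : X.ι) :
    fromShift B X σ a i j = sgn K (σ * B.deg i) • a i j := rfl

theorem diff_toShift {X B : Twisted A} {σ : ℤ} (a : X ⟶ B) :
    diff X (B.shift σ) (toShift X B σ a) = toShift X B σ (diff X B a) := by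
  refine hom_ext fun i j => ?_
  rw [toShift_apply, diff_apply, diff_apply, smul_comm]
  congr 1
  simp only [Finset.smul_sum]
  refine Finset.sum_congr rfl fun k _ => Finset.sum_congr rfl fun l _ => ?_
  rw [← msum_fun_smul]
  refine msum_congr fun p _ => ?_
  rw [msum_chains_shift B σ l j _ ((A.isHomog_μ _ _).comp_left _)]
  simp only [toShift_apply, A.μ_smul, msum_fun_smul]
  rw [smul_smul, ← sgn_add, ← sgn_neg]
  rw [show -(σ * B.deg l - σ * B.deg j + σ * B.deg l) =
    σ * B.deg j - (σ * B.deg l + σ * B.deg l) by ring, sgn_sub, sgn_add, sgn_mul_self, mul_one]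

/-- Unlike for `toShift`, a sign remains: `diff` depends on the degree of the source summand, which
has moved by `σ`. -/
theorem diff_fromShift {B X : Twisted A} {σ : ℤ} (a : B ⟶ X) :
    diff (B.shift σ) X (fromShift B X σ a) = sgn K σ • fromShift B X σ (diff B X a) := by
  refine hom_ext fun i j => ?_
  rw [smul_apply, fromShift_apply, diff_apply, diff_apply, smul_smul, smul_smul]
  simp only [Finset.smul_sum]
  refine Finset.sum_congr rfl fun k _ => Finset.sum_congr rfl fun l _ => ?_
  have h := msum_chains_shift B σ i k
    (fun p => msum (X.chains l j) fun q => A.μ ((p.cons (a k l)).comp q))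
    (AInfCategory.IsHomog.msum (fun q => ((A.isHomog_μ _ _).comp_right q).cons _) _)
  simp only [fromShift_apply, A.μ_smul, msum_fun_smul]
  rw [h, smul_smul, smul_smul]
  congr 1
  rw [sgn_sub, sgn_sub]
  linear_combination sgn K σ * sgn K (B.deg i) * sgn K (σ * B.deg i) *
    sgn_mul_self (K := K) (σ * B.deg k)

theorem toShift_injective (X B : Twisted A) (σ : ℤ) : Function.Injective (toShift X B σ) := by
  refine Function.LeftInverse.injective (g := fun b i j => sgn K (σ * B.deg j) • b i j) fun a => ?_
  exact hom_ext fun i j => sgn_smul_sgn_smul _ _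

theorem toShift_surjective (X B : Twisted A) (σ : ℤ) : Function.Surjective (toShift X B σ) := by
  refine Function.RightInverse.surjective (g := fun b i j => sgn K (σ * B.deg j) • b i j)
    fun a => ?_
  exact hom_ext fun i j => sgn_smul_sgn_smul _ _

theorem fromShift_injective (B X : Twisted A) (σ : ℤ) : Function.Injective (fromShift B X σ) := by
  refine Function.LeftInverse.injective (g := fun b i j => sgn K (σ * B.deg i) • b i j) fun a => ?_
  exact hom_ext fun i j => sgn_smul_sgn_smul _ _

theorem fromShift_surjective (B X : Twisted A) (σ : ℤ) :
    Function.Surjective (fromShift B X σ) := by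
  refine Function.RightInverse.surjective (g := fun b i j => sgn K (σ * B.deg i) • b i j)
    fun a => ?_
  exact hom_ext fun i j => sgn_smul_sgn_smul _ _

theorem toShift_mem {X B : Twisted A} {σ r : ℤ} {a : X ⟶ B} (ha : a ∈ gr X B (r + σ)) :
    toShift X B σ a ∈ gr X (B.shift σ) r := fun i j => by
  have := Submodule.smul_mem _ (sgn K (σ * B.deg j)) (ha i j)
  rwa [show r + σ - (B.deg j - X.deg i) = r - (B.deg j - σ - X.deg i) by ring] at this

theorem fromShift_mem {B X : Twisted A} {σ r : ℤ} {a : B ⟶ X} (ha : a ∈ gr B X (r - σ)) :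
    fromShift B X σ a ∈ gr (B.shift σ) X r := fun i j => by
  have := Submodule.smul_mem _ (sgn K (σ * B.deg i)) (ha i j)
  rwa [show r - σ - (X.deg j - B.deg i) = r - (X.deg j - (B.deg i - σ)) by ring] at this

theorem ExactHom.shift_right {X B : Twisted A} (h : ExactHom X B) (σ : ℤ) :
    ExactHom X (B.shift σ) := by
  intro a ha
  obtain ⟨a, rfl⟩ := toShift_surjective X B σ a
  rw [diff_toShift] at ha
  obtain ⟨c, rfl⟩ := h a (toShift_injective X B σ (by rw [ha, map_zero]))
  exact ⟨_, diff_toShift c⟩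

theorem ExactHom.shift_left {B X : Twisted A} (h : ExactHom B X) (σ : ℤ) :
    ExactHom (B.shift σ) X := by
  intro a ha
  obtain ⟨a, rfl⟩ := fromShift_surjective B X σ a
  rw [diff_fromShift] at ha
  have ha' : sgn K σ • sgn K σ • fromShift B X σ (diff B X a) = 0 := by rw [ha, smul_zero]
  rw [sgn_smul_sgn_smul] at ha'
  obtain ⟨c, rfl⟩ := h a (fromShift_injective B X σ (by rw [ha', map_zero]))
  exact ⟨sgn K σ • fromShift B X σ c, by rw [map_smul, diff_fromShift, sgn_smul_sgn_smul]⟩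

/-- A component of degree `σ` of a cocycle is a cocycle of degree zero with values in the shift by
`σ`. -/
theorem ExactHom.of_shift_right {X B : Twisted A} (h : ∀ σ, ExactHomZero X (B.shift σ)) :
    ExactHom X B := by
  intro a ha
  refine AInfCategory.exact_of_exact_proj (C := category A) fun σ => ?_
  have hmem : (category A).proj X B σ a ∈ gr X B (0 + σ) := by
    rw [zero_add]; exact AInfCategory.proj_mem (C := category A) σ a
  have h0 : diff X B ((category A).proj X B σ a) = 0 :=
    AInfCategory.d_proj_eq_zero (C := category A) ha σ
  obtain ⟨c, hc⟩ := h σ _ (toShift_mem hmem) (by rw [diff_toShift, h0, map_zero])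
  obtain ⟨c, rfl⟩ := toShift_surjective X B σ c
  rw [diff_toShift] at hc
  exact ⟨c, toShift_injective X B σ hc⟩

theorem ExactHom.of_shift_left {B X : Twisted A} (h : ∀ σ, ExactHomZero (B.shift σ) X) :
    ExactHom B X := by
  intro a ha
  refine AInfCategory.exact_of_exact_proj (C := category A) fun r => ?_
  have hmem : (category A).proj B X r a ∈ gr B X (0 - -r) := by
    rw [sub_neg_eq_add, zero_add]; exact AInfCategory.proj_mem (C := category A) r a
  have h0 : diff B X ((category A).proj B X r a) = 0 :=
    AInfCategory.d_proj_eq_zero (C := category A) ha r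
  -- In the first variable the shift acts on degrees in the opposite direction.
  obtain ⟨c, hc⟩ := h (-r) _ (fromShift_mem hmem) (by
    rw [diff_fromShift, h0, map_zero, smul_zero])
  obtain ⟨c, rfl⟩ := fromShift_surjective B X (-r) c
  rw [diff_fromShift, ← map_smul, ← map_smul] at hc
  exact ⟨_, fromShift_injective B X (-r) hc⟩

theorem eq_of_x_eq {B B' : Twisted A} (hι : B.ι = B'.ι) (hf : HEq B.fintype B'.fintype)
    (ho : HEq B.obj B'.obj) (hd : HEq B.deg B'.deg) (hl : HEq B.level B'.level)
    (hx : HEq B.x B'.x) : B = B' := by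
  cases B; cases B'
  dsimp only at *
  subst hι
  cases hf; cases ho; cases hd; cases hl; cases hx
  rfl

end Twisted

/-! ### Vanishing in the derived category -/

namespace TwOb

variable {K : Type w} [Field K] {A : AInfCategory.{w, u, v} K}

/-- The entry of `δ` from `i` to `j` has reduced degree `deg i - deg j`; lowering the source degree
by `σ` changes its rescaling sign by `σ` times this number. -/
theorem toTwisted_shift (B : TwOb A) (σ : ℤ) : (B.shift σ).toTwisted = B.toTwisted.shift σ := by
  refine Twisted.eq_of_x_eq rfl HEq.rfl HEq.rfl HEq.rfl HEq.rfl (heq_of_eq ?_)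
  refine funext fun (i : B.ι) => funext fun (j : B.ι) => ?_
  refine (signTwist_apply _ _ _ _ (B.δ_mem i j)).trans ?_
  refine Eq.trans ?_ (congrArg (_ • ·) (signTwist_apply _ _ _ _ (B.δ_mem i j)).symm)
  dsimp only
  rw [smul_smul]
  congr 1
  change sgn K _ = sgn K _ * sgn K _
  rw [← sgn_neg (_ - _), ← sgn_add]
  congr 1
  change (B.deg i - σ) * _ = _
  ring

theorem toTwisted_single (V : A.Ob) : (single V).toTwisted = Twisted.ofOb V 0 := by
  refine Twisted.eq_of_x_eq rfl HEq.rfl HEq.rfl HEq.rfl (heq_of_eq ?_) (heq_of_eq ?_)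
  · funext (i : Unit)
    exact Nat.lt_one_iff.1 (level_lt_card (single V) i)
  · funext (i : Unit) (j : Unit)
    exact map_zero (signTwist (A.gr V V) (A.gr_internal V V) 0)

theorem exactHom_iff_right {X B : TwOb A} : X.toTwisted.ExactHom B.toTwisted ↔
    ∀ σ : ℤ, Subsingleton (DHom X (B.shift σ)) := by
  simp only [subsingleton_dHom_iff, toTwisted_shift]
  exact ⟨fun h σ a _ => h.shift_right σ a, .of_shift_right⟩

theorem exactHom_iff_left {B X : TwOb A} : B.toTwisted.ExactHom X.toTwisted ↔
    ∀ σ : ℤ, Subsingleton (DHom (B.shift σ) X) := by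
  simp only [subsingleton_dHom_iff, toTwisted_shift]
  exact ⟨fun h σ a _ => h.shift_left σ a, .of_shift_left⟩

theorem isZero_of_exactHom [A.CUnital] {B : TwOb A} (h : B.toTwisted.ExactHom B.toTwisted) :
    B.IsZero := fun X =>
  ⟨subsingleton_dHom_iff.2 fun a _ => h.left X.toTwisted a,
    subsingleton_dHom_iff.2 fun a _ => h.right X.toTwisted a⟩

theorem IsZero.exactHom {B : TwOb A} (h : B.IsZero) : B.toTwisted.ExactHom B.toTwisted :=
  exactHom_iff_right.2 fun σ => (h (B.shift σ)).2

theorem mem_rightOrthogonal_iff {X B : TwOb A} :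
    B ∈ rightOrthogonal X ↔ X.toTwisted.ExactHom B.toTwisted := exactHom_iff_right.symm

/-- If `V` were zero, its endomorphism algebra would be the zero ring, and `x^(n+1)`, hence `x`,
would be a unit of the polynomial ring. -/
theorem not_isZero_single [A.CUnital] {n : ℕ} {V : A.Ob} {h : V ⟶ V} (hV : A.IsCPObject n V h) :
    ¬ (single V).IsZero := by
  intro hz
  have he := hz.exactHom
  rw [toTwisted_single] at he
  have hs : Subsingleton (A.H V V) := by
    refine subsingleton_of_forall_eq 0 fun x => ?_
    obtain ⟨a, ha, rfl⟩ := A.cls_surjective x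
    rw [A.cls_eq_zero]
    obtain ⟨c, hc⟩ := he (Twisted.ofHom 0 0 a) (by
      rw [Twisted.diff_ofHom, ha, map_zero, smul_zero])
    obtain ⟨c, rfl⟩ := Twisted.ofHom_surjective c
    rw [Twisted.diff_ofHom, sgn_zero, one_smul] at hc
    exact ⟨c, congrFun (congrFun hc ()) ()⟩
  obtain ⟨φ, -⟩ := hV.end_iso
  have hq : Subsingleton (K[X] ⧸ Ideal.span {(Polynomial.X : K[X]) ^ (n + 1)}) :=
    φ.toEquiv.subsingleton_congr.2 hs
  rw [Ideal.Quotient.subsingleton_iff, Ideal.span_singleton_eq_top] at hq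
  exact Polynomial.not_isUnit_X (isUnit_pow_succ_iff.1 hq)

end TwOb

theorem mainTheorem8 {K : Type w} [Field K] (A : AInfCategory.{w, u, v} K) [A.CUnital]
    (n : ℕ) (V : A.Ob) (h : V ⟶ V) (hV : A.IsCPObject n V h) :
    TwOb.IsSpanningClass ({TwOb.single V} ∪ TwOb.rightOrthogonal (TwOb.single V)) where
  nontrivial := ⟨_, Or.inl rfl, TwOb.not_isZero_single hV⟩
  right B hB := by
    -- Testing against `V` puts `B` into `Ω`, so the hypothesis applies to `B` itself.
    have hperp : B ∈ TwOb.rightOrthogonal (TwOb.single V) := hB _ (Or.inl rfl)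
    exact TwOb.isZero_of_exactHom (TwOb.exactHom_iff_right.2 (hB B (Or.inr hperp)))
  left B hB := by
    obtain ⟨I, hI⟩ := hV.duality
    obtain ⟨θ, hθ⟩ := AInfCategory.exists_isDualizing hI
    have h₁ := TwOb.exactHom_iff_left.2 (hB _ (Or.inl rfl))
    rw [TwOb.toTwisted_single] at h₁
    -- Duality exchanges the two sides, which is what places `B` in the right orthogonal of `V`.
    have h₂ := Twisted.exactHom_of_isDualizing hθ h₁
    rw [← TwOb.toTwisted_single] at h₂
    exact TwOb.isZero_of_exactHom (TwOb.exactHom_iff_left.2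
      (hB B (Or.inr (TwOb.mem_rightOrthogonal_iff.2 h₂))))
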